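/- Let $B\ge 1$ be an integer, let $\alpha>0$ and $\Delta>0$, and let $P_0=\sum_{k=1}^{K}p_k\,\delta_{\mathbf a_k}$ be a probability measure on $\mathbb R^B$ with finitely many atoms. For $L,M\ge 1$ let $\mathbf S=(\mathbf S_1,\dots,\mathbf S_L)\in\mathbb R^{LB}$ consist of $L$ independent sections $\mathbf S_l\sim P_0$, let $\boldsymbol\Phi\in\mathbb R^{M\times LB}$ have independent entries $\Phi_{\mu i}\sim\mathcal N(0,1/L)$, let $\mathbf Z\sim\mathcal N(0,\mathbf I_M)$, with $\mathbf S,\boldsymbol\Phi,\mathbf Z$ independent, and let $\mathbf Y=\boldsymbol\Phi\mathbf S+\sqrt\Delta\,\mathbf Z$. Given $\boldsymbol\Phi$, write $P^{\rm cs}(\mathbf s,\mathbf y)$ for the joint density of $(\mathbf S,\mathbf Y)$ and $P^{\rm cs}(\mathbf y)$ for the density of $\mathbf Y$. The mutual information per section is $$i^{\rm cs}_{L,M}=\frac1L\,\mathbb E\left[\ln\frac{P^{\rm cs}(\mathbf S,\mathbf Y)}{P_0(\mathbf S)\,P^{\rm cs}(\mathbf Y)}\right],$$ where $\mathbb E$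 is over $\boldsymbol\Phi,\mathbf S,\mathbf Z$ and $P_0(\mathbf s)=\prod_l P_0(\mathbf s_l)$. Put $v=\sum_k p_k\|\mathbf a_k\|_2^2$ and, for $E\in[0,v]$, let $\Sigma(E;\Delta)>0$ be given by $\Sigma(E;\Delta)^{-2}=\alpha B/(\Delta+E)$ and $$i^{\rm RS}(E;\Delta)=\frac{\alpha B}{2}\left[\ln\left(1+\frac E\Delta\right)-\frac{E}{E+\Delta}\right]+i\big(\widetilde{\mathbf S};\widetilde{\mathbf S}+\Sigma(E;\Delta)\widetilde{\mathbf Z}\big),$$ $$i\big(\widetilde{\mathbf S};\widetilde{\mathbf S}+\Sigma\widetilde{\mathbf Z}\big)=-\mathbb E_{\widetilde{\mathbf S},\widetilde{\mathbf Z}}\left[\ln\mathbb E_{\widetilde{\mathbf X}}\left[\exp\left(-\frac{\|\widetilde{\mathbf X}-(\widetilde{\mathbf S}+\Sigma\widetilde{\mathbf Z})\|_2^2}{2\Sigma^2}\right)\right]\right]-\frac B2,$$ where $\widetilde{\mathbf S},\widetilde{\mathbf X}\sim P_0$ and $\widetilde{\mathbf Z}\sim\mathcal N(0,\mathbf I_B)$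 are independent. Then the expectations above are finite, and as $L\to\infty$ with measurement rate $M_L/(LB)\to\alpha$ the limit of $i^{\rm cs}_{L,M_L}$ exists, takes the same value for every such sequence $(M_L)$, and satisfies $$\lim_{L\to\infty}i^{\rm cs}_{L,M_L}\le\min_{E\in[0,v]}i^{\rm RS}(E;\Delta),$$ where the minimum is attained. -/

import Mathlib

open MeasureTheory ProbabilityTheory Filter Topology

noncomputable section

/-- A discrete prior on `ℝ^B`: a probability measure `∑ i, p i • δ_{a i}` with finitely many
atoms. -/
def IsDiscretePrior {B : ℕ} (P₀ : Measure (Fin B → ℝ)) : Prop :=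
  ∃ (K : ℕ) (p : Fin K → ℝ) (a : Fin K → Fin B → ℝ),
    (∀ i, 0 ≤ p i) ∧ ∑ i, p i = 1 ∧
      P₀ = ∑ i, ENNReal.ofReal (p i) • Measure.dirac (a i)

/-- The second moment `v = 𝔼 ‖S‖₂²` of one section `S ∼ P₀`. -/
def secondMoment {B : ℕ} (P₀ : Measure (Fin B → ℝ)) : ℝ :=
  ∫ s, ∑ b, s b ^ 2 ∂P₀

/-- The law of `n` independent standard normal variables. -/
def stdNormal (n : ℕ) : Measure (Fin n → ℝ) :=
  Measure.pi fun _ => gaussianReal 0 1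

/-- The law of the signal: `L` independent sections distributed according to `P₀`. -/
def signalLaw {B : ℕ} (P₀ : Measure (Fin B → ℝ)) (L : ℕ) : Measure (Fin L → Fin B → ℝ) :=
  Measure.pi fun _ => P₀

/-- The law of the `M × (L B)` measurement matrix, with independent `N(0, 1/L)` entries. The
columns are indexed by pairs (section, component in the section). -/
def matrixLaw (B L M : ℕ) : Measure (Fin M → Fin L × Fin B → ℝ) :=
  Measure.pi fun _ => Measure.pi fun _ => gaussianReal 0 (1 / (L : NNReal))

/-- The projection `φ s`, with coordinates `∑ i, φ μ i * s i`. -/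
def project {B L M : ℕ} (φ : Fin M → Fin L × Fin B → ℝ) (s : Fin L → Fin B → ℝ) :
    Fin M → ℝ :=
  fun μ => ∑ i : Fin L × Fin B, φ μ i * s i.1 i.2

/-- The measurement `y = φ s + z √Δ`. -/
def measurement {B L M : ℕ} (Δ : ℝ) (φ : Fin M → Fin L × Fin B → ℝ)
    (s : Fin L → Fin B → ℝ) (z : Fin M → ℝ) : Fin M → ℝ :=
  fun μ => project φ s μ + z μ * √Δ

/-- The conditional density `P(y | s)` of the measurement given the signal (and the matrix),
with respect to Lebesgue measure on `ℝ^M`. -/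
def likelihood {B L M : ℕ} (Δ : ℝ) (φ : Fin M → Fin L × Fin B → ℝ)
    (s : Fin L → Fin B → ℝ) (y : Fin M → ℝ) : ℝ :=
  (2 * Real.pi * Δ) ^ (-(M : ℝ) / 2) *
    Real.exp (-(1 / (2 * Δ)) * ∑ μ, (project φ s μ - y μ) ^ 2)

/-- The density `P(y)` of the measurement (given the matrix): the likelihood averaged over the
law of the signal. -/
def evidence {B L M : ℕ} (Δ : ℝ) (P₀ : Measure (Fin B → ℝ))
    (φ : Fin M → Fin L × Fin B → ℝ) (y : Fin M → ℝ) : ℝ :=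
  ∫ x, likelihood Δ φ x y ∂(signalLaw P₀ L)

/-- The joint law of the matrix, the signal and the normalized noise, which are independent. -/
def quenchedLaw {B : ℕ} (P₀ : Measure (Fin B → ℝ)) (L M : ℕ) :
    Measure ((Fin M → Fin L × Fin B → ℝ) × (Fin L → Fin B → ℝ) × (Fin M → ℝ)) :=
  (matrixLaw B L M).prod ((signalLaw P₀ L).prod (stdNormal M))

/-- The information density `ln (P(s, y) / (P₀(s) P(y))) = ln (P(y | s) / P(y))` at
`y = φ s + z √Δ`, as a function of the quenched variables `(φ, s, z)`. -/
def informationDensity {B : ℕ} (Δ : ℝ) (P₀ : Measure (Fin B → ℝ)) (L M : ℕ)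
    (q : (Fin M → Fin L × Fin B → ℝ) × (Fin L → Fin B → ℝ) × (Fin M → ℝ)) : ℝ :=
  Real.log (likelihood Δ q.1 q.2.1 (measurement Δ q.1 q.2.1 q.2.2) /
    evidence Δ P₀ q.1 (measurement Δ q.1 q.2.1 q.2.2))

/-- The mutual information per section of the linear estimation model with `L` sections and
`M` measurements. -/
def iCS {B : ℕ} (Δ : ℝ) (P₀ : Measure (Fin B → ℝ)) (L M : ℕ) : ℝ :=
  (1 / (L : ℝ)) * ∫ q, informationDensity Δ P₀ L M q ∂(quenchedLaw P₀ L M)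

/-- For the denoising model `y = s + z σ` on `ℝ^B`: the logarithm of
`𝔼_X exp (-‖X - (s + z σ)‖² / (2 σ²))`, as a function of `(s, z)`. -/
def denoisingLogPartition {B : ℕ} (P₀ : Measure (Fin B → ℝ)) (σ : ℝ)
    (q : (Fin B → ℝ) × (Fin B → ℝ)) : ℝ :=
  Real.log (∫ x, Real.exp (-∑ b, (x b - (q.1 b + q.2 b * σ)) ^ 2 / (2 * σ ^ 2)) ∂P₀)

/-- The mutual information `i(S; S + Z σ)` of the denoising model, `S ∼ P₀`, `Z ∼ N(0, I_B)`. -/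
def iDenoising {B : ℕ} (P₀ : Measure (Fin B → ℝ)) (σ : ℝ) : ℝ :=
  -(∫ q, denoisingLogPartition P₀ σ q ∂(P₀.prod (stdNormal B))) - (B : ℝ) / 2

/-- The effective noise level `Σ(E; Δ)`, given by `Σ⁻² = α B / (Δ + E)`. -/
def effectiveNoise (B : ℕ) (α Δ E : ℝ) : ℝ :=
  √((α * B / (Δ + E))⁻¹)

/-- `ψ(E; Δ) = α B [ln (1 + E / Δ) - E / (E + Δ)] / 2`. -/
def psiRS (B : ℕ) (α Δ E : ℝ) : ℝ :=
  α * B * (Real.log (1 + E / Δ) - E / (E + Δ)) / 2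

/-- The replica symmetric potential
`i^RS(E; Δ) = ψ(E; Δ) + i(S; S + Z Σ(E; Δ))`. -/
def iRS {B : ℕ} (P₀ : Measure (Fin B → ℝ)) (α Δ E : ℝ) : ℝ :=
  psiRS B α Δ E + iDenoising P₀ (effectiveNoise B α Δ E)

end

open scoped NNReal
set_option linter.unusedSectionVars false
noncomputable section

/-! The proof works with remaining uncertainty instead of mutual information. A posterior on a
finite alphabet is kept as an unnormalised weight vector, and entropies and variances are positively
homogeneous functionals of it. Observing a channel then acts linearly on functionals: `Channel.op`
averages the functional of the updated weights over the output. These operators are positive,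
preserve the mass, and commute, because outputs are independent given the input. If `T` is the
operator of one measurement row, `T ^ M` applied to the entropy is what `M` rows leave. The model's
information per section is the entropy of a section minus `residualEntropy` over `L` (`iCS_eq`), and
the denoising information is that entropy minus `scalarResidualEntropy` (`iRS_eq`).

The bound by the potential is an interpolation. Let `S` be a weak scalar Gaussian observation of
every component of the signal, with precision of order `1 / L`, and put `δ = 1 / Δ`. A row reveals
at most an affine function of the averaged posterior variance, namely the tangent at `E` of `log (1
+ δ V) / 2` (`entropy_sub_rowChannel_le`). A use of `S` reveals at least half its precision times
the variance that remains afterwards (`le_entropy_sub_sideOp`, an integrated form of the relation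
between information and mean square error). The precision of `S` is chosen so that the two slopes
agree. Trading a `T` for an `S` then costs a constant plus a difference of variances that telescopes
(`sideOp_le_rowChannel`). Since `S` treats sections separately, trading all rows leaves `L`
independent denoising problems. The `N` additional uses of `S` disappear as `L → ∞`, and the
remaining error as `N → ∞` (`le_of_tendsto_residualEntropy_div`).

The existence of the limit is an approximate subadditivity of the residual entropy. A joint row is
compared with a row that sees a single block of sections, chosen with probability proportional to
its size. Let `e` be the posterior variance per section. By concavity of the logarithm, block rows
reveal at most `log (1 + δ e) / 2` on average. A joint row reveals almost that much, by a central
limit argument for random projections, if squared norms and overlaps of posterior samples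
concentrate (`exists_le_entropy_sub_rowChannel`). Their fluctuations are controlled by how much
revealing the label of a random section lowers the average label variance (`exists_fluctuation_le`).
Over successive revelations these decreases sum to a bounded quantity. Averaging over up to `N`
revelations therefore makes them negligible, at an entropy cost of order `N` (`pow_sub_pow_le`). A
block of size `n` receives a binomial number of rows, which is replaced by its mean at a cost of
order `√n` (`lazy_pow_apply_le`). Hence the upper limit of the residual entropy per section is at
most its value at size `n` plus `O(1 / √n)`, for every `n`, which forces convergence. -/

/-! ### Homogeneous functionals of weight vectors -/

/-- Measurable, positively homogeneous functionals of finite weight vectors that are bounded by a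
multiple of the total weight. -/
def Functional (𝒳 : Type*) [Fintype 𝒳] : Submodule ℝ ((𝒳 → ℝ≥0) → ℝ) where
  carrier := {F | Measurable F ∧ (∀ (c : ℝ≥0) (w : 𝒳 → ℝ≥0), F (fun x => c * w x) = c * F w) ∧
    ∃ C : ℝ, ∀ w, |F w| ≤ C * ∑ x, (w x : ℝ)}
  add_mem' := by
    rintro F G ⟨hF, hF', C, hC⟩ ⟨hG, hG', D, hD⟩
    refine ⟨hF.add hG, fun c w => ?_, C + D, fun w => ?_⟩
    · simp only [Pi.add_apply, hF', hG']; ring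
    · rw [add_mul]
      exact (abs_add_le _ _).trans (add_le_add (hC w) (hD w))
  zero_mem' := ⟨measurable_const, fun c w => by simp, 0, fun w => by simp⟩
  smul_mem' := by
    rintro a F ⟨hF, hF', C, hC⟩
    refine ⟨hF.const_smul a, fun c w => ?_, |a| * C, fun w => ?_⟩
    · simp only [Pi.smul_apply, smul_eq_mul, hF']; ring
    · simp only [Pi.smul_apply, smul_eq_mul, abs_mul, mul_assoc]
      exact mul_le_mul_of_nonneg_left (hC w) (abs_nonneg a)

namespace Functional

variable {𝒳 : Type*} [Fintype 𝒳]

instance : CoeFun (Functional 𝒳) (fun _ => (𝒳 → ℝ≥0) → ℝ) := ⟨fun F => F.1⟩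

lemma measurable (F : Functional 𝒳) : Measurable F := F.2.1

lemma homogeneous (F : Functional 𝒳) (c : ℝ≥0) (w : 𝒳 → ℝ≥0) :
    F (fun x => c * w x) = c * F w := F.2.2.1 c w

lemma exists_bound (F : Functional 𝒳) : ∃ C : ℝ, 0 ≤ C ∧ ∀ w, |F w| ≤ C * ∑ x, (w x : ℝ) := by
  obtain ⟨C, hC⟩ := F.2.2.2
  refine ⟨max C 0, le_max_right _ _, fun w => (hC w).trans ?_⟩
  exact mul_le_mul_of_nonneg_right (le_max_left _ _) (by positivity)

lemma ext' {F G : Functional 𝒳} (h : ∀ w, F w = G w) : F = G := Subtype.ext (funext h)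

@[simp] lemma add_apply (F G : Functional 𝒳) (w : 𝒳 → ℝ≥0) : (F + G) w = F w + G w := rfl
@[simp] lemma sub_apply (F G : Functional 𝒳) (w : 𝒳 → ℝ≥0) : (F - G) w = F w - G w := rfl
@[simp] lemma smul_apply (a : ℝ) (F : Functional 𝒳) (w : 𝒳 → ℝ≥0) : (a • F) w = a * F w := rfl
lemma sum_apply {ι : Type*} (s : Finset ι) (F : ι → Functional 𝒳) (w : 𝒳 → ℝ≥0) :
    (∑ i ∈ s, F i) w = ∑ i ∈ s, F i w := by
  classical
  induction s using Finset.induction_on with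
  | empty => simp
  | insert a s ha ih => rw [Finset.sum_insert ha, Finset.sum_insert ha, add_apply, ih]

/-- By homogeneity, inequalities between functionals can be tested on probability vectors. -/
lemma le_of_forall_prob {F G : Functional 𝒳} (h : ∀ w, ∑ x, w x = 1 → F w ≤ G w) : F ≤ G := by
  intro w
  by_cases h0 : ∑ x, w x = 0
  · have hw : w = fun x => 0 * w x := by
      funext x
      simpa using (Finset.sum_eq_zero_iff.mp h0) x (Finset.mem_univ x)
    show F w ≤ G w
    rw [hw, homogeneous F, homogeneous G]; simp
  · have hw : w = fun x => (∑ x, w x) * ((∑ x, w x)⁻¹ * w x) := by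
      funext x; field_simp
    have h1 : ∑ x, (∑ x, w x)⁻¹ * w x = 1 := by
      rw [← Finset.mul_sum]; field_simp
    show F w ≤ G w
    rw [hw, homogeneous F, homogeneous G]
    exact mul_le_mul_of_nonneg_left (h _ h1) (NNReal.coe_nonneg _)

/-- The total weight. -/
def mass (𝒳 : Type*) [Fintype 𝒳] : Functional 𝒳 :=
  ⟨fun w => ∑ x, (w x : ℝ), by fun_prop, fun c w => by simp [Finset.mul_sum], 1, fun w => by
    rw [abs_of_nonneg (by positivity), one_mul]⟩

lemma mass_apply (w : 𝒳 → ℝ≥0) : mass 𝒳 w = ∑ x, (w x : ℝ) := rfl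

lemma mass_nonneg : 0 ≤ mass 𝒳 := fun w => by
  show (0 : ℝ) ≤ ∑ x, (w x : ℝ); positivity

/-- The entropy `W ln W - ∑ w ln w` of a weight vector with total weight `W`. -/
def entropyFun (w : 𝒳 → ℝ≥0) : ℝ :=
  ∑ x, Real.negMulLog (w x) - Real.negMulLog (∑ x, (w x : ℝ))

lemma entropyFun_eq (w : 𝒳 → ℝ≥0) : entropyFun w =
    (∑ x, (w x : ℝ)) * Real.log (∑ x, (w x : ℝ)) - ∑ x, (w x : ℝ) * Real.log (w x) := by
  simp only [entropyFun, Real.negMulLog, neg_mul, Finset.sum_neg_distrib]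
  ring

/-- The left side is the tangent line at `b` of the convex function `x log x`. With `b` an explicit
density it gives lower bounds for posterior entropies. -/
lemma _root_.Real.mul_log_ge {a b : ℝ} (ha : 0 ≤ a) (hb : 0 < b) :
    a * Real.log b + a - b ≤ a * Real.log a := by
  rcases ha.eq_or_lt with rfl | ha
  · simp; exact hb.le
  · have h := Real.log_le_sub_one_of_pos (div_pos hb ha)
    rw [Real.log_div hb.ne' ha.ne'] at h
    have := mul_le_mul_of_nonneg_left h ha.le
    have h2 : a * (b / a - 1) = b - a := by field_simp
    rw [h2] at this
    linarith

/-- This is `log t ≤ t - 1` at `t = a / b`. The bound is quadratic in `a`, so averaging it requires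
only two moments. -/
lemma _root_.Real.mul_log_le {a b : ℝ} (ha : 0 ≤ a) (hb : 0 < b) :
    a * Real.log a ≤ a * Real.log b + a * (a / b - 1) := by
  rcases ha.eq_or_lt with rfl | ha
  · simp
  · have h := Real.log_le_sub_one_of_pos (div_pos ha hb)
    rw [Real.log_div ha.ne' hb.ne'] at h
    have := mul_le_mul_of_nonneg_left h ha.le
    linarith

/-- Gibbs' inequality. -/
lemma entropyFun_le (v : 𝒳 → ℝ≥0) (w : 𝒳 → ℝ≥0) (hvw : ∀ x, w x = 0 → v x = 0) :
    entropyFun v ≤ ∑ x, (v x : ℝ) * (Real.log (∑ x, (w x : ℝ)) - Real.log (w x)) := by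
  rw [entropyFun_eq]
  by_cases hV : ∑ x, v x = 0
  · have hv : ∀ x, v x = 0 := fun x => (Finset.sum_eq_zero_iff.mp hV) x (Finset.mem_univ x)
    simp [hv]
  have hV' : (0 : ℝ) < ∑ x, (v x : ℝ) := by
    rw [← NNReal.coe_sum]; exact_mod_cast pos_iff_ne_zero.mpr hV
  have hW : ∑ x, w x ≠ 0 := by
    intro hW
    apply hV
    refine Finset.sum_eq_zero fun x hx => hvw x ((Finset.sum_eq_zero_iff.mp hW) x hx)
  have hW' : (0 : ℝ) < ∑ x, (w x : ℝ) := by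
    rw [← NNReal.coe_sum]; exact_mod_cast pos_iff_ne_zero.mpr hW
  set V := ∑ x, (v x : ℝ)
  set S := ∑ x, (w x : ℝ)
  -- Tangent line of `x log x` at `w x` rescaled to total mass `V`; after summation over `x` the
  -- linear corrections cancel.
  have key : ∀ x, (v x : ℝ) * (Real.log (w x) + Real.log V - Real.log S) + v x - w x * V / S ≤
      v x * Real.log (v x) := by
    intro x
    by_cases hx : w x = 0
    · simp [hx, hvw x hx]
    · have hx' : (0 : ℝ) < w x := by exact_mod_cast pos_iff_ne_zero.mpr hx
      have := Real.mul_log_ge (v x).coe_nonneg (show (0 : ℝ) < w x * V / S by positivity)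
      rwa [Real.log_div (by positivity) hW'.ne', Real.log_mul hx'.ne' hV'.ne'] at this
  have h1 := Finset.sum_le_sum fun x (_ : x ∈ Finset.univ) => key x
  have h2 : ∑ x, (w x : ℝ) * V / S = V := by
    rw [← Finset.sum_div, ← Finset.sum_mul]; show S * V / S = V; field_simp
  simp only [Finset.sum_sub_distrib, Finset.sum_add_distrib, h2] at h1
  have h3 : ∑ x, (v x : ℝ) * (Real.log (w x) + Real.log V - Real.log S) =
      ∑ x, (v x : ℝ) * (Real.log (w x) - Real.log S) + V * Real.log V := by
    rw [show V * Real.log V = ∑ x, (v x : ℝ) * Real.log V by rw [Finset.sum_mul],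
      ← Finset.sum_add_distrib]
    exact Finset.sum_congr rfl fun x _ => by ring
  have h4 : ∑ x, (v x : ℝ) * (Real.log S - Real.log (w x)) =
      - ∑ x, (v x : ℝ) * (Real.log (w x) - Real.log S) := by
    rw [← Finset.sum_neg_distrib]
    exact Finset.sum_congr rfl fun x _ => by ring
  have h5 : ∑ x, (v x : ℝ) = V := rfl
  rw [h4]
  linarith

lemma entropyFun_nonneg (w : 𝒳 → ℝ≥0) : 0 ≤ entropyFun w := by
  rw [entropyFun_eq, Finset.sum_mul, ← Finset.sum_sub_distrib]
  refine Finset.sum_nonneg fun x _ => ?_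
  by_cases hx : w x = 0
  · simp [hx]
  · have hx' : (0 : ℝ) < w x := by exact_mod_cast pos_iff_ne_zero.mpr hx
    rw [← mul_sub]
    refine mul_nonneg hx'.le (sub_nonneg.mpr (Real.log_le_log hx' ?_))
    exact Finset.single_le_sum (f := fun x => (w x : ℝ)) (fun x _ => (w x).coe_nonneg)
      (Finset.mem_univ x)

/-- By `log t ≤ t - 1` each letter contributes at most the total mass. The sharp constant `log card`
is not needed: only a linear bound in the mass matters. -/
lemma entropyFun_le_card (w : 𝒳 → ℝ≥0) :
    entropyFun w ≤ Fintype.card 𝒳 * ∑ x, (w x : ℝ) := by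
  have h := entropyFun_le w w fun _ h => h
  refine h.trans ?_
  rw [← nsmul_eq_mul, ← Finset.card_univ, ← Finset.sum_const]
  refine Finset.sum_le_sum fun x _ => ?_
  have hx := Finset.single_le_sum (f := fun x => (w x : ℝ)) (fun x _ => (w x).coe_nonneg)
      (Finset.mem_univ x)
  by_cases h0 : w x = 0
  · simp [h0]; positivity
  · have hx' : (0 : ℝ) < w x := by exact_mod_cast pos_iff_ne_zero.mpr h0
    have hS : (0 : ℝ) < ∑ x, (w x : ℝ) := hx'.trans_le hx
    have h1 := Real.log_le_sub_one_of_pos (div_pos hS hx')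
    rw [Real.log_div hS.ne' hx'.ne'] at h1
    have := mul_le_mul_of_nonneg_left h1 hx'.le
    have h2 : (w x : ℝ) * ((∑ x, (w x : ℝ)) / w x - 1) = (∑ x, (w x : ℝ)) - w x := by field_simp
    linarith

/-- The entropy as a functional. -/
def entropy (𝒳 : Type*) [Fintype 𝒳] : Functional 𝒳 :=
  ⟨entropyFun, by unfold entropyFun; fun_prop, fun c w => by
    simp only [entropyFun, NNReal.coe_mul, ← Finset.mul_sum, Real.negMulLog_mul,
      Finset.sum_add_distrib, ← Finset.sum_mul]
    ring, Fintype.card 𝒳, fun w => by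
    rw [abs_of_nonneg (entropyFun_nonneg w)]
    exact entropyFun_le_card w⟩

lemma entropy_apply (w : 𝒳 → ℝ≥0) : entropy 𝒳 w = entropyFun w := rfl

lemma entropy_nonneg : 0 ≤ entropy 𝒳 := fun w => entropyFun_nonneg w

/-- The (weighted) variance of `f`. -/
def varianceFun (f : 𝒳 → ℝ) (w : 𝒳 → ℝ≥0) : ℝ :=
  ∑ x, w x * f x ^ 2 - (∑ x, w x * f x) ^ 2 / ∑ x, (w x : ℝ)

lemma eq_zero_of_sum_coe {w : 𝒳 → ℝ≥0} (h : ∑ x, (w x : ℝ) = 0) (x : 𝒳) : w x = 0 := by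
  have := (Finset.sum_eq_zero_iff_of_nonneg (fun x _ => (w x).coe_nonneg)).mp h x (Finset.mem_univ x)
  exact_mod_cast this

lemma varianceFun_eq (f : 𝒳 → ℝ) (w : 𝒳 → ℝ≥0) : varianceFun f w =
    ∑ x, w x * (f x - (∑ x, w x * f x) / ∑ x, (w x : ℝ)) ^ 2 := by
  unfold varianceFun
  by_cases h : ∑ x, (w x : ℝ) = 0
  · simp [eq_zero_of_sum_coe h]
  set m := (∑ x, w x * f x) / ∑ x, (w x : ℝ) with hm
  have h1 : ∀ x, (w x : ℝ) * (f x - m) ^ 2 = w x * f x ^ 2 - 2 * m * (w x * f x) + m ^ 2 * w x :=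
    fun x => by ring
  simp only [h1, Finset.sum_add_distrib, Finset.sum_sub_distrib, ← Finset.mul_sum]
  rw [hm]; field_simp; ring

/-- The mean is the optimal centre: the two sides differ by the mass times the squared distance from
`c` to the mean. At zero mass all weights vanish, so the division by zero is harmless. -/
lemma varianceFun_le (f : 𝒳 → ℝ) (w : 𝒳 → ℝ≥0) (c : ℝ) :
    varianceFun f w ≤ ∑ x, w x * (f x - c) ^ 2 := by
  unfold varianceFun
  by_cases h : ∑ x, (w x : ℝ) = 0
  · simp [eq_zero_of_sum_coe h]
  have hpos : 0 < ∑ x, (w x : ℝ) := lt_of_le_of_ne (by positivity) (Ne.symm h)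
  have h1 : ∀ x, (w x : ℝ) * (f x - c) ^ 2 = w x * f x ^ 2 - 2 * c * (w x * f x) + c ^ 2 * w x :=
    fun x => by ring
  simp only [h1, Finset.sum_add_distrib, Finset.sum_sub_distrib, ← Finset.mul_sum]
  set A := ∑ x, w x * f x
  set S := ∑ x, (w x : ℝ)
  have : 0 ≤ (A - c * S) ^ 2 / S := by positivity
  have h2 : (A - c * S) ^ 2 / S = A ^ 2 / S - 2 * c * A + c ^ 2 * S := by field_simp; ring
  linarith

lemma varianceFun_nonneg (f : 𝒳 → ℝ) (w : 𝒳 → ℝ≥0) : 0 ≤ varianceFun f w := by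
  rw [varianceFun_eq]; positivity

/-- The variance of `f` as a functional. -/
def variance (f : 𝒳 → ℝ) : Functional 𝒳 :=
  ⟨varianceFun f, by unfold varianceFun; fun_prop, fun c w => by
    simp only [varianceFun, NNReal.coe_mul, mul_assoc, ← Finset.mul_sum]
    by_cases hc : (c : ℝ) = 0
    · simp [hc]
    by_cases h : ∑ x, (w x : ℝ) = 0
    · simp [eq_zero_of_sum_coe h]
    field_simp, ∑ x, f x ^ 2, fun w => by
    rw [abs_of_nonneg (varianceFun_nonneg f w)]
    refine (varianceFun_le f w 0).trans ?_
    rw [Finset.mul_sum]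
    refine Finset.sum_le_sum fun x _ => ?_
    rw [sub_zero, mul_comm]
    refine mul_le_mul_of_nonneg_right ?_ (w x).coe_nonneg
    exact Finset.single_le_sum (f := fun x => f x ^ 2) (fun x _ => sq_nonneg _)
      (Finset.mem_univ x)⟩

lemma variance_apply (f : 𝒳 → ℝ) (w : 𝒳 → ℝ≥0) : variance f w = varianceFun f w := rfl

lemma variance_nonneg (f : 𝒳 → ℝ) : 0 ≤ variance f := fun w => varianceFun_nonneg f w

lemma variance_le_mass {f : 𝒳 → ℝ} {c : ℝ} (h : ∀ x, f x ^ 2 ≤ c) :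
    variance f ≤ c • mass 𝒳 := fun w => by
  refine (varianceFun_le f w 0).trans ?_
  show _ ≤ c * ∑ x, (w x : ℝ)
  rw [Finset.mul_sum]
  refine Finset.sum_le_sum fun x _ => ?_
  rw [sub_zero, mul_comm]
  exact mul_le_mul_of_nonneg_right (h x) (w x).coe_nonneg

end Functional

/-! ### Averaging operators -/

/-- Positive operators on functionals that preserve the total weight. -/
structure IsAveraging {𝒳 : Type*} [Fintype 𝒳] (T : Module.End ℝ (Functional 𝒳)) : Prop where
  nonneg : ∀ F, 0 ≤ F → 0 ≤ T F
  mass : T (Functional.mass 𝒳) = Functional.mass 𝒳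

namespace IsAveraging

variable {𝒳 : Type*} [Fintype 𝒳] {S T : Module.End ℝ (Functional 𝒳)}

lemma mono (hT : IsAveraging T) {F G : Functional 𝒳} (h : F ≤ G) : T F ≤ T G := by
  have := hT.nonneg (G - F) (sub_nonneg.mpr h)
  rwa [map_sub, sub_nonneg] at this

lemma one : IsAveraging (1 : Module.End ℝ (Functional 𝒳)) := ⟨fun _ h => h, rfl⟩

lemma mul (hS : IsAveraging S) (hT : IsAveraging T) : IsAveraging (S * T) :=
  ⟨fun F h => hS.nonneg _ (hT.nonneg F h), by rw [Module.End.mul_apply, hT.mass, hS.mass]⟩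

lemma pow (hT : IsAveraging T) (n : ℕ) : IsAveraging (T ^ n) := by
  induction n with
  | zero => simpa using one
  | succ n ih => rw [pow_succ]; exact ih.mul hT

lemma list_prod {l : List (Module.End ℝ (Functional 𝒳))} (h : ∀ T ∈ l, IsAveraging T) :
    IsAveraging l.prod := by
  induction l with
  | nil => simpa using one
  | cons a l ih =>
    rw [List.prod_cons]
    exact (h a (by simp)).mul (ih fun T hT => h T (by simp [hT]))

lemma convex {ι : Type*} [Fintype ι] {c : ι → ℝ} (hc : ∀ i, 0 ≤ c i) (hc1 : ∑ i, c i = 1)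
    {T : ι → Module.End ℝ (Functional 𝒳)} (hT : ∀ i, IsAveraging (T i)) :
    IsAveraging (∑ i, c i • T i) := by
  refine ⟨fun F hF => ?_, ?_⟩
  · rw [LinearMap.sum_apply]
    refine Finset.sum_nonneg fun i _ w => ?_
    exact mul_nonneg (hc i) ((hT i).nonneg F hF w)
  · rw [LinearMap.sum_apply]
    simp only [LinearMap.smul_apply, (hT _).mass]
    rw [← Finset.sum_smul, hc1, one_smul]

end IsAveraging

/-! ### Channels -/

/-- A channel with finite input alphabet `𝒳`, given by its densities with respect to a reference
measure on the output space. -/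
structure Channel (Y 𝒳 : Type*) [MeasurableSpace Y] where
  /-- the reference measure -/
  ref : Measure Y
  sfinite : SFinite ref
  /-- the density of the output given the input -/
  dens : Y → 𝒳 → ℝ≥0
  measurable_dens : Measurable dens
  lintegral_dens : ∀ x, ∫⁻ y, dens y x ∂ref = 1

namespace Channel

variable {Y Y' 𝒳 : Type*} [MeasurableSpace Y] [MeasurableSpace Y'] [Fintype 𝒳]

instance (C : Channel Y 𝒳) : SFinite C.ref := C.sfinite

lemma integrable_dens (C : Channel Y 𝒳) (x : 𝒳) : Integrable (fun y => (C.dens y x : ℝ)) C.ref := by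
  have hm : Measurable fun y => C.dens y x := (measurable_pi_apply x).comp C.measurable_dens
  refine ⟨by fun_prop, ?_⟩
  rw [hasFiniteIntegral_iff_enorm]
  have h : ∀ y, ‖(C.dens y x : ℝ)‖ₑ = C.dens y x := fun y => by
    simp [← ofReal_norm]
  simp only [h, C.lintegral_dens x]
  exact ENNReal.one_lt_top

lemma integral_dens (C : Channel Y 𝒳) (x : 𝒳) : ∫ y, (C.dens y x : ℝ) ∂C.ref = 1 := by
  have hm : Measurable fun y => C.dens y x := (measurable_pi_apply x).comp C.measurable_dens
  rw [integral_eq_lintegral_of_nonneg_ae (ae_of_all _ fun y => NNReal.coe_nonneg _) (by fun_prop)]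
  simp [C.lintegral_dens x]

/-- The unnormalized posterior weights. -/
def update (C : Channel Y 𝒳) (w : 𝒳 → ℝ≥0) (y : Y) : 𝒳 → ℝ≥0 := fun x => w x * C.dens y x

lemma measurable_update (C : Channel Y 𝒳) :
    Measurable fun p : (𝒳 → ℝ≥0) × Y => C.update p.1 p.2 := by
  have := C.measurable_dens
  unfold update
  refine measurable_pi_lambda _ fun x => ?_
  have h2 : Measurable fun p : (𝒳 → ℝ≥0) × Y => C.dens p.2 x :=
    (measurable_pi_apply x).comp (this.comp measurable_snd)
  fun_prop

lemma measurable_update_right (C : Channel Y 𝒳) (w : 𝒳 → ℝ≥0) : Measurable (C.update w) :=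
  C.measurable_update.comp (measurable_const.prodMk measurable_id)

lemma integrable_sum_update (C : Channel Y 𝒳) (w : 𝒳 → ℝ≥0) (f : 𝒳 → ℝ) :
    Integrable (fun y => ∑ x, (C.update w y x : ℝ) * f x) C.ref := by
  refine integrable_finsetSum _ fun x _ => ?_
  simp only [update, NNReal.coe_mul, mul_assoc]
  exact ((C.integrable_dens x).mul_const _).const_mul _

lemma integral_sum_update (C : Channel Y 𝒳) (w : 𝒳 → ℝ≥0) (f : 𝒳 → ℝ) :
    ∫ y, ∑ x, (C.update w y x : ℝ) * f x ∂C.ref = ∑ x, w x * f x := by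
  rw [integral_finsetSum]
  · refine Finset.sum_congr rfl fun x _ => ?_
    simp only [update, NNReal.coe_mul]
    rw [integral_mul_const, integral_const_mul, C.integral_dens, mul_one]
  · intro x _
    simp only [update, NNReal.coe_mul, mul_assoc]
    exact ((C.integrable_dens x).mul_const _).const_mul _

lemma integrable_comp_update (C : Channel Y 𝒳) (F : Functional 𝒳) (w : 𝒳 → ℝ≥0) :
    Integrable (fun y => F (C.update w y)) C.ref := by
  obtain ⟨B, hB, hF⟩ := Functional.exists_bound F
  refine Integrable.mono' ((C.integrable_sum_update w fun _ => 1).const_mul B)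
    ((Functional.measurable F).comp (C.measurable_update_right w)).aestronglyMeasurable
    (ae_of_all _ fun y => ?_)
  simpa using hF (C.update w y)

/-- The expectation of a functional of the posterior weights, as an operator on functionals. -/
def op (C : Channel Y 𝒳) : Module.End ℝ (Functional 𝒳) where
  toFun F := ⟨fun w => ∫ y, F (C.update w y) ∂C.ref, by
      refine ⟨?_, fun c w => ?_, ?_⟩
      · have h : StronglyMeasurable fun p : (𝒳 → ℝ≥0) × Y => F (C.update p.1 p.2) :=
          ((Functional.measurable F).comp C.measurable_update).stronglyMeasurable
        exact h.integral_prod_right'.measurable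
      · rw [← integral_const_mul]
        refine integral_congr_ae (ae_of_all _ fun y => ?_)
        simp only
        rw [← Functional.homogeneous F]
        have h : C.update (fun x => c * w x) y = fun x => c * C.update w y x := by
          funext x; simp [update, mul_assoc]
        rw [h]
      · obtain ⟨B, hB, hF⟩ := Functional.exists_bound F
        refine ⟨B, fun w => ?_⟩
        have h1 := C.integral_sum_update w fun _ => 1
        simp only [mul_one] at h1
        rw [← h1, ← integral_const_mul, ← Real.norm_eq_abs]
        refine norm_integral_le_of_norm_le ?_ (ae_of_all _ fun y => hF _)
        simpa using (C.integrable_sum_update w fun _ => 1).const_mul B⟩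
  map_add' F G := Functional.ext' fun w => by
    simp only [Functional.add_apply]
    exact integral_add (C.integrable_comp_update F w) (C.integrable_comp_update G w)
  map_smul' a F := Functional.ext' fun w => by
    simp only [Functional.smul_apply]
    exact integral_const_mul _ _

lemma op_apply (C : Channel Y 𝒳) (F : Functional 𝒳) (w : 𝒳 → ℝ≥0) :
    C.op F w = ∫ y, F (C.update w y) ∂C.ref := rfl

lemma isAveraging_op (C : Channel Y 𝒳) : IsAveraging C.op := by
  refine ⟨fun F hF w => ?_, Functional.ext' fun w => ?_⟩
  · exact integral_nonneg fun y => hF _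
  · rw [op_apply]
    simpa [Functional.mass_apply] using C.integral_sum_update w fun _ => 1

lemma update_update (C : Channel Y 𝒳) (C' : Channel Y' 𝒳) (w : 𝒳 → ℝ≥0) (y : Y) (y' : Y') :
    C.update (C'.update w y') y = C'.update (C.update w y) y' := by
  funext x; simp only [update]; ring

lemma integrable_prod_update (C : Channel Y 𝒳) (C' : Channel Y' 𝒳) (F : Functional 𝒳)
    (w : 𝒳 → ℝ≥0) :
    Integrable (fun p : Y × Y' => F (C'.update (C.update w p.1) p.2)) (C.ref.prod C'.ref) := by
  obtain ⟨B, hB, hF⟩ := Functional.exists_bound F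
  have hm : Measurable fun p : Y × Y' => C'.update (C.update w p.1) p.2 :=
    C'.measurable_update.comp (((C.measurable_update_right w).comp measurable_fst).prodMk
      measurable_snd)
  have h1 : Integrable (fun p : Y × Y' => ∑ x, (w x : ℝ) * (C.dens p.1 x * C'.dens p.2 x))
      (C.ref.prod C'.ref) := by
    refine integrable_finsetSum _ fun x _ => Integrable.const_mul ?_ _
    exact (C.integrable_dens x).mul_prod (C'.integrable_dens x)
  refine Integrable.mono' (h1.const_mul B) ((Functional.measurable F).comp hm).aestronglyMeasurable
    (ae_of_all _ fun p => ?_)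
  simpa [update, mul_assoc] using hF (C'.update (C.update w p.1) p.2)

/-- Bayesian updates are pointwise multiplications, so their order is irrelevant, and Fubini
exchanges the outputs. This is what allows rows, side observations and revealed labels to be
reordered freely. -/
lemma commute_op (C : Channel Y 𝒳) (C' : Channel Y' 𝒳) : Commute C.op C'.op := by
  refine LinearMap.ext fun F => Functional.ext' fun w => ?_
  simp only [Module.End.mul_apply, op_apply]
  rw [integral_integral_swap (C.integrable_prod_update C' F w)]
  simp only [C.update_update C' w]

/-- The prior mean is an admissible, generally suboptimal centre for each posterior, and the mean
square deviation from a fixed centre is linear in the weights, hence preserved on average. -/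
lemma op_variance_le (C : Channel Y 𝒳) (f : 𝒳 → ℝ) :
    C.op (Functional.variance f) ≤ Functional.variance f := fun w => by
  show C.op (Functional.variance f) w ≤ Functional.varianceFun f w
  rw [Functional.varianceFun_eq, ← C.integral_sum_update w, op_apply]
  exact integral_mono (C.integrable_comp_update _ w) (C.integrable_sum_update w _) fun y =>
    Functional.varianceFun_le f _ _

/-- Gibbs' inequality bounds the posterior entropy by the cross-entropy with the prior, which is
linear in the posterior and so averages to the prior entropy. -/
lemma op_entropy_le (C : Channel Y 𝒳) : C.op (Functional.entropy 𝒳) ≤ Functional.entropy 𝒳 := by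
  intro w
  show C.op (Functional.entropy 𝒳) w ≤ Functional.entropyFun w
  have h : Functional.entropyFun w =
      ∑ x, (w x : ℝ) * (Real.log (∑ x, (w x : ℝ)) - Real.log (w x)) := by
    rw [Functional.entropyFun_eq, Finset.sum_mul, ← Finset.sum_sub_distrib]
    exact Finset.sum_congr rfl fun x _ => by ring
  rw [h, ← C.integral_sum_update w, op_apply]
  refine integral_mono (C.integrable_comp_update _ w) (C.integrable_sum_update w _) fun y =>
    Functional.entropyFun_le _ _ fun x hx => ?_
  simp [update, hx]

end Channel

section Gaussian

/-! ### Scalar Gaussian channels -/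

/-- The Cameron-Martin formula in dimension one. -/
lemma gaussianReal_withDensity_exp (δ : ℝ≥0) (u : ℝ) :
    (gaussianReal 0 δ).withDensity (fun y => ENNReal.ofReal (Real.exp (u * y - δ * u ^ 2 / 2))) =
      gaussianReal (δ * u) δ := by
  by_cases hδ : δ = 0
  · subst hδ
    rw [gaussianReal_zero_var, NNReal.coe_zero, zero_mul, gaussianReal_zero_var]
    ext t ht
    rw [withDensity_apply _ ht, ← lintegral_indicator ht, lintegral_dirac,
      Measure.dirac_apply' _ ht]
    by_cases h : (0 : ℝ) ∈ t <;> simp [h]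
  · rw [gaussianReal_of_var_ne_zero _ hδ, gaussianReal_of_var_ne_zero _ hδ,
      ← withDensity_mul _ (measurable_gaussianPDF _ _) (by fun_prop)]
    congr 1
    funext y
    have hδ' : (δ : ℝ) ≠ 0 := by exact_mod_cast hδ
    simp only [Pi.mul_apply, gaussianPDF, gaussianPDFReal]
    rw [← ENNReal.ofReal_mul (by positivity), mul_assoc, ← Real.exp_add]
    congr 3
    field_simp
    ring

lemma integral_exp_mul_gaussianReal_mul (δ : ℝ≥0) (u : ℝ) (f : ℝ → ℝ) :
    ∫ y, Real.exp (u * y - δ * u ^ 2 / 2) * f y ∂gaussianReal 0 δ =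
      ∫ y, f y ∂gaussianReal (δ * u) δ := by
  rw [← gaussianReal_withDensity_exp, integral_withDensity_eq_integral_toReal_smul (by fun_prop)
    (ae_of_all _ fun y => ENNReal.ofReal_lt_top)]
  refine integral_congr_ae (ae_of_all _ fun y => ?_)
  simp [ENNReal.toReal_ofReal (Real.exp_pos _).le]

lemma integrable_exp_mul_gaussianReal_mul {δ : ℝ≥0} {u : ℝ} {f : ℝ → ℝ}
    (hf : Integrable f (gaussianReal (δ * u) δ)) :
    Integrable (fun y => Real.exp (u * y - δ * u ^ 2 / 2) * f y) (gaussianReal 0 δ) := by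
  rw [← gaussianReal_withDensity_exp, integrable_withDensity_iff_integrable_smul' (by fun_prop)
    (ae_of_all _ fun y => ENNReal.ofReal_lt_top)] at hf
  refine hf.congr (ae_of_all _ fun y => ?_)
  simp [ENNReal.toReal_ofReal (Real.exp_pos _).le]

lemma integrable_id_gaussianReal (m : ℝ) (δ : ℝ≥0) : Integrable (fun y => y) (gaussianReal m δ) :=
  (memLp_id_gaussianReal (μ := m) (v := δ) 1).integrable (by simp)

lemma integrable_sq_gaussianReal (m : ℝ) (δ : ℝ≥0) :
    Integrable (fun y => y ^ 2) (gaussianReal m δ) :=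
  (memLp_id_gaussianReal (μ := m) (v := δ) 2).integrable_sq

lemma integral_sq_gaussianReal (m : ℝ) (δ : ℝ≥0) :
    ∫ y, y ^ 2 ∂gaussianReal m δ = δ + m ^ 2 := by
  have h := variance_eq_sub (memLp_id_gaussianReal (μ := m) (v := δ) 2)
  rw [variance_id_gaussianReal] at h
  simp only [Pi.pow_apply, id] at h
  rw [integral_id_gaussianReal] at h
  linarith

lemma integral_exp_mul_gaussianReal (δ : ℝ≥0) (t : ℝ) :
    ∫ y, Real.exp (t * y) ∂gaussianReal 0 δ = Real.exp (δ * t ^ 2 / 2) := by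
  have := congr_fun (mgf_id_gaussianReal (μ := 0) (v := δ)) t
  simpa [mgf] using this

/-- The density of a centred Gaussian of larger variance with respect to one of smaller variance. -/
lemma integral_exp_sq_gaussianReal (δ : ℝ≥0) {E : ℝ} (hE : 0 ≤ E) :
    Integrable (fun y => Real.exp (-(Real.log (1 + δ * E) / 2) + y ^ 2 * (E / (2 * (1 + δ * E)))))
      (gaussianReal 0 δ) ∧
    ∫ y, Real.exp (-(Real.log (1 + δ * E) / 2) + y ^ 2 * (E / (2 * (1 + δ * E))))
      ∂gaussianReal 0 δ = 1 := by
  by_cases hδ : δ = 0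
  · subst hδ
    simp [gaussianReal_zero_var, integrable_dirac]
  have hδ' : (0 : ℝ) < δ := by exact_mod_cast pos_iff_ne_zero.mpr hδ
  have hE' : 0 < 1 + (δ : ℝ) * E := by positivity
  -- The variance of the rescaled output for a Gaussian input of variance `E`: the noise contributes
  -- `δ` and the input `δ² E`.
  let v : ℝ≥0 := NNReal.mk (δ * (1 + δ * E)) (by positivity)
  have hv : v ≠ 0 := by
    rw [← NNReal.coe_ne_zero]; exact (mul_pos hδ' hE').ne'
  have key : ∀ y, gaussianPDFReal 0 δ y *
      Real.exp (-(Real.log (1 + δ * E) / 2) + y ^ 2 * (E / (2 * (1 + δ * E)))) =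
      gaussianPDFReal 0 v y := by
    intro y
    have h1 : Real.exp (-(Real.log (1 + δ * E) / 2)) = (√(1 + δ * E))⁻¹ := by
      rw [Real.exp_neg, Real.sqrt_eq_rpow, Real.rpow_def_of_pos hE']
      congr 2
      ring
    simp only [gaussianPDFReal, v, NNReal.coe_mk]
    rw [Real.exp_add, h1, ← mul_assoc (2 * Real.pi), Real.sqrt_mul (by positivity) (1 + δ * E),
      mul_inv]
    have h2 : Real.exp (-(y - 0) ^ 2 / (2 * (δ * (1 + δ * E)))) =
        Real.exp (-(y - 0) ^ 2 / (2 * δ)) * Real.exp (y ^ 2 * (E / (2 * (1 + δ * E)))) := by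
      rw [← Real.exp_add]
      congr 1
      field_simp
      ring
    rw [h2]
    ring
  constructor
  · rw [gaussianReal_of_var_ne_zero _ hδ, integrable_withDensity_iff_integrable_smul'
      (measurable_gaussianPDF _ _) (ae_of_all _ fun y => gaussianPDF_lt_top)]
    simp only [toReal_gaussianPDF, smul_eq_mul, key]
    exact integrable_gaussianPDFReal _ _
  · rw [integral_gaussianReal_eq_integral_smul hδ]
    simp only [smul_eq_mul, key]
    exact integral_gaussianPDFReal_eq_one _ hv

variable {𝒳 : Type*} [Fintype 𝒳]

/-- The channel `x ↦ u x + N(0, 1/δ)`, with the output rescaled by `δ`. -/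
def gaussChannel (u : 𝒳 → ℝ) (δ : ℝ≥0) : Channel ℝ 𝒳 where
  ref := gaussianReal 0 δ
  sfinite := inferInstance
  dens y x := NNReal.mk (Real.exp (u x * y - δ * u x ^ 2 / 2)) (Real.exp_pos _).le
  measurable_dens := by
    refine measurable_pi_lambda _ fun x => Measurable.subtype_mk (p := fun r : ℝ => 0 ≤ r) ?_
    fun_prop
  lintegral_dens x := by
    have h := congr_arg (fun μ => μ Set.univ) (gaussianReal_withDensity_exp δ (u x))
    simp only [measure_univ, withDensity_apply _ MeasurableSet.univ, Measure.restrict_univ] at h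
    rw [← h]
    refine lintegral_congr fun y => ?_
    rw [ENNReal.ofReal_eq_coe_nnreal (Real.exp_pos _).le]

@[simp] lemma coe_gaussChannel_dens (u : 𝒳 → ℝ) (δ : ℝ≥0) (y : ℝ) (x : 𝒳) :
    ((gaussChannel u δ).dens y x : ℝ) = Real.exp (u x * y - δ * u x ^ 2 / 2) := rfl

@[simp] lemma gaussChannel_ref (u : 𝒳 → ℝ) (δ : ℝ≥0) :
    (gaussChannel u δ).ref = gaussianReal 0 δ := rfl

/-- With outputs rescaled by the precision, the sum of two outputs is a sufficient statistic and the
reference laws convolve. Precisions therefore add, and the operators form a semigroup in `δ`. -/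
lemma gaussChannel_op_mul (u : 𝒳 → ℝ) (δ δ' : ℝ≥0) :
    (gaussChannel u δ).op * (gaussChannel u δ').op = (gaussChannel u (δ + δ')).op := by
  refine LinearMap.ext fun F => Functional.ext' fun w => ?_
  have hconv : (gaussianReal 0 δ) ∗ (gaussianReal 0 δ') = gaussianReal 0 (δ + δ') := by
    rw [gaussianReal_conv_gaussianReal]; simp
  have hupd : ∀ y y' : ℝ, (gaussChannel u δ').update ((gaussChannel u δ).update w y) y' =
      (gaussChannel u (δ + δ')).update w (y + y') := by
    intro y y'
    funext x
    apply NNReal.coe_injective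
    simp only [Channel.update, NNReal.coe_mul, coe_gaussChannel_dens, mul_assoc, ← Real.exp_add,
      NNReal.coe_add]
    congr 2
    ring
  have hint := (gaussChannel u (δ + δ')).integrable_comp_update F w
  simp only [Module.End.mul_apply, Channel.op_apply, hupd, gaussChannel_ref]
  rw [gaussChannel_ref, ← hconv] at hint
  rw [← hconv, integral_conv hint]

lemma gaussChannel_op_zero (u : 𝒳 → ℝ) : (gaussChannel u 0).op = 1 := by
  refine LinearMap.ext fun F => Functional.ext' fun w => ?_
  rw [Channel.op_apply, gaussChannel_ref, gaussianReal_zero_var, integral_dirac]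
  have h : (gaussChannel u 0).update w 0 = w := by
    funext x
    apply NNReal.coe_injective
    simp [Channel.update]
  rw [h]; rfl

lemma gaussChannel_op_pow (u : 𝒳 → ℝ) (δ : ℝ≥0) (n : ℕ) :
    (gaussChannel u δ).op ^ n = (gaussChannel u (n * δ)).op := by
  induction n with
  | zero => simp [gaussChannel_op_zero]
  | succ n ih => rw [pow_succ, ih, gaussChannel_op_mul]; push_cast; rw [add_mul, one_mul]

/-- The channel is invariant under translations of the input. -/
lemma gaussChannel_op_add_const (u : 𝒳 → ℝ) (c : ℝ) (δ : ℝ≥0) :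
    (gaussChannel (fun x => u x + c) δ).op = (gaussChannel u δ).op := by
  refine LinearMap.ext fun F => Functional.ext' fun w => ?_
  have hmap : gaussianReal (δ * c) δ = (gaussianReal 0 δ).map (fun y => y + δ * c) := by
    rw [gaussianReal_map_add_const, zero_add]
  -- Completing the square turns the translation of the input into a translation of the output and a
  -- factor independent of `x`. Homogeneity extracts the factor, and Cameron-Martin absorbs it into
  -- a shift of the reference law.
  have hupd : ∀ y, F ((gaussChannel (fun x => u x + c) δ).update w y) =
      Real.exp (c * y - δ * c ^ 2 / 2) * F ((gaussChannel u δ).update w (y - δ * c)) := by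
    intro y
    have h := Functional.homogeneous F (NNReal.mk (Real.exp (c * y - δ * c ^ 2 / 2)) (Real.exp_pos _).le)
      ((gaussChannel u δ).update w (y - δ * c))
    rw [NNReal.coe_mk] at h
    rw [← h]
    refine congr_arg (F : (𝒳 → ℝ≥0) → ℝ) (funext fun x => ?_)
    apply NNReal.coe_injective
    simp only [Channel.update, NNReal.coe_mul, coe_gaussChannel_dens, NNReal.coe_mk]
    rw [mul_left_comm, ← Real.exp_add]
    congr 2
    ring
  simp only [Channel.op_apply, gaussChannel_ref, hupd]
  rw [integral_exp_mul_gaussianReal_mul, hmap, integral_map (by fun_prop)]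
  · simp
  · have := (Functional.measurable F).comp ((gaussChannel u δ).measurable_update_right w)
    exact (this.comp (measurable_id.sub_const _)).aestronglyMeasurable

/-- The logarithm of an updated weight is explicit, so the last sum has a closed expectation. Only
the term `W log W` in the total mass `W`, the output density, has to be estimated. -/
lemma entropyFun_update_gaussChannel (u : 𝒳 → ℝ) (δ : ℝ≥0) (w : 𝒳 → ℝ≥0) (y : ℝ) :
    Functional.entropyFun ((gaussChannel u δ).update w y) =
      (∑ x, ((gaussChannel u δ).update w y x : ℝ)) *
        Real.log (∑ x, ((gaussChannel u δ).update w y x : ℝ)) -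
      ∑ x, ((gaussChannel u δ).update w y x : ℝ) *
        (Real.log (w x) + (u x * y - δ * u x ^ 2 / 2)) := by
  rw [Functional.entropyFun_eq]
  congr 1
  refine Finset.sum_congr rfl fun x _ => ?_
  by_cases hx : w x = 0
  · simp [Channel.update, hx]
  · have hx' : (w x : ℝ) ≠ 0 := by exact_mod_cast hx
    conv_lhs => rw [Channel.update, NNReal.coe_mul, coe_gaussChannel_dens,
      Real.log_mul hx' (Real.exp_pos _).ne', Real.log_exp]
    simp only [Channel.update, NNReal.coe_mul, coe_gaussChannel_dens]

lemma integrable_update_gaussChannel_mul (u : 𝒳 → ℝ) (δ : ℝ≥0) (w : 𝒳 → ℝ≥0) (x : 𝒳) {f : ℝ → ℝ}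
    (hf : Integrable f (gaussianReal (δ * u x) δ)) :
    Integrable (fun y => ((gaussChannel u δ).update w y x : ℝ) * f y) (gaussianReal 0 δ) := by
  simp only [Channel.update, NNReal.coe_mul, coe_gaussChannel_dens, mul_assoc]
  exact (integrable_exp_mul_gaussianReal_mul hf).const_mul _

lemma integral_update_gaussChannel_mul (u : 𝒳 → ℝ) (δ : ℝ≥0) (w : 𝒳 → ℝ≥0) (x : 𝒳) (f : ℝ → ℝ) :
    ∫ y, ((gaussChannel u δ).update w y x : ℝ) * f y ∂gaussianReal 0 δ =
      w x * ∫ y, f y ∂gaussianReal (δ * u x) δ := by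
  simp only [Channel.update, NNReal.coe_mul, coe_gaussChannel_dens, mul_assoc]
  rw [integral_const_mul, integral_exp_mul_gaussianReal_mul]

lemma integrable_quadratic_gaussianReal (m : ℝ) (δ : ℝ≥0) (a b c : ℝ) :
    Integrable (fun y => a + b * y + c * y ^ 2) (gaussianReal m δ) :=
  ((integrable_const a).add ((integrable_id_gaussianReal m δ).const_mul b)).add
    ((integrable_sq_gaussianReal m δ).const_mul c)

lemma integral_quadratic_gaussianReal (m : ℝ) (δ : ℝ≥0) (a b c : ℝ) :
    ∫ y, (a + b * y + c * y ^ 2) ∂gaussianReal m δ = a + b * m + c * (δ + m ^ 2) := by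
  rw [integral_add (f := fun y => a + b * y)
    ((integrable_const a).add ((integrable_id_gaussianReal m δ).const_mul b))
    ((integrable_sq_gaussianReal m δ).const_mul c), integral_add (integrable_const a)
    ((integrable_id_gaussianReal m δ).const_mul b), integral_const_mul, integral_const_mul,
    integral_sq_gaussianReal, integral_id_gaussianReal]
  simp

/-- The expectation of a quadratic statistic of input and output. -/
lemma integral_sum_update_gaussChannel (u : 𝒳 → ℝ) (δ : ℝ≥0) (w : 𝒳 → ℝ≥0) (a b c : 𝒳 → ℝ) :
    Integrable (fun y => ∑ x, ((gaussChannel u δ).update w y x : ℝ) *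
      (a x + b x * y + c x * y ^ 2)) (gaussianReal 0 δ) ∧
    ∫ y, ∑ x, ((gaussChannel u δ).update w y x : ℝ) * (a x + b x * y + c x * y ^ 2)
      ∂gaussianReal 0 δ = ∑ x, w x * (a x + b x * (δ * u x) + c x * (δ + (δ * u x) ^ 2)) := by
  have h : ∀ x, Integrable (fun y => ((gaussChannel u δ).update w y x : ℝ) *
      (a x + b x * y + c x * y ^ 2)) (gaussianReal 0 δ) := fun x =>
    integrable_update_gaussChannel_mul u δ w x (integrable_quadratic_gaussianReal _ _ _ _ _)
  refine ⟨integrable_finsetSum _ fun x _ => h x, ?_⟩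
  rw [integral_finsetSum _ fun x _ => h x]
  refine Finset.sum_congr rfl fun x _ => ?_
  rw [integral_update_gaussChannel_mul u δ w x (fun y => a x + b x * y + c x * y ^ 2),
    integral_quadratic_gaussianReal]

lemma coe_sum_eq_one {w : 𝒳 → ℝ≥0} (hw : ∑ x, w x = 1) : ∑ x, (w x : ℝ) = 1 := by
  rw [← NNReal.coe_sum, hw, NNReal.coe_one]

lemma entropyFun_of_prob {w : 𝒳 → ℝ≥0} (hw : ∑ x, w x = 1) :
    Functional.entropyFun w = - ∑ x, w x * Real.log (w x) := by
  rw [Functional.entropyFun_eq, coe_sum_eq_one hw]; simp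

/-- The mutual information of a Gaussian channel is bounded by the divergence from the channel
whose input is Gaussian with variance `E`. -/
lemma entropy_sub_gaussChannel_le_aux (u : 𝒳 → ℝ) (δ : ℝ≥0) {E : ℝ} (hE : 0 ≤ E) {w : 𝒳 → ℝ≥0}
    (hw : ∑ x, w x = 1) :
    Functional.entropyFun w - (gaussChannel u δ).op (Functional.entropy 𝒳) w ≤
      (Real.log (1 + δ * E) + δ * (∑ x, w x * u x ^ 2 - E) / (1 + δ * E)) / 2 := by
  set C := gaussChannel u δ
  have hE' : 0 < 1 + (δ : ℝ) * E := by positivity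
  obtain ⟨hi, he⟩ := integral_exp_sq_gaussianReal δ hE
  set κ := Real.log (1 + δ * E) / 2 with hκ
  set s := E / (2 * (1 + δ * E)) with hs
  -- The coefficients combine the tangent line of `x log x` at the Gaussian output density `exp (-κ
  -- + y² s)`, without its constant term, with the explicit part of the posterior entropy.
  obtain ⟨hi2, he2⟩ := integral_sum_update_gaussChannel u δ w
    (fun x => 1 - κ - Real.log (w x) + δ * u x ^ 2 / 2) (fun x => - u x) (fun _ => s)
  have hlow : ∀ y, ∑ x, (C.update w y x : ℝ) *
      (1 - κ - Real.log (w x) + δ * u x ^ 2 / 2 + - u x * y + s * y ^ 2) -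
      Real.exp (-κ + y ^ 2 * s) ≤ Functional.entropyFun (C.update w y) := by
    intro y
    rw [entropyFun_update_gaussChannel]
    have h1 := Real.mul_log_ge (a := ∑ x, (C.update w y x : ℝ)) (by positivity)
      (Real.exp_pos (-κ + y ^ 2 * s))
    rw [Real.log_exp] at h1
    have h2 : ∑ x, (C.update w y x : ℝ) *
        (1 - κ - Real.log (w x) + δ * u x ^ 2 / 2 + - u x * y + s * y ^ 2) =
        (∑ x, (C.update w y x : ℝ)) * (1 - κ + y ^ 2 * s) -
        ∑ x, (C.update w y x : ℝ) * (Real.log (w x) + (u x * y - δ * u x ^ 2 / 2)) := by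
      rw [Finset.sum_mul, ← Finset.sum_sub_distrib]
      exact Finset.sum_congr rfl fun x _ => by ring
    rw [h2]
    linarith
  have h := integral_mono (hi2.sub hi) (C.integrable_comp_update (Functional.entropy 𝒳) w) hlow
  simp only [Pi.sub_apply] at h
  have hop : C.op (Functional.entropy 𝒳) w =
      ∫ y, Functional.entropy 𝒳 (C.update w y) ∂gaussianReal 0 δ := rfl
  rw [← hop, integral_sub hi2 hi, he, he2] at h
  rw [entropyFun_of_prob hw]
  have hexp : ∑ x, (w x : ℝ) * (1 - κ - Real.log (w x) + δ * u x ^ 2 / 2 + - u x * (δ * u x) +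
      s * (δ + (δ * u x) ^ 2)) = (1 - κ + s * δ) * ∑ x, (w x : ℝ) -
      ∑ x, w x * Real.log (w x) + (s * δ ^ 2 - δ / 2) * ∑ x, w x * u x ^ 2 := by
    rw [Finset.mul_sum, Finset.mul_sum, ← Finset.sum_sub_distrib, ← Finset.sum_add_distrib]
    exact Finset.sum_congr rfl fun x _ => by ring
  rw [hexp, coe_sum_eq_one hw] at h
  set A := ∑ x, w x * u x ^ 2
  have hfin : κ - s * δ - (s * δ ^ 2 - δ / 2) * A =
      (Real.log (1 + δ * E) + δ * (A - E) / (1 + δ * E)) / 2 := by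
    rw [hκ, hs]; field_simp; ring
  linarith

/-- Translation invariance lets `u` be centred, which turns the second moment into a variance. The
bound is the tangent at `E` of the concave function `V ↦ log (1 + δ V) / 2`. Being affine in the
variance, it can be averaged over rows and under other channels. -/
lemma entropy_sub_gaussChannel_le (u : 𝒳 → ℝ) (δ : ℝ≥0) {E : ℝ} (hE : 0 ≤ E) :
    Functional.entropy 𝒳 - (gaussChannel u δ).op (Functional.entropy 𝒳) ≤
      (Real.log (1 + δ * E) / 2 - δ * E / (1 + δ * E) / 2) • Functional.mass 𝒳 +
      (δ / (1 + δ * E) / 2) • Functional.variance u := by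
  refine Functional.le_of_forall_prob fun w hw => ?_
  simp only [Functional.sub_apply, Functional.add_apply, Functional.smul_apply,
    Functional.mass_apply, coe_sum_eq_one hw, Functional.variance_apply, Functional.entropy_apply]
  rw [← gaussChannel_op_add_const u (-∑ x, w x * u x) δ, Functional.varianceFun_eq,
    coe_sum_eq_one hw, div_one]
  refine (entropy_sub_gaussChannel_le_aux _ δ hE hw).trans (le_of_eq ?_)
  simp only [← sub_eq_add_neg]
  ring

lemma exp_le_one_add_sq {t : ℝ} (ht : |t| ≤ 1) : Real.exp t ≤ 1 + t + t ^ 2 := by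
  have := Real.abs_exp_sub_one_sub_id_le ht
  have := (abs_le.mp this).2
  linarith

/-- Squaring the output density introduces two copies of the input. The Gaussian integral couples
them through the exponential of `δ` times their product. -/
lemma integral_sq_sum_update (u : 𝒳 → ℝ) (δ : ℝ≥0) (w : 𝒳 → ℝ≥0) :
    Integrable (fun y => (∑ x, ((gaussChannel u δ).update w y x : ℝ)) ^ 2) (gaussianReal 0 δ) ∧
    ∫ y, (∑ x, ((gaussChannel u δ).update w y x : ℝ)) ^ 2 ∂gaussianReal 0 δ =
      ∑ x, ∑ x', (w x : ℝ) * w x' * Real.exp (δ * u x * u x') := by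
  have hprod : ∀ y, (∑ x, ((gaussChannel u δ).update w y x : ℝ)) ^ 2 =
      ∑ x, ∑ x', ((w x : ℝ) * w x' * Real.exp (-(δ * u x ^ 2 / 2) - δ * u x' ^ 2 / 2)) *
        Real.exp ((u x + u x') * y) := by
    intro y
    rw [sq, Finset.sum_mul_sum]
    refine Finset.sum_congr rfl fun x _ => Finset.sum_congr rfl fun x' _ => ?_
    simp only [Channel.update, NNReal.coe_mul, coe_gaussChannel_dens]
    rw [mul_mul_mul_comm, ← Real.exp_add, mul_assoc ((w x : ℝ) * w x'), ← Real.exp_add]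
    congr 2
    ring
  have hi : ∀ x x', Integrable (fun y => ((w x : ℝ) * w x' *
      Real.exp (-(δ * u x ^ 2 / 2) - δ * u x' ^ 2 / 2)) * Real.exp ((u x + u x') * y))
      (gaussianReal 0 δ) := fun x x' => (integrable_exp_mul_gaussianReal _).const_mul _
  simp only [hprod]
  refine ⟨integrable_finsetSum _ fun x _ => integrable_finsetSum _ fun x' _ => hi x x', ?_⟩
  rw [integral_finsetSum _ fun x _ => integrable_finsetSum _ fun x' _ => hi x x']
  refine Finset.sum_congr rfl fun x _ => ?_
  rw [integral_finsetSum _ fun x' _ => hi x x']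
  refine Finset.sum_congr rfl fun x' _ => ?_
  rw [integral_const_mul, integral_exp_mul_gaussianReal, mul_assoc, ← Real.exp_add]
  congr 2
  ring

/-- A lower bound for the mutual information at small signal-to-noise ratio. -/
lemma le_entropy_sub_gaussChannel_aux {u : 𝒳 → ℝ} {δ : ℝ≥0} {U : ℝ} (hu : ∀ x, |u x| ≤ U)
    (hδ : δ * U ^ 2 ≤ 1) {w : 𝒳 → ℝ≥0} (hw : ∑ x, w x = 1) (hwu : ∑ x, w x * u x = 0) :
    δ / 2 * ∑ x, w x * u x ^ 2 - δ ^ 2 * U ^ 4 ≤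
      Functional.entropyFun w - (gaussChannel u δ).op (Functional.entropy 𝒳) w := by
  set C := gaussChannel u δ
  obtain ⟨hi, he⟩ := integral_sq_sum_update u δ w
  obtain ⟨hi2, he2⟩ := integral_sum_update_gaussChannel u δ w
    (fun x => 1 + Real.log (w x) - δ * u x ^ 2 / 2) (fun x => u x) (fun _ => 0)
  have hup : ∀ y, Functional.entropyFun (C.update w y) ≤ (∑ x, (C.update w y x : ℝ)) ^ 2 -
      ∑ x, (C.update w y x : ℝ) *
        (1 + Real.log (w x) - δ * u x ^ 2 / 2 + u x * y + 0 * y ^ 2) := by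
    intro y
    rw [entropyFun_update_gaussChannel]
    -- Comparison with the output law of the zero input, whose density is `1`: `W log W ≤ W² - W`.
    have h1 := Real.mul_log_le (a := ∑ x, (C.update w y x : ℝ)) (by positivity) one_pos
    rw [Real.log_one, mul_zero, zero_add, div_one] at h1
    have h2 : ∑ x, (C.update w y x : ℝ) *
        (1 + Real.log (w x) - δ * u x ^ 2 / 2 + u x * y + 0 * y ^ 2) =
        (∑ x, (C.update w y x : ℝ)) +
        ∑ x, (C.update w y x : ℝ) * (Real.log (w x) + (u x * y - δ * u x ^ 2 / 2)) := by
      rw [← Finset.sum_add_distrib]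
      exact Finset.sum_congr rfl fun x _ => by ring
    rw [h2]
    linarith
  have h := integral_mono (C.integrable_comp_update (Functional.entropy 𝒳) w) (hi.sub hi2) hup
  simp only [Pi.sub_apply] at h
  have hop : C.op (Functional.entropy 𝒳) w =
      ∫ y, Functional.entropy 𝒳 (C.update w y) ∂gaussianReal 0 δ := rfl
  rw [gaussChannel_ref, ← hop, integral_sub hi hi2, he, he2] at h
  rw [entropyFun_of_prob hw]
  have hexp : ∑ x, (w x : ℝ) * (1 + Real.log (w x) - δ * u x ^ 2 / 2 + u x * (δ * u x) +
      0 * (δ + (δ * u x) ^ 2)) = ∑ x, (w x : ℝ) + ∑ x, w x * Real.log (w x) +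
      δ / 2 * ∑ x, w x * u x ^ 2 := by
    rw [Finset.mul_sum, ← Finset.sum_add_distrib, ← Finset.sum_add_distrib]
    exact Finset.sum_congr rfl fun x _ => by ring
  rw [hexp, coe_sum_eq_one hw] at h
  have hU : 0 ≤ U := by
    by_contra hU
    have : IsEmpty 𝒳 := ⟨fun x => hU ((abs_nonneg _).trans (hu x))⟩
    simp at hw
  have huu : ∀ x x', |u x * u x'| ≤ U ^ 2 := fun x x' => by
    rw [abs_mul, sq]; exact mul_le_mul (hu x) (hu x') (abs_nonneg _) hU
  have hchi : ∑ x, ∑ x', (w x : ℝ) * w x' * Real.exp (δ * u x * u x') ≤ 1 + δ ^ 2 * U ^ 4 := by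
    -- Second order expansion of the exponential. The first order term sums to `δ (∑ w u)²`, which
    -- vanishes by centring, so the error is of order `δ²`.
    have hterm : ∀ x x', (w x : ℝ) * w x' * Real.exp (δ * u x * u x') ≤
        (1 + δ ^ 2 * U ^ 4) * ((w x : ℝ) * w x') + δ * ((w x * u x) * (w x' * u x')) := by
      intro x x'
      have h1 : |(δ : ℝ) * u x * u x'| ≤ 1 := by
        rw [mul_assoc, abs_mul, abs_of_nonneg δ.coe_nonneg]
        exact (mul_le_mul_of_nonneg_left (huu x x') δ.coe_nonneg).trans hδ
      have h2 := exp_le_one_add_sq h1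
      have h3 : ((δ : ℝ) * u x * u x') ^ 2 ≤ δ ^ 2 * U ^ 4 := by
        rw [mul_assoc, mul_pow]
        refine mul_le_mul_of_nonneg_left ?_ (sq_nonneg _)
        rw [show U ^ 4 = (U ^ 2) ^ 2 by ring, ← sq_abs]
        exact pow_le_pow_left₀ (abs_nonneg _) (huu x x') 2
      have h4 := mul_le_mul_of_nonneg_left (h2.trans (add_le_add_right h3 _))
        (mul_nonneg (w x).coe_nonneg (w x').coe_nonneg)
      refine h4.trans (le_of_eq ?_)
      ring
    refine (Finset.sum_le_sum fun x _ => Finset.sum_le_sum fun x' _ => hterm x x').trans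
      (le_of_eq ?_)
    simp only [Finset.sum_add_distrib, ← Finset.mul_sum, coe_sum_eq_one hw, hwu]
    simp [coe_sum_eq_one hw]
  linarith

lemma abs_sum_mul_le {w : 𝒳 → ℝ≥0} (hw : ∑ x, w x = 1) {u : 𝒳 → ℝ} {U : ℝ}
    (hu : ∀ x, |u x| ≤ U) : |∑ x, w x * u x| ≤ U := by
  refine (Finset.abs_sum_le_sum_abs _ _).trans ?_
  rw [show U = ∑ x, (w x : ℝ) * U by rw [← Finset.sum_mul, coe_sum_eq_one hw, one_mul]]
  refine Finset.sum_le_sum fun x _ => ?_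
  rw [abs_mul, abs_of_nonneg (w x).coe_nonneg]
  exact mul_le_mul_of_nonneg_left (hu x) (w x).coe_nonneg

/-- Centring `u` reduces to the previous estimate but may double the bound on `|u|`, whence `2 * U`.
-/
lemma le_entropy_sub_gaussChannel_of_small {u : 𝒳 → ℝ} {δ : ℝ≥0} {U : ℝ} (hu : ∀ x, |u x| ≤ U)
    (hδ : δ * (2 * U) ^ 2 ≤ 1) :
    (δ / 2 : ℝ) • Functional.variance u - (δ ^ 2 * (2 * U) ^ 4 : ℝ) • Functional.mass 𝒳 ≤
      Functional.entropy 𝒳 - (gaussChannel u δ).op (Functional.entropy 𝒳) := by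
  refine Functional.le_of_forall_prob fun w hw => ?_
  simp only [Functional.sub_apply, Functional.smul_apply,
    Functional.mass_apply, coe_sum_eq_one hw, Functional.variance_apply, Functional.entropy_apply]
  have hm := abs_sum_mul_le hw hu
  rw [← gaussChannel_op_add_const u (-∑ x, w x * u x) δ, Functional.varianceFun_eq,
    coe_sum_eq_one hw, div_one]
  simp only [← sub_eq_add_neg, mul_one]
  refine le_entropy_sub_gaussChannel_aux (fun x => ?_) hδ hw ?_
  · refine (abs_sub _ _).trans ?_
    linarith [hu x]
  · simp only [mul_sub, Finset.sum_sub_distrib, ← Finset.sum_mul, coe_sum_eq_one hw]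
    ring

/-- For a Gaussian channel, the mutual information is at least half the signal-to-noise ratio
times the minimum mean square error. -/
theorem le_entropy_sub_gaussChannel (u : 𝒳 → ℝ) (δ : ℝ≥0) :
    (δ / 2 : ℝ) • (gaussChannel u δ).op (Functional.variance u) ≤
      Functional.entropy 𝒳 - (gaussChannel u δ).op (Functional.entropy 𝒳) := by
  set U := ∑ x, |u x|
  have hu : ∀ x, |u x| ≤ U := fun x =>
    Finset.single_le_sum (f := fun x => |u x|) (fun x _ => abs_nonneg _) (Finset.mem_univ x)
  -- Split the precision into `N` equal pieces and apply the small-precision bound to each.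
  -- Variances decrease along the composition, so every piece is bounded below using the final
  -- variance; the quadratic errors add up to `O(1 / N)`.
  have key : ∀ N : ℕ, δ * (2 * U) ^ 2 ≤ N → N ≠ 0 →
      (δ / 2 : ℝ) • (gaussChannel u δ).op (Functional.variance u) -
        (δ ^ 2 * (2 * U) ^ 4 / N : ℝ) • Functional.mass 𝒳 ≤
      Functional.entropy 𝒳 - (gaussChannel u δ).op (Functional.entropy 𝒳) := by
    intro N hN hN0
    have hNpos : (0 : ℝ) < N := by exact_mod_cast Nat.pos_of_ne_zero hN0
    set ε : ℝ≥0 := δ / N with hε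
    have hεc : (ε : ℝ) = δ / N := by simp [hε]
    have hNε : (N : ℝ≥0) * ε = δ := by rw [hε]; field_simp
    set G := (gaussChannel u ε).op
    have hG : IsAveraging G := (gaussChannel u ε).isAveraging_op
    have hGN : (gaussChannel u δ).op = G ^ N := by rw [gaussChannel_op_pow, hNε]
    have hstep := le_entropy_sub_gaussChannel_of_small (δ := ε) hu (by
      rw [hεc, div_mul_eq_mul_div, div_le_one hNpos]; exact hN)
    have hvar : ∀ k, G ^ (k + 1) • Functional.variance u ≤ G ^ k • Functional.variance u := by
      intro k
      show (G ^ (k + 1)) (Functional.variance u) ≤ (G ^ k) (Functional.variance u)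
      rw [pow_succ, Module.End.mul_apply]
      exact (hG.pow k).mono ((gaussChannel u ε).op_variance_le u)
    have hanti : Antitone fun k => (G ^ k) (Functional.variance u) := antitone_nat_of_succ_le hvar
    have htel : Functional.entropy 𝒳 - (G ^ N) (Functional.entropy 𝒳) =
        ∑ k ∈ Finset.range N, (G ^ k) (Functional.entropy 𝒳 - G (Functional.entropy 𝒳)) := by
      have h := Finset.sum_range_sub' (fun k => (G ^ k) (Functional.entropy 𝒳)) N
      simp only [pow_zero, Module.End.one_apply] at h
      rw [← h]
      refine Finset.sum_congr rfl fun k _ => ?_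
      rw [map_sub, pow_succ, Module.End.mul_apply]
    rw [hGN, htel]
    have hlow : ∀ k ∈ Finset.range N,
        (ε / 2 : ℝ) • (G ^ N) (Functional.variance u) -
          (ε ^ 2 * (2 * U) ^ 4 : ℝ) • Functional.mass 𝒳 ≤
        (G ^ k) (Functional.entropy 𝒳 - G (Functional.entropy 𝒳)) := by
      intro k hk
      have h := (hG.pow k).mono hstep
      rw [map_sub, map_smul, map_smul, (hG.pow k).mass] at h
      refine le_trans (sub_le_sub_right ?_ _) h
      intro w
      exact mul_le_mul_of_nonneg_left (hanti (Finset.mem_range.mp hk).le w) (by positivity)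
    refine le_trans (le_of_eq ?_) (Finset.sum_le_sum hlow)
    rw [Finset.sum_const, Finset.card_range, ← Nat.cast_smul_eq_nsmul ℝ, smul_sub, smul_smul,
      smul_smul, hεc]
    congr 2 <;> field_simp
  intro w
  have hlim : Tendsto (fun N : ℕ => ((δ / 2 : ℝ) • (gaussChannel u δ).op (Functional.variance u)) w -
      δ ^ 2 * (2 * U) ^ 4 / N * Functional.mass 𝒳 w) atTop
      (𝓝 (((δ / 2 : ℝ) • (gaussChannel u δ).op (Functional.variance u)) w - 0 *
        Functional.mass 𝒳 w)) :=
    (tendsto_const_nhds).sub ((tendsto_const_div_atTop_nhds_zero_nat _).mul_const _)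
  rw [zero_mul, sub_zero] at hlim
  refine le_of_tendsto hlim ?_
  filter_upwards [eventually_ge_atTop ⌈(δ : ℝ) * (2 * U) ^ 2⌉₊, eventually_ne_atTop 0] with N hN hN0
  exact key N (Nat.ceil_le.mp hN) hN0 w

end Gaussian

section Rows

/-! ### Gaussian rows -/

variable {κ : Type*} [Fintype κ] {𝒳 : Type*} [Fintype 𝒳]

/-- The law of a row of independent centred Gaussian entries of variance `v`. -/
def rowLaw (κ : Type*) [Fintype κ] (v : ℝ≥0) : Measure (κ → ℝ) := Measure.pi fun _ => gaussianReal 0 v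

instance (v : ℝ≥0) : IsProbabilityMeasure (rowLaw κ v) := by unfold rowLaw; infer_instance

lemma integral_cexp_rowLaw (v : ℝ≥0) (z : κ → ℝ) :
    ∫ φ, Complex.exp (Complex.I * ((∑ i, φ i * z i : ℝ) : ℂ)) ∂rowLaw κ v =
      ((Real.exp (-(v * ∑ i, z i ^ 2) / 2) : ℝ) : ℂ) := by
  have h : ∀ φ : κ → ℝ, Complex.exp (Complex.I * ((∑ i, φ i * z i : ℝ) : ℂ)) =
      ∏ i, Complex.exp (z i * φ i * Complex.I) := by
    intro φ
    rw [← Complex.exp_sum]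
    congr 1
    push_cast
    rw [Finset.mul_sum]
    exact Finset.sum_congr rfl fun i _ => by ring
  simp only [h]
  rw [rowLaw, integral_fintype_prod_eq_prod (𝕜 := ℂ)
    (fun i (a : ℝ) => Complex.exp (z i * a * Complex.I))]
  have h2 : ∀ i, ∫ a, Complex.exp (z i * a * Complex.I) ∂gaussianReal 0 v =
      Complex.exp (-(v * z i ^ 2 / 2)) := by
    intro i
    have := charFun_gaussianReal (μ := 0) (v := v) (z i)
    rw [charFun_apply_real] at this
    rw [this]
    congr 1
    push_cast
    ring
  simp only [h2]
  rw [← Complex.exp_sum]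
  push_cast
  congr 1
  rw [Finset.sum_neg_distrib, Finset.mul_sum, neg_div, Finset.sum_div]

/-- A linear form of a Gaussian row is Gaussian. -/
lemma rowLaw_map_linear (v : ℝ≥0) (z : κ → ℝ) :
    (rowLaw κ v).map (fun φ => ∑ i, φ i * z i) =
      gaussianReal 0 (v * (∑ i, z i ^ 2).toNNReal) := by
  have hm : Measurable fun φ : κ → ℝ => ∑ i, φ i * z i := by fun_prop
  have : IsProbabilityMeasure ((rowLaw κ v).map (fun φ => ∑ i, φ i * z i)) :=
    Measure.isProbabilityMeasure_map hm.aemeasurable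
  refine Measure.ext_of_charFun (funext fun t => ?_)
  rw [charFun_gaussianReal, charFun_apply_real, integral_map hm.aemeasurable (by fun_prop)]
  have h := integral_cexp_rowLaw v fun i => t * z i
  have h2 : ∀ φ : κ → ℝ, (∑ i, φ i * (t * z i)) = t * ∑ i, φ i * z i := fun φ => by
    rw [Finset.mul_sum]; exact Finset.sum_congr rfl fun i _ => by ring
  simp only [h2] at h
  convert h using 1
  · refine integral_congr_ae (ae_of_all _ fun φ => ?_)
    simp only
    congr 1
    push_cast
    ring
  · push_cast
    congr 1
    rw [Real.coe_toNNReal _ (by positivity)]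
    push_cast
    simp only [mul_pow, ← Finset.mul_sum]
    ring

lemma integral_sq_linear_rowLaw (v : ℝ≥0) (z : κ → ℝ) :
    Integrable (fun φ => (∑ i, φ i * z i) ^ 2) (rowLaw κ v) ∧
    ∫ φ, (∑ i, φ i * z i) ^ 2 ∂rowLaw κ v = v * ∑ i, z i ^ 2 := by
  have hm : Measurable fun φ : κ → ℝ => ∑ i, φ i * z i := by fun_prop
  constructor
  · have := integrable_sq_gaussianReal 0 (v * (∑ i, z i ^ 2).toNNReal)
    rw [← rowLaw_map_linear, integrable_map_measure (by fun_prop) hm.aemeasurable] at this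
    exact this
  · have := integral_sq_gaussianReal 0 (v * (∑ i, z i ^ 2).toNNReal)
    rw [← rowLaw_map_linear, integral_map hm.aemeasurable (by fun_prop)] at this
    rw [this, NNReal.coe_mul, Real.coe_toNNReal _ (by positivity)]
    ring

/-- The channel that outputs a random Gaussian linear form `φ` of the features `X`, together with
a noisy observation of its value. -/
def rowChannel (X : 𝒳 → κ → ℝ) (v δ : ℝ≥0) : Channel ((κ → ℝ) × ℝ) 𝒳 where
  ref := (rowLaw κ v).prod (gaussianReal 0 δ)
  sfinite := inferInstance
  dens p x := (gaussChannel (fun x => ∑ i, p.1 i * X x i) δ).dens p.2 x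
  measurable_dens := by
    refine measurable_pi_lambda _ fun x => Measurable.subtype_mk (p := fun r : ℝ => 0 ≤ r) ?_
    fun_prop
  lintegral_dens x := by
    rw [lintegral_prod]
    · have h : ∀ φ : κ → ℝ, ∫⁻ y,
          ((gaussChannel (fun x => ∑ i, φ i * X x i) δ).dens y x : ENNReal) ∂gaussianReal 0 δ = 1 :=
        fun φ => (gaussChannel (fun x => ∑ i, φ i * X x i) δ).lintegral_dens x
      simp [h]
    · have hm : Measurable fun p : (κ → ℝ) × ℝ =>
          (gaussChannel (fun x => ∑ i, p.1 i * X x i) δ).dens p.2 x :=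
        Measurable.subtype_mk (p := fun r : ℝ => 0 ≤ r) (by fun_prop)
      fun_prop

lemma rowChannel_op_apply (X : 𝒳 → κ → ℝ) (v δ : ℝ≥0) (F : Functional 𝒳) (w : 𝒳 → ℝ≥0) :
    Integrable (fun φ => (gaussChannel (fun x => ∑ i, φ i * X x i) δ).op F w) (rowLaw κ v) ∧
    (rowChannel X v δ).op F w =
      ∫ φ, (gaussChannel (fun x => ∑ i, φ i * X x i) δ).op F w ∂rowLaw κ v := by
  have h := (rowChannel X v δ).integrable_comp_update F w
  exact ⟨h.integral_prod_left, integral_prod _ h⟩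

/-- Write the variance as a mean square of centred linear forms. Row entries are independent and
centred, so cross terms average to zero and only the individual feature variances survive. -/
lemma integral_variance_rowLaw (X : 𝒳 → κ → ℝ) (v : ℝ≥0) (w : 𝒳 → ℝ≥0) :
    Integrable (fun φ : κ → ℝ => Functional.varianceFun (fun x => ∑ i, φ i * X x i) w)
      (rowLaw κ v) ∧
    ∫ φ, Functional.varianceFun (fun x => ∑ i, φ i * X x i) w ∂rowLaw κ v =
      v * ∑ i, Functional.varianceFun (fun x => X x i) w := by
  set m : κ → ℝ := fun i => (∑ x, w x * X x i) / ∑ x, (w x : ℝ)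
  have h : ∀ φ : κ → ℝ, Functional.varianceFun (fun x => ∑ i, φ i * X x i) w =
      ∑ x, w x * (∑ i, φ i * (X x i - m i)) ^ 2 := by
    intro φ
    rw [Functional.varianceFun_eq]
    refine Finset.sum_congr rfl fun x _ => ?_
    have hm : (∑ x, (w x : ℝ) * ∑ i, φ i * X x i) / ∑ x, (w x : ℝ) = ∑ i, φ i * m i := by
      simp only [m, mul_div_assoc', Finset.mul_sum, ← Finset.sum_div]
      rw [Finset.sum_comm]
      congr 1
      exact Finset.sum_congr rfl fun i _ => Finset.sum_congr rfl fun x _ => by ring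
    rw [hm]
    simp only [mul_sub, Finset.sum_sub_distrib]
  simp only [h]
  have hi := fun x => integral_sq_linear_rowLaw v fun i => X x i - m i
  refine ⟨integrable_finsetSum _ fun x _ => (hi x).1.const_mul _, ?_⟩
  rw [integral_finsetSum _ fun x _ => (hi x).1.const_mul _]
  simp only [integral_const_mul, (hi _).2, Functional.varianceFun_eq, m]
  simp only [Finset.mul_sum]
  rw [Finset.sum_comm]
  exact Finset.sum_congr rfl fun i _ => Finset.sum_congr rfl fun x _ => by ring

/-- The sum of the variances of the features. -/
def totalVariance (X : 𝒳 → κ → ℝ) : Functional 𝒳 := ∑ i, Functional.variance fun x => X x i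

lemma totalVariance_apply (X : 𝒳 → κ → ℝ) (w : 𝒳 → ℝ≥0) :
    totalVariance X w = ∑ i, Functional.varianceFun (fun x => X x i) w :=
  Functional.sum_apply _ _ _

lemma totalVariance_nonneg (X : 𝒳 → κ → ℝ) : 0 ≤ totalVariance X :=
  Finset.sum_nonneg fun _ _ => Functional.variance_nonneg _

/-- The scalar bound is affine in the variance of the linear form, so averaging over the row
replaces that variance by `v` times the total variance. -/
lemma entropy_sub_rowChannel_le (X : 𝒳 → κ → ℝ) (v δ : ℝ≥0) {E : ℝ} (hE : 0 ≤ E) :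
    Functional.entropy 𝒳 - (rowChannel X v δ).op (Functional.entropy 𝒳) ≤
      (Real.log (1 + δ * E) / 2 - δ * E / (1 + δ * E) / 2) • Functional.mass 𝒳 +
      (δ / (1 + δ * E) / 2 * v) • totalVariance X := by
  intro w
  obtain ⟨hi, he⟩ := rowChannel_op_apply X v δ (Functional.entropy 𝒳) w
  obtain ⟨hi2, he2⟩ := integral_variance_rowLaw X v w
  have hmono := integral_mono ((integrable_const (Functional.entropy 𝒳 w)).sub hi)
    ((integrable_const ((Real.log (1 + δ * E) / 2 - δ * E / (1 + δ * E) / 2) *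
      Functional.mass 𝒳 w)).add (hi2.const_mul (δ / (1 + δ * E) / 2))) fun φ =>
    entropy_sub_gaussChannel_le (fun x => ∑ i, φ i * X x i) δ hE w
  simp only [Pi.sub_apply, Pi.add_apply] at hmono
  rw [integral_sub (integrable_const _) hi, integral_add (integrable_const _)
    (hi2.const_mul _), ← he, integral_const_mul (δ / (1 + δ * E) / 2 : ℝ)
    (fun φ : κ → ℝ => Functional.varianceFun (fun x => ∑ i, φ i * X x i) w), he2,
    ← totalVariance_apply] at hmono
  simp only [integral_const, probReal_univ, one_smul] at hmono
  show Functional.entropy 𝒳 w - _ ≤ _ * _ + _ * _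
  rw [mul_assoc (δ / (1 + δ * E) / 2 : ℝ)]
  exact hmono

/-! ### Products of Gaussian channels -/

/-- The composition of the scalar Gaussian channels of all features. -/
def sideOp (X : 𝒳 → κ → ℝ) (δ : ℝ≥0) : Module.End ℝ (Functional 𝒳) :=
  (Finset.univ.toList.map fun i => (gaussChannel (fun x => X x i) δ).op).prod

lemma list_prod_le {l : List (Module.End ℝ (Functional 𝒳))} {F : Functional 𝒳}
    (h : ∀ T ∈ l, IsAveraging T ∧ T F ≤ F) : l.prod F ≤ F := by
  induction l with
  | nil => simp
  | cons T l ih =>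
    rw [List.prod_cons, Module.End.mul_apply]
    obtain ⟨hT, hTF⟩ := h T (by simp)
    exact (hT.mono (ih fun S hS => h S (by simp [hS]))).trans hTF

lemma isAveraging_sideOp (X : 𝒳 → κ → ℝ) (δ : ℝ≥0) : IsAveraging (sideOp X δ) := by
  refine IsAveraging.list_prod fun T hT => ?_
  obtain ⟨i, _, rfl⟩ := List.mem_map.mp hT
  exact Channel.isAveraging_op _

lemma sideOp_variance_le (X : 𝒳 → κ → ℝ) (δ : ℝ≥0) (f : 𝒳 → ℝ) :
    sideOp X δ (Functional.variance f) ≤ Functional.variance f := by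
  refine list_prod_le fun T hT => ?_
  obtain ⟨i, _, rfl⟩ := List.mem_map.mp hT
  exact ⟨Channel.isAveraging_op _, Channel.op_variance_le _ _⟩

lemma sideOp_totalVariance_le (X : 𝒳 → κ → ℝ) (δ : ℝ≥0) :
    sideOp X δ (totalVariance X) ≤ totalVariance X := by
  rw [totalVariance, map_sum]
  exact Finset.sum_le_sum fun i _ => sideOp_variance_le X δ _

/-- Chain rule by induction on the list. The head channel reveals at least half its precision times
the variance left by itself alone, and further channels only lower that variance. -/
lemma le_entropy_sub_list_prod (X : 𝒳 → κ → ℝ) (δ : ℝ≥0) (l : List κ) :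
    (δ / 2 : ℝ) • (l.map fun i => (gaussChannel (fun x => X x i) δ).op).prod
        (l.map fun i => Functional.variance fun x => X x i).sum ≤
      Functional.entropy 𝒳 - (l.map fun i => (gaussChannel (fun x => X x i) δ).op).prod
        (Functional.entropy 𝒳) := by
  induction l with
  | nil => simp
  | cons i l ih =>
    simp only [List.map_cons, List.prod_cons, List.sum_cons, Module.End.mul_apply, map_add]
    set G := (gaussChannel (fun x => X x i) δ).op
    set R := (l.map fun i => (gaussChannel (fun x => X x i) δ).op).prod
    set V := (l.map fun i => Functional.variance fun x => X x i).sum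
    have hG : IsAveraging G := Channel.isAveraging_op _
    have h1 := hG.mono ih
    rw [map_smul, map_sub] at h1
    have h2 := le_entropy_sub_gaussChannel (fun x => X x i) δ
    have h3 : R (Functional.variance fun x => X x i) ≤ Functional.variance fun x => X x i := by
      refine list_prod_le fun T hT => ?_
      obtain ⟨i, _, rfl⟩ := List.mem_map.mp hT
      exact ⟨Channel.isAveraging_op _, Channel.op_variance_le _ _⟩
    have h4 := hG.mono h3
    have h5 : (δ / 2 : ℝ) • G (R (Functional.variance fun x => X x i)) ≤
        (δ / 2 : ℝ) • G (Functional.variance fun x => X x i) := fun w =>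
      mul_le_mul_of_nonneg_left (h4 w) (by positivity)
    rw [smul_add]
    calc _ ≤ (δ / 2 : ℝ) • G (Functional.variance fun x => X x i) + (δ / 2 : ℝ) • G (R V) :=
          add_le_add_left h5 _
      _ ≤ (Functional.entropy 𝒳 - G (Functional.entropy 𝒳)) +
          (G (Functional.entropy 𝒳) - G (R (Functional.entropy 𝒳))) := add_le_add h2 h1
      _ = _ := by abel

lemma le_entropy_sub_sideOp (X : 𝒳 → κ → ℝ) (δ : ℝ≥0) :
    (δ / 2 : ℝ) • sideOp X δ (totalVariance X) ≤
      Functional.entropy 𝒳 - sideOp X δ (Functional.entropy 𝒳) := by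
  have h := le_entropy_sub_list_prod X δ Finset.univ.toList
  rwa [Finset.sum_map_toList] at h

lemma sideOp_entropy_le (X : 𝒳 → κ → ℝ) (δ : ℝ≥0) :
    sideOp X δ (Functional.entropy 𝒳) ≤ Functional.entropy 𝒳 := by
  refine list_prod_le fun T hT => ?_
  obtain ⟨i, _, rfl⟩ := List.mem_map.mp hT
  exact ⟨Channel.isAveraging_op _, Channel.op_entropy_le _⟩

lemma commute_rowChannel_sideOp (X : 𝒳 → κ → ℝ) (v δ δ' : ℝ≥0) :
    Commute (rowChannel X v δ).op (sideOp X δ') := by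
  refine Commute.list_prod_right _ _ fun T hT => ?_
  obtain ⟨i, _, rfl⟩ := List.mem_map.mp hT
  exact Channel.commute_op _ _

lemma list_prod_map_pow {M ι : Type*} [Monoid M] (g : ι → M) (hg : ∀ i j, Commute (g i) (g j))
    (n : ℕ) (l : List ι) : (l.map g).prod ^ n = (l.map fun i => g i ^ n).prod := by
  induction l with
  | nil => simp
  | cons i l ih =>
    simp only [List.map_cons, List.prod_cons]
    rw [Commute.mul_pow, ih]
    refine Commute.list_prod_right _ _ fun T hT => ?_
    obtain ⟨j, _, rfl⟩ := List.mem_map.mp hT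
    exact hg i j

lemma sideOp_pow (X : 𝒳 → κ → ℝ) (δ : ℝ≥0) (n : ℕ) : sideOp X δ ^ n = sideOp X (n * δ) := by
  rw [sideOp, list_prod_map_pow _ fun i j => Channel.commute_op _ _]
  simp only [gaussChannel_op_pow]
  rfl

lemma list_prod_map_mul {M ι : Type*} [Monoid M] (g h : ι → M)
    (hg : ∀ i j, Commute (g i) (h j)) (l : List ι) :
    (l.map g).prod * (l.map h).prod = (l.map fun i => g i * h i).prod := by
  induction l with
  | nil => simp
  | cons i l ih =>
    simp only [List.map_cons, List.prod_cons]
    have : Commute (l.map g).prod (h i) := by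
      refine Commute.list_prod_left _ _ fun T hT => ?_
      obtain ⟨j, _, rfl⟩ := List.mem_map.mp hT
      exact hg j i
    rw [← ih, mul_assoc, mul_assoc, ← mul_assoc _ (h i), this.eq, mul_assoc]

lemma sideOp_mul (X : 𝒳 → κ → ℝ) (δ δ' : ℝ≥0) :
    sideOp X δ * sideOp X δ' = sideOp X (δ + δ') := by
  rw [sideOp, sideOp, list_prod_map_mul _ _ fun i j => Channel.commute_op _ _]
  simp only [gaussChannel_op_mul]
  rfl

/-! ### The interpolation -/

/-- Summation of the increments along the antidiagonals of a double sequence. -/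
lemma antidiagonal_bound {h b : ℕ → ℕ → ℝ} {K β : ℝ}
    (hstep : ∀ m j, h m (j + 1) - h (m + 1) j ≤ K + (b m j - b m (j + 1)))
    (hanti : ∀ m, Antitone (h m)) (hb : ∀ m j, 0 ≤ b m j) (hβ : ∀ m j, b m j ≤ β) (M N : ℕ) :
    N * (h 0 (M + N) - h M 0) ≤ N * (M * K) + M * β := by
  -- Summing over `N` consecutive offsets makes the differences of `b` telescope, so each exchange
  -- contributes at most `β` in total; the shift `a` lets the induction move along the antidiagonal.
  have key : ∀ M a, ∑ j ∈ Finset.range N, (h 0 (M + a + j) - h M (a + j)) ≤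
      N * (M * K) + M * β := by
    intro M
    induction M with
    | zero => intro a; simp
    | succ M ih =>
      intro a
      have h1 := ih (a + 1)
      have h2 : ∑ j ∈ Finset.range N, (h M (a + j + 1) - h (M + 1) (a + j)) ≤
          ∑ j ∈ Finset.range N, (K + (b M (a + j) - b M (a + (j + 1)))) :=
        Finset.sum_le_sum fun j _ => hstep M (a + j)
      rw [Finset.sum_add_distrib, Finset.sum_range_sub' (fun j => b M (a + j))] at h2
      simp only [Finset.sum_const, Finset.card_range, nsmul_eq_mul] at h2
      have h3 : ∑ j ∈ Finset.range N, (h 0 (M + 1 + a + j) - h (M + 1) (a + j)) =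
          ∑ j ∈ Finset.range N, (h 0 (M + (a + 1) + j) - h M (a + 1 + j)) +
          ∑ j ∈ Finset.range N, (h M (a + j + 1) - h (M + 1) (a + j)) := by
        rw [← Finset.sum_add_distrib]
        refine Finset.sum_congr rfl fun j _ => ?_
        rw [show M + (a + 1) + j = M + 1 + a + j by ring, show a + 1 + j = a + j + 1 by ring]
        ring
      rw [h3]
      push_cast
      have := hb M (a + N)
      have := hβ M (a + 0)
      nlinarith
  -- By monotonicity in `j`, each of the `N` summands is at least `h 0 (M + N) - h M 0`.
  refine le_trans ?_ (key M 0)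
  rw [← nsmul_eq_mul, ← Finset.card_range N, ← Finset.sum_const, Finset.card_range]
  refine Finset.sum_le_sum fun j hj => ?_
  have hj' := Finset.mem_range.mp hj
  exact sub_le_sub (hanti 0 (by omega)) (hanti M (Nat.zero_le _))

/-- The interpolation bound between the measurement channel and the side channel. -/
theorem sideOp_le_rowChannel (X : 𝒳 → κ → ℝ) (v δ ε : ℝ≥0) {E : ℝ} (hE : 0 ≤ E)
    (hε : (ε : ℝ) = δ * v / (1 + δ * E)) {β : ℝ} (hβ : v • totalVariance X ≤ β • Functional.mass 𝒳)
    (M N : ℕ) (w : 𝒳 → ℝ≥0) :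
    N * ((sideOp X ε ^ (M + N)) (Functional.entropy 𝒳) w -
        ((rowChannel X v δ).op ^ M) (Functional.entropy 𝒳) w) ≤
      (N * (M * (Real.log (1 + δ * E) / 2 - δ * E / (1 + δ * E) / 2)) +
        M * (δ / (1 + δ * E) / 2 * β)) * Functional.mass 𝒳 w := by
  set T := (rowChannel X v δ).op
  set S := sideOp X ε
  set H := Functional.entropy 𝒳
  set ψ := Real.log (1 + δ * E) / 2 - δ * E / (1 + δ * E) / 2
  set c := δ / (1 + δ * E) / 2 with hc
  have hc0 : 0 ≤ c := by positivity
  set e : Functional 𝒳 := (v : ℝ) • totalVariance X with he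
  have hT : IsAveraging T := Channel.isAveraging_op _
  have hS : IsAveraging S := isAveraging_sideOp _ _
  have hST : Commute T S := commute_rowChannel_sideOp _ _ _ _
  have hTH : H - T H ≤ ψ • Functional.mass 𝒳 + c • e := by
    have := entropy_sub_rowChannel_le X v δ hE
    rwa [← smul_smul] at this
  have hSH : c • S e ≤ H - S H := by
    have := le_entropy_sub_sideOp X ε
    -- The precision `ε` is exactly the one for which the lower bound for `S` and the upper bound
    -- for `T` carry the same coefficient of the variance.
    rw [he, map_smul, smul_smul, show c * v = ε / 2 by rw [hε, hc]; ring]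
    exact this
  have hSe : S e ≤ e := by
    rw [he, map_smul]
    intro w
    exact mul_le_mul_of_nonneg_left (sideOp_totalVariance_le X ε w) v.coe_nonneg
  have he0 : 0 ≤ e := fun w => mul_nonneg v.coe_nonneg (totalVariance_nonneg X w)
  replace hβ : e ≤ β • Functional.mass 𝒳 := hβ
  clear_value e
  have hav : ∀ m j, IsAveraging (T ^ m * S ^ j) := fun m j => (hT.pow m).mul (hS.pow j)
  have hTmS : ∀ m j F, (T ^ m * S ^ j) (T F) = (T ^ (m + 1) * S ^ j) F := by
    intro m j F
    rw [← Module.End.mul_apply, mul_assoc, (hST.pow_right j).symm.eq, ← mul_assoc, ← pow_succ]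
  have hTSj : ∀ m j F, (T ^ m * S ^ j) (S F) = (T ^ m * S ^ (j + 1)) F := by
    intro m j F
    rw [← Module.End.mul_apply, mul_assoc, ← pow_succ]
  -- Here `h m j` is the entropy left by `m` rows and `j` side observations, and `b m j` the matched
  -- multiple of the variance left by them.
  have main := antidiagonal_bound (h := fun m j => (T ^ m * S ^ j) H w)
    (b := fun m j => c * (T ^ m * S ^ j) e w) (K := ψ * Functional.mass 𝒳 w)
    (β := c * (β * Functional.mass 𝒳 w)) ?_ ?_ ?_ ?_ M N
  · simp only [pow_zero, one_mul, mul_one] at main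
    refine main.trans (le_of_eq ?_)
    ring
  · intro m j
    have h1 := (hav m j).mono hTH w
    have h2 := (hav m j).mono hSH w
    rw [map_add, map_smul, map_smul, map_sub, hTmS, (hav m j).mass] at h1
    rw [map_smul, map_sub, hTSj, hTSj] at h2
    have h1' : (T ^ m * S ^ j) H w - (T ^ (m + 1) * S ^ j) H w ≤
      ψ * Functional.mass 𝒳 w + c * (T ^ m * S ^ j) e w := h1
    have h2' : c * (T ^ m * S ^ (j + 1)) e w ≤
      (T ^ m * S ^ j) H w - (T ^ m * S ^ (j + 1)) H w := h2
    linarith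
  · intro m
    refine antitone_nat_of_succ_le fun j => ?_
    have h := (hav m j).mono (sideOp_entropy_le X ε) w
    rw [hTSj] at h
    exact h
  · intro m j
    exact mul_nonneg hc0 ((hav m j).nonneg e he0 w)
  · intro m j
    refine mul_le_mul_of_nonneg_left ?_ hc0
    have h := (hav m j).mono hβ w
    rw [map_smul, (hav m j).mass] at h
    exact h

end Rows

/-! ### Product systems -/

section Product

variable {β : Type*} [Fintype β] [DecidableEq β] {𝒳 : β → Type*} [∀ b, Fintype (𝒳 b)]
  {Y : Type*} [MeasurableSpace Y]

/-- The product of weight vectors. -/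
def prodWeight (w : ∀ b, 𝒳 b → ℝ≥0) : (∀ b, 𝒳 b) → ℝ≥0 := fun x => ∏ b, w b (x b)

/-- A functional on a product system that is additive over the factors of a product weight. -/
def Decomposes (Ψ : Functional (∀ b, 𝒳 b)) (F : ∀ b, Functional (𝒳 b)) : Prop :=
  ∀ w : ∀ b, 𝒳 b → ℝ≥0, Ψ (prodWeight w) =
    ∑ b, F b (w b) * ∏ b' ∈ Finset.univ.erase b, Functional.mass (𝒳 b') (w b')

/-- The function `-x log x` obeys the Leibniz rule on products; this is the algebraic source of
additivity of the entropy. -/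
lemma negMulLog_prod {ι : Type*} [DecidableEq ι] (s : Finset ι) (a : ι → ℝ) :
    Real.negMulLog (∏ i ∈ s, a i) = ∑ i ∈ s, Real.negMulLog (a i) * ∏ j ∈ s.erase i, a j := by
  induction s using Finset.induction_on with
  | empty => simp
  | insert c s hc ih =>
    rw [Finset.prod_insert hc, Real.negMulLog_mul, ih, Finset.sum_insert hc,
      Finset.erase_insert hc, Finset.mul_sum]
    congr 1
    · ring
    · refine Finset.sum_congr rfl fun i hi => ?_
      have hci : c ≠ i := fun h => hc (h ▸ hi)
      rw [Finset.erase_insert_of_ne hci, Finset.prod_insert (fun h => hc (Finset.mem_of_mem_erase h))]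
      ring

lemma sum_prodWeight (w : ∀ b, 𝒳 b → ℝ≥0) :
    ∑ x, (prodWeight w x : ℝ) = ∏ b, Functional.mass (𝒳 b) (w b) := by
  simp only [prodWeight, NNReal.coe_prod, Functional.mass_apply]
  rw [Finset.prod_univ_sum]
  simp

/-- The Leibniz rule is applied both to each product weight and to the total mass. In each term,
summing out the undifferentiated factors produces their masses. -/
lemma decomposes_entropy :
    Decomposes (Functional.entropy (∀ b, 𝒳 b)) fun b => Functional.entropy (𝒳 b) := by
  intro w
  simp only [Functional.entropy_apply, Functional.entropyFun]
  rw [sum_prodWeight, negMulLog_prod]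
  simp only [prodWeight, NNReal.coe_prod, negMulLog_prod]
  rw [Finset.sum_comm, ← Finset.sum_sub_distrib]
  refine Finset.sum_congr rfl fun b _ => ?_
  rw [sub_mul]
  congr 1
  have h := Finset.prod_univ_sum (fun b => (Finset.univ : Finset (𝒳 b)))
    (fun b' (j : 𝒳 b') => if b' = b then Real.negMulLog (w b' j) else (w b' j : ℝ))
  rw [Fintype.piFinset_univ, ← Finset.mul_prod_erase _ _ (Finset.mem_univ b)] at h
  simp only [if_true] at h
  rw [Finset.prod_congr rfl (g := fun b' => Functional.mass (𝒳 b') (w b'))] at h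
  · rw [h]
    refine Finset.sum_congr rfl fun x _ => ?_
    rw [← Finset.mul_prod_erase _ _ (Finset.mem_univ b)]
    simp only [if_true]
    congr 1
    exact Finset.prod_congr rfl fun b' hb' => by rw [if_neg (Finset.ne_of_mem_erase hb')]
  · intro b' hb'
    simp only [if_neg (Finset.ne_of_mem_erase hb'), Functional.mass_apply]

/-- A channel acting on one factor of a product system. -/
def Channel.lift (c : β) (C : Channel Y (𝒳 c)) : Channel Y (∀ b, 𝒳 b) where
  ref := C.ref
  sfinite := C.sfinite
  dens y x := C.dens y (x c)
  measurable_dens := measurable_pi_lambda _ fun x =>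
    (measurable_pi_apply (x c)).comp C.measurable_dens
  lintegral_dens x := C.lintegral_dens (x c)

lemma Channel.lift_update (c : β) (C : Channel Y (𝒳 c)) (w : ∀ b, 𝒳 b → ℝ≥0) (y : Y) :
    (Channel.lift c C).update (prodWeight w) y =
      prodWeight (Function.update w c (C.update (w c) y)) := by
  funext x
  simp only [Channel.update, prodWeight, Channel.lift]
  rw [← Finset.mul_prod_erase _ _ (Finset.mem_univ c),
    ← Finset.mul_prod_erase _ (fun b => Function.update w c _ b (x b)) (Finset.mem_univ c)]
  rw [Function.update_self, mul_right_comm]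
  congr 1
  exact Finset.prod_congr rfl fun b hb => by
    rw [Function.update_of_ne (Finset.ne_of_mem_erase hb)]

/-- In the term of the observed factor the functional is replaced by its average. In every other
term the channel affects only the mass of factor `c`, which it preserves on average. -/
lemma Decomposes.lift {Ψ : Functional (∀ b, 𝒳 b)} {F : ∀ b, Functional (𝒳 b)}
    (h : Decomposes Ψ F) (c : β) (C : Channel Y (𝒳 c)) :
    Decomposes ((Channel.lift c C).op Ψ) (Function.update F c (C.op (F c))) := by
  intro w
  rw [Channel.op_apply]
  simp only [Channel.lift_update, h _]
  have hterm : ∀ b, Integrable (fun y => F b (Function.update w c (C.update (w c) y) b) *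
      ∏ b' ∈ Finset.univ.erase b,
        Functional.mass (𝒳 b') (Function.update w c (C.update (w c) y) b')) C.ref ∧
      ∫ y, F b (Function.update w c (C.update (w c) y) b) * ∏ b' ∈ Finset.univ.erase b,
        Functional.mass (𝒳 b') (Function.update w c (C.update (w c) y) b') ∂C.ref =
      Function.update F c (C.op (F c)) b (w b) *
        ∏ b' ∈ Finset.univ.erase b, Functional.mass (𝒳 b') (w b') := by
    intro b
    by_cases hb : b = c
    · subst hb
      have hp : ∀ y, ∏ b' ∈ Finset.univ.erase b,
          Functional.mass (𝒳 b') (Function.update w b (C.update (w b) y) b') =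
          ∏ b' ∈ Finset.univ.erase b, Functional.mass (𝒳 b') (w b') := fun y =>
        Finset.prod_congr rfl fun b' hb' => by
          rw [Function.update_of_ne (Finset.ne_of_mem_erase hb')]
      simp only [Function.update_self, hp]
      exact ⟨(C.integrable_comp_update _ _).mul_const _, by
        rw [integral_mul_const, Channel.op_apply]⟩
    · have hc : c ∈ Finset.univ.erase b := by simp [Ne.symm hb]
      have hp : ∀ y, F b (Function.update w c (C.update (w c) y) b) * ∏ b' ∈ Finset.univ.erase b,
          Functional.mass (𝒳 b') (Function.update w c (C.update (w c) y) b') =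
          Functional.mass (𝒳 c) (C.update (w c) y) * (F b (w b) *
            ∏ b' ∈ (Finset.univ.erase b).erase c, Functional.mass (𝒳 b') (w b')) := by
        intro y
        rw [Function.update_of_ne hb, ← Finset.mul_prod_erase _ _ hc, Function.update_self]
        rw [Finset.prod_congr rfl (g := fun b' => Functional.mass (𝒳 b') (w b'))]
        · ring
        · intro b' hb'
          rw [Function.update_of_ne (Finset.ne_of_mem_erase hb')]
      simp only [hp]
      refine ⟨(C.integrable_comp_update _ _).mul_const _, ?_⟩
      rw [integral_mul_const, ← Channel.op_apply, C.isAveraging_op.mass, Function.update_of_ne hb,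
        ← Finset.mul_prod_erase (Finset.univ.erase b) (fun b' => Functional.mass (𝒳 b') (w b')) hc]
      ring
  have := integral_finsetSum (μ := C.ref) Finset.univ fun b _ => (hterm b).1
  exact this.trans (Finset.sum_congr rfl fun b _ => (hterm b).2)

/-- A random choice of the observed factor couples the factors, but an additive functional sees only
each marginal: factor `b` is observed with probability `π b` and otherwise left alone. Iteration
gives each factor a binomial number of observations. -/
lemma Decomposes.average {Y : β → Type*} [∀ b, MeasurableSpace (Y b)]
    {Ψ : Functional (∀ b, 𝒳 b)} {F : ∀ b, Functional (𝒳 b)}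
    (h : Decomposes Ψ F) (C : ∀ b, Channel (Y b) (𝒳 b)) {π : β → ℝ} (hπ : ∑ b, π b = 1) :
    Decomposes ((∑ b, π b • (Channel.lift b (C b)).op) Ψ)
      fun b => (π b • (C b).op + (1 - π b) • (1 : Module.End ℝ (Functional (𝒳 b)))) (F b) := by
  intro w
  rw [LinearMap.sum_apply, Functional.sum_apply]
  simp only [LinearMap.smul_apply, Functional.smul_apply, (h.lift _ (C _)) w, Finset.mul_sum]
  rw [Finset.sum_comm]
  refine Finset.sum_congr rfl fun b _ => ?_
  have h1 : ∀ c, π c * (Function.update F c ((C c).op (F c)) b (w b) *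
      ∏ b' ∈ Finset.univ.erase b, Functional.mass (𝒳 b') (w b')) =
      (π c * F b (w b) + if c = b then π c * ((C b).op (F b) (w b) - F b (w b)) else 0) *
      ∏ b' ∈ Finset.univ.erase b, Functional.mass (𝒳 b') (w b') := by
    intro c
    split_ifs with hc
    · subst hc
      rw [Function.update_self]; ring
    · rw [Function.update_of_ne (Ne.symm hc)]; ring
  simp only [h1]
  rw [← Finset.sum_mul, Finset.sum_add_distrib, ← Finset.sum_mul, hπ]
  simp only [Finset.sum_ite_eq', Finset.mem_univ, if_true, LinearMap.add_apply,
    LinearMap.smul_apply, Functional.add_apply, Functional.smul_apply, Module.End.one_apply]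
  ring

lemma Decomposes.average_pow {Y : β → Type*} [∀ b, MeasurableSpace (Y b)]
    {Ψ : Functional (∀ b, 𝒳 b)} {F : ∀ b, Functional (𝒳 b)}
    (h : Decomposes Ψ F) (C : ∀ b, Channel (Y b) (𝒳 b)) {π : β → ℝ} (hπ : ∑ b, π b = 1) (n : ℕ) :
    Decomposes (((∑ b, π b • (Channel.lift b (C b)).op) ^ n) Ψ)
      fun b => ((π b • (C b).op + (1 - π b) • (1 : Module.End ℝ (Functional (𝒳 b)))) ^ n) (F b) := by
  induction n with
  | zero => simpa using h
  | succ n ih =>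
    simp only [pow_succ', Module.End.mul_apply]
    exact ih.average C hπ

/-- On product weights of total weight one, a decomposing functional is a sum. -/
lemma Decomposes.apply_prob {Ψ : Functional (∀ b, 𝒳 b)} {F : ∀ b, Functional (𝒳 b)}
    (h : Decomposes Ψ F) {w : ∀ b, 𝒳 b → ℝ≥0} (hw : ∀ b, ∑ x, w b x = 1) :
    Ψ (prodWeight w) = ∑ b, F b (w b) := by
  rw [h w]
  refine Finset.sum_congr rfl fun b _ => ?_
  rw [Finset.prod_eq_one, mul_one]
  intro b' _
  rw [Functional.mass_apply, coe_sum_eq_one (hw b')]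

end Product

/-! ### The side channel on product systems -/

section Side

variable {ι κ A : Type*} [Fintype ι] [DecidableEq ι] [Fintype κ] [Fintype A]

/-- The features of a sequence of sections. -/
def sectionFeatures (a : A → κ → ℝ) (x : ι → A) (i : ι × κ) : ℝ := a (x i.1) i.2

lemma Decomposes.lift_list (a : A → κ → ℝ) (δ : ℝ≥0) (c : ι) (l : List κ)
    {Ψ : Functional (ι → A)} {F : ι → Functional A} (h : Decomposes (𝒳 := fun _ => A) Ψ F) :
    Decomposes (𝒳 := fun _ => A)
      ((l.map fun i => (gaussChannel (fun x : ι → A => sectionFeatures a x (c, i)) δ).op).prod Ψ)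
      (Function.update F c ((l.map fun i => (gaussChannel (fun x => a x i) δ).op).prod (F c))) := by
  induction l with
  | nil => simpa using h
  | cons i l ih =>
    simp only [List.map_cons, List.prod_cons, Module.End.mul_apply]
    have := Decomposes.lift (𝒳 := fun _ : ι => A) ih c (gaussChannel (fun x => a x i) δ)
    rw [Function.update_self, Function.update_idem] at this
    exact this

lemma Decomposes.lift_list_list (a : A → κ → ℝ) (δ : ℝ≥0) (l : List κ) (l' : List ι)
    (hl' : l'.Nodup) {Ψ : Functional (ι → A)} {F : ι → Functional A}
    (h : Decomposes (𝒳 := fun _ => A) Ψ F) :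
    Decomposes (𝒳 := fun _ => A)
      ((l'.map fun c => (l.map fun i =>
        (gaussChannel (fun x : ι → A => sectionFeatures a x (c, i)) δ).op).prod).prod Ψ)
      (fun c => if c ∈ l' then (l.map fun i => (gaussChannel (fun x => a x i) δ).op).prod (F c)
        else F c) := by
  induction l' with
  | nil => simpa using h
  | cons c l' ih =>
    obtain ⟨hc, hl'⟩ := List.nodup_cons.mp hl'
    simp only [List.map_cons, List.prod_cons, Module.End.mul_apply]
    have := Decomposes.lift_list a δ c l (ih hl')
    convert this using 1
    funext c'
    by_cases hcc : c' = c
    · subst hcc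
      simp [hc]
    · simp [hcc]

lemma sideOp_sectionFeatures (a : A → κ → ℝ) (δ : ℝ≥0) :
    sideOp (sectionFeatures a : (ι → A) → ι × κ → ℝ) δ =
      ((Finset.univ : Finset ι).toList.map fun c => ((Finset.univ : Finset κ).toList.map fun i =>
        (gaussChannel (fun x : ι → A => sectionFeatures a x (c, i)) δ).op).prod).prod := by
  classical
  have hperm : (Finset.univ : Finset (ι × κ)).toList.Perm
      ((Finset.univ : Finset ι).toList.product (Finset.univ : Finset κ).toList) := by
    refine List.perm_of_nodup_nodup_toFinset_eq (Finset.nodup_toList _)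
      ((Finset.nodup_toList _).product (Finset.nodup_toList _)) ?_
    ext ⟨i, j⟩
    simp
  rw [sideOp, (hperm.map _).prod_eq' ?_]
  · unfold List.product
    generalize (Finset.univ : Finset ι).toList = l
    induction l with
    | nil => simp
    | cons i l ih =>
      rw [List.flatMap_cons, List.map_append, List.prod_append, ih, List.map_cons, List.prod_cons,
        List.map_map]
      rfl
  · rw [List.pairwise_map]
    exact List.pairwise_of_forall fun i j => Channel.commute_op _ _

lemma Decomposes.sideOp (a : A → κ → ℝ) (δ : ℝ≥0) {Ψ : Functional (ι → A)} {F : ι → Functional A}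
    (h : Decomposes (𝒳 := fun _ => A) Ψ F) :
    Decomposes (𝒳 := fun _ => A) (sideOp (sectionFeatures a) δ Ψ)
      (fun c => _root_.sideOp a δ (F c)) := by
  have := Decomposes.lift_list_list a δ (Finset.univ : Finset κ).toList
    (Finset.univ : Finset ι).toList (Finset.nodup_toList _) h
  rw [sideOp_sectionFeatures]
  simpa [_root_.sideOp] using this

end Side

/-! ### Random numbers of channel uses -/

section Binomial

variable {𝒳 : Type*} [Fintype 𝒳]

lemma abs_le_half_add_sq {s t : ℝ} (hs : 0 < s) : |t| ≤ s / 2 + t ^ 2 / (2 * s) := by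
  have : 0 ≤ (|t| - s) ^ 2 / (2 * s) := by positivity
  have h2 : (|t| - s) ^ 2 / (2 * s) = s / 2 + t ^ 2 / (2 * s) - |t| := by
    rw [← sq_abs t]; field_simp; ring
  linarith

/-- A binomial number of channel uses is almost as informative as its mean. -/
lemma lazy_pow_apply_le {T : Module.End ℝ (Functional 𝒳)} (hT : IsAveraging T)
    {H : Functional 𝒳} {c : ℝ} (hTH : T H ≤ H) (hc : H - T H ≤ c • Functional.mass 𝒳)
    {w : 𝒳 → ℝ≥0} (hw : ∑ x, w x = 1) {π : ℝ} (hπ : 0 ≤ π) (hπ1 : π ≤ 1) {s : ℝ} (hs : 0 < s)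
    (M n : ℕ) :
    ((π • T + (1 - π) • (1 : Module.End ℝ (Functional 𝒳))) ^ M) H w ≤ (T ^ n) H w +
      c * (s / 2 + ((M * π - n) ^ 2 + M * (π * (1 - π))) / (2 * s)) := by
  have hstep : ∀ k, (T ^ (k + 1)) H w ≤ (T ^ k) H w ∧ (T ^ k) H w - (T ^ (k + 1)) H w ≤ c := by
    intro k
    have h1 := (hT.pow k).mono hTH w
    have h2 := (hT.pow k).mono hc w
    rw [← Module.End.mul_apply, ← pow_succ] at h1
    rw [map_sub, map_smul, (hT.pow k).mass, ← Module.End.mul_apply, ← pow_succ] at h2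
    refine ⟨h1, ?_⟩
    have h3 : (T ^ k) H w - (T ^ (k + 1)) H w ≤ c * Functional.mass 𝒳 w := h2
    rwa [Functional.mass_apply, coe_sum_eq_one hw, mul_one] at h3
  have hc0 : 0 ≤ c := by have := hstep 0; linarith
  have hlip : ∀ k d : ℕ, (T ^ k) H w ≤ (T ^ (k + d)) H w + c * d := by
    intro k d
    induction d with
    | zero => simp
    | succ d ih =>
      have := (hstep (k + d)).2
      rw [← add_assoc]
      push_cast
      linarith
  have hmono : ∀ k d : ℕ, (T ^ (k + d)) H w ≤ (T ^ k) H w := by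
    intro k d
    induction d with
    | zero => simp
    | succ d ih => exact ((hstep (k + d)).1).trans ih
  have habs : ∀ k : ℕ, (T ^ k) H w ≤ (T ^ n) H w + c * |(k : ℝ) - n| := by
    intro k
    rcases le_total k n with h | h
    · obtain ⟨d, rfl⟩ := Nat.exists_eq_add_of_le h
      refine (hlip k d).trans ?_
      rw [show ((k : ℝ) - ((k + d : ℕ) : ℝ)) = -d by push_cast; ring, abs_neg, Nat.abs_cast]
    · obtain ⟨d, rfl⟩ := Nat.exists_eq_add_of_le h
      have := hmono n d
      have : 0 ≤ c * |((n + d : ℕ) : ℝ) - n| := mul_nonneg hc0 (abs_nonneg _)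
      linarith
  -- The quantity `(k + M π - n)² + M π (1 - π)` is the mean square distance from `n` of `k` plus a
  -- binomial number of uses. Generalising over the `k` uses already made lets the induction
  -- condition on one use at a time.
  have key : ∀ M k : ℕ, ((π • T + (1 - π) • (1 : Module.End ℝ (Functional 𝒳))) ^ M) ((T ^ k) H) w ≤
      (T ^ n) H w + c * (s / 2 + ((k + M * π - n) ^ 2 + M * (π * (1 - π))) / (2 * s)) := by
    intro M
    induction M with
    | zero =>
      intro k
      rw [pow_zero, Module.End.one_apply]
      refine (habs k).trans (add_le_add_right (mul_le_mul_of_nonneg_left ?_ hc0) _)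
      simpa using abs_le_half_add_sq (t := (k : ℝ) - n) hs
    | succ M ih =>
      intro k
      have h1 : ((π • T + (1 - π) • (1 : Module.End ℝ (Functional 𝒳))) ^ (M + 1)) ((T ^ k) H) w =
          π * ((π • T + (1 - π) • (1 : Module.End ℝ (Functional 𝒳))) ^ M) ((T ^ (k + 1)) H) w +
          (1 - π) * ((π • T + (1 - π) • (1 : Module.End ℝ (Functional 𝒳))) ^ M) ((T ^ k) H) w := by
        rw [pow_succ, Module.End.mul_apply, LinearMap.add_apply, LinearMap.smul_apply,
          LinearMap.smul_apply, Module.End.one_apply, map_add, map_smul, map_smul,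
          ← Module.End.mul_apply T, ← pow_succ']
        rfl
      rw [h1]
      have h2 := mul_le_mul_of_nonneg_left (ih (k + 1)) hπ
      have h3 := mul_le_mul_of_nonneg_left (ih k) (sub_nonneg.mpr hπ1)
      refine (add_le_add h2 h3).trans (le_of_eq ?_)
      push_cast
      field_simp
      ring
  have := key M 0
  simpa using this

end Binomial

/-! ### The entropy of Gaussian mixtures with random projections -/

section Blur

variable {κ : Type*} [Fintype κ] {𝒳 : Type*} [Fintype 𝒳]

/-- The output density of the Gaussian channel, normalized to be at most one. -/
def blurred (u : 𝒳 → ℝ) (δ : ℝ≥0) (w : 𝒳 → ℝ≥0) (y : ℝ) : ℝ :=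
  ∑ x, w x * Real.exp (-(y - δ * u x) ^ 2 / (2 * δ))

lemma blurred_nonneg (u : 𝒳 → ℝ) (δ : ℝ≥0) (w : 𝒳 → ℝ≥0) (y : ℝ) : 0 ≤ blurred u δ w y := by
  unfold blurred; positivity

lemma blurred_le_one (u : 𝒳 → ℝ) (δ : ℝ≥0) {w : 𝒳 → ℝ≥0} (hw : ∑ x, w x = 1) (y : ℝ) :
    blurred u δ w y ≤ 1 := by
  rw [← coe_sum_eq_one hw]
  refine Finset.sum_le_sum fun x _ => mul_le_of_le_one_right (w x).coe_nonneg ?_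
  rw [Real.exp_le_one_iff, neg_div]
  exact neg_nonpos.mpr (by positivity)

/-- Information is the entropy of the output minus that of the noise, which contributes the `1 / 2`.
With the density normalised to be at most one, the integrand is nonnegative, so a lower bound may
discard all outputs outside an interval. -/
lemma entropy_sub_gaussChannel_eq (u : 𝒳 → ℝ) {δ : ℝ≥0} (hδ : δ ≠ 0) {w : 𝒳 → ℝ≥0}
    (hw : ∑ x, w x = 1) :
    Integrable (fun y => Real.negMulLog (blurred u δ w y)) ∧
    Functional.entropyFun w - (gaussChannel u δ).op (Functional.entropy 𝒳) w =
      (√(2 * Real.pi * δ))⁻¹ * (∫ y, Real.negMulLog (blurred u δ w y)) - 1 / 2 := by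
  set C := gaussChannel u δ
  have hδ' : (0 : ℝ) < δ := by exact_mod_cast pos_iff_ne_zero.mpr hδ
  have hc : 0 < √(2 * Real.pi * δ) := Real.sqrt_pos.mpr (by positivity)
  obtain ⟨hi2, he2⟩ := integral_sum_update_gaussChannel u δ w
    (fun x => δ * u x ^ 2 / 2 - Real.log (w x)) (fun x => - u x) (fun _ => 1 / (2 * δ))
  have hiH : Integrable (fun y => Functional.entropy 𝒳 (C.update w y)) (gaussianReal 0 δ) :=
    C.integrable_comp_update (Functional.entropy 𝒳) w
  have hop : C.op (Functional.entropy 𝒳) w =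
      ∫ y, Functional.entropy 𝒳 (C.update w y) ∂gaussianReal 0 δ := rfl
  have hpt : ∀ y, gaussianPDFReal 0 δ y * (∑ x, (C.update w y x : ℝ) *
      (δ * u x ^ 2 / 2 - Real.log (w x) + - u x * y + 1 / (2 * δ) * y ^ 2) -
      Functional.entropy 𝒳 (C.update w y)) =
      (√(2 * Real.pi * δ))⁻¹ * Real.negMulLog (blurred u δ w y) := by
    intro y
    rw [Functional.entropy_apply, entropyFun_update_gaussChannel]
    have hZ : 0 < ∑ x, (C.update w y x : ℝ) := by
      have hne : ∑ x, (w x : ℝ) ≠ 0 := by rw [coe_sum_eq_one hw]; exact one_ne_zero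
      obtain ⟨x, _, hx⟩ := Finset.exists_ne_zero_of_sum_ne_zero hne
      refine Finset.sum_pos' (fun x _ => NNReal.coe_nonneg _) ⟨x, Finset.mem_univ x, ?_⟩
      exact mul_pos (lt_of_le_of_ne (w x).coe_nonneg (Ne.symm hx)) (Real.exp_pos _)
    have h2 : ∑ x, (C.update w y x : ℝ) *
        (δ * u x ^ 2 / 2 - Real.log (w x) + - u x * y + 1 / (2 * δ) * y ^ 2) =
        (∑ x, (C.update w y x : ℝ)) * (y ^ 2 / (2 * δ)) -
        ∑ x, (C.update w y x : ℝ) * (Real.log (w x) + (u x * y - δ * u x ^ 2 / 2)) := by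
      rw [Finset.sum_mul, ← Finset.sum_sub_distrib]
      exact Finset.sum_congr rfl fun x _ => by ring
    have hQ : blurred u δ w y = (∑ x, (C.update w y x : ℝ)) * Real.exp (-(y ^ 2 / (2 * δ))) := by
      rw [blurred, Finset.sum_mul]
      refine Finset.sum_congr rfl fun x _ => ?_
      simp only [C, Channel.update, NNReal.coe_mul, coe_gaussChannel_dens]
      rw [mul_assoc, ← Real.exp_add]
      congr 2
      field_simp
      ring
    rw [h2, hQ, Real.negMulLog, Real.log_mul hZ.ne' (Real.exp_pos _).ne', Real.log_exp,
      gaussianPDFReal, sub_zero, neg_div]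
    ring
  have hR := hi2.sub hiH
  have hRi : ∫ y, (∑ x, (C.update w y x : ℝ) *
      (δ * u x ^ 2 / 2 - Real.log (w x) + - u x * y + 1 / (2 * δ) * y ^ 2) -
      Functional.entropy 𝒳 (C.update w y)) ∂gaussianReal 0 δ =
      1 / 2 + Functional.entropyFun w - C.op (Functional.entropy 𝒳) w := by
    rw [integral_sub hi2 hiH, he2, ← hop, entropyFun_of_prob hw]
    congr 1
    have : ∑ x, (w x : ℝ) * (δ * u x ^ 2 / 2 - Real.log (w x) + - u x * (δ * u x) +
      1 / (2 * δ) * (δ + (δ * u x) ^ 2)) = 1 / 2 * ∑ x, (w x : ℝ) -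
        ∑ x, (w x : ℝ) * Real.log (w x) := by
      rw [Finset.mul_sum, ← Finset.sum_sub_distrib]
      exact Finset.sum_congr rfl fun x _ => by field_simp; ring
    rw [this, coe_sum_eq_one hw]
    ring
  constructor
  · rw [gaussianReal_of_var_ne_zero _ hδ, integrable_withDensity_iff_integrable_smul'
      (measurable_gaussianPDF _ _) (ae_of_all _ fun y => gaussianPDF_lt_top)] at hR
    simp only [toReal_gaussianPDF, smul_eq_mul, Pi.sub_apply, C, hpt] at hR
    have := hR.const_mul (√(2 * Real.pi * δ))
    refine this.congr (ae_of_all _ fun y => ?_)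
    simp only
    field_simp
  · rw [integral_gaussianReal_eq_integral_smul hδ] at hRi
    simp only [smul_eq_mul, hpt] at hRi
    rw [integral_const_mul] at hRi
    linarith

/-- A Gaussian factor is written as a mixture of phases in an auxiliary variable. The exponent
becomes linear in the row, whose average is then explicit. -/
lemma integral_cexp_gaussianReal_inv {δ : ℝ≥0} (hδ : δ ≠ 0) (t : ℝ) :
    ∫ T, Complex.exp (Complex.I * ((T * t : ℝ) : ℂ)) ∂gaussianReal 0 δ⁻¹ =
      ((Real.exp (-t ^ 2 / (2 * δ)) : ℝ) : ℂ) := by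
  have h := charFun_gaussianReal (μ := 0) (v := δ⁻¹) t
  rw [charFun_apply_real] at h
  have hδ' : (δ : ℂ) ≠ 0 := by exact_mod_cast hδ
  convert h using 1
  · refine integral_congr_ae (ae_of_all _ fun T => ?_)
    simp only
    congr 1
    push_cast
    ring
  · push_cast
    congr 1
    field_simp
    ring

lemma integrable_cexp_mul_I {Ω : Type*} [MeasurableSpace Ω] {P : Measure Ω} [IsFiniteMeasure P]
    {θ : Ω → ℝ} (hθ : Measurable θ) :
    Integrable (fun ω => Complex.exp (Complex.I * (θ ω : ℂ))) P := by
  refine Integrable.of_bound (by fun_prop) 1 (ae_of_all _ fun ω => ?_)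
  rw [mul_comm, Complex.norm_exp_ofReal_mul_I]

/-- Averaging a random phase over a Gaussian row. -/
lemma integral_rowLaw_integral_cexp {Ω : Type*} [MeasurableSpace Ω] (P : Measure Ω)
    [IsProbabilityMeasure P] (v : ℝ≥0) {θ : Ω → ℝ} (hθ : Measurable θ) {Z : Ω → κ → ℝ}
    (hZ : Measurable Z) :
    ∫ φ, ∫ ω, Complex.exp (Complex.I * ((θ ω + ∑ i, φ i * Z ω i : ℝ) : ℂ)) ∂P ∂rowLaw κ v =
      ∫ ω, Complex.exp (Complex.I * (θ ω : ℂ)) *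
        ((Real.exp (-(v * ∑ i, Z ω i ^ 2) / 2) : ℝ) : ℂ) ∂P := by
  rw [integral_integral_swap]
  · refine integral_congr_ae (ae_of_all _ fun ω => ?_)
    simp only
    rw [← integral_cexp_rowLaw, ← integral_const_mul]
    refine integral_congr_ae (ae_of_all _ fun φ => ?_)
    simp only
    rw [← Complex.exp_add]
    congr 1
    push_cast
    ring
  · exact integrable_cexp_mul_I (θ := fun p : (κ → ℝ) × Ω => θ p.2 + ∑ i, p.1 i * Z p.2 i)
      (by fun_prop)

lemma abs_exp_neg_sub_exp_neg_le {A B : ℝ} (hA : 0 ≤ A) (hB : 0 ≤ B) :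
    |Real.exp (-A) - Real.exp (-B)| ≤ |A - B| := by
  wlog h : A ≤ B generalizing A B
  · rw [abs_sub_comm, abs_sub_comm A]
    exact this hB hA (le_of_not_ge h)
  rw [abs_of_nonneg (sub_nonneg.mpr (Real.exp_le_exp.mpr (by linarith))), abs_sub_comm,
    abs_of_nonneg (by linarith)]
  have h1 : Real.exp (-B) = Real.exp (-A) * Real.exp (-(B - A)) := by
    rw [← Real.exp_add]; congr 1; ring
  have h2 := Real.one_sub_le_exp_neg (B - A)
  have h3 : Real.exp (-A) ≤ 1 := by rw [Real.exp_le_one_iff]; linarith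
  have h4 := Real.exp_pos (-A)
  rw [h1]
  nlinarith

/-- Comparison of two Gaussian mixtures of phases. -/
lemma norm_integral_cexp_sub_le {Ω : Type*} [MeasurableSpace Ω] (P : Measure Ω)
    [IsProbabilityMeasure P] {θ A B G : Ω → ℝ} (hθ : Measurable θ) (hA : Measurable A)
    (hB : Measurable B) (hA0 : ∀ ω, 0 ≤ A ω) (hB0 : ∀ ω, 0 ≤ B ω) (hG : Integrable G P)
    (hAB : ∀ ω, |A ω - B ω| ≤ G ω) :
    ‖∫ ω, Complex.exp (Complex.I * (θ ω : ℂ)) * ((Real.exp (-A ω) : ℝ) : ℂ) ∂P -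
      ∫ ω, Complex.exp (Complex.I * (θ ω : ℂ)) * ((Real.exp (-B ω) : ℝ) : ℂ) ∂P‖ ≤ ∫ ω, G ω ∂P := by
  have hint : ∀ A : Ω → ℝ, Measurable A → (∀ ω, 0 ≤ A ω) → Integrable (fun ω =>
      Complex.exp (Complex.I * (θ ω : ℂ)) * ((Real.exp (-A ω) : ℝ) : ℂ)) P := by
    intro A hA hA0
    refine Integrable.of_bound (by fun_prop) 1 (ae_of_all _ fun ω => ?_)
    rw [norm_mul, mul_comm Complex.I, Complex.norm_exp_ofReal_mul_I, one_mul, Complex.norm_real,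
      Real.norm_eq_abs, abs_of_pos (Real.exp_pos _), Real.exp_le_one_iff]
    linarith [hA0 ω]
  rw [← integral_sub (hint A hA hA0) (hint B hB hB0)]
  refine norm_integral_le_of_norm_le hG (ae_of_all _ fun ω => ?_)
  rw [← mul_sub, norm_mul, mul_comm Complex.I, Complex.norm_exp_ofReal_mul_I, one_mul,
    ← Complex.ofReal_sub, Complex.norm_real, Real.norm_eq_abs]
  exact (abs_exp_neg_sub_exp_neg_le (hA0 ω) (hB0 ω)).trans (hAB ω)

/-- The normalized density of a centred Gaussian output. -/
def gaussOutput (δ : ℝ≥0) (e : ℝ) (y : ℝ) : ℝ :=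
  (√(1 + δ * e))⁻¹ * Real.exp (-y ^ 2 / (2 * (δ * (1 + δ * e))))

/-- The damping factor tilts the auxiliary Gaussian, replacing its precision `δ` by `δ (1 + δ e)`;
the change of normalisation gives the prefactor of `gaussOutput`. -/
lemma integral_cexp_mul_exp_gaussianReal_inv {δ : ℝ≥0} (hδ : δ ≠ 0) {e : ℝ} (he : 0 ≤ e) (y : ℝ) :
    ∫ T, Complex.exp (Complex.I * ((T * y : ℝ) : ℂ)) *
      ((Real.exp (-(δ ^ 2 * T ^ 2 * e / 2)) : ℝ) : ℂ) ∂gaussianReal 0 δ⁻¹ =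
      (gaussOutput δ e y : ℂ) := by
  have hδ' : (0 : ℝ) < δ := by exact_mod_cast pos_iff_ne_zero.mpr hδ
  have hE' : 0 < 1 + (δ : ℝ) * e := by positivity
  let s : ℝ≥0 := δ * NNReal.mk (1 + δ * e) hE'.le
  have hs : (s : ℝ) = δ * (1 + δ * e) := rfl
  have hs0 : s ≠ 0 := by rw [← NNReal.coe_ne_zero, hs]; positivity
  have hpdf : ∀ T : ℝ, gaussianPDFReal 0 δ⁻¹ T * Real.exp (-(δ ^ 2 * T ^ 2 * e / 2)) =
      (√(1 + δ * e))⁻¹ * gaussianPDFReal 0 s⁻¹ T := by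
    intro T
    simp only [gaussianPDFReal, NNReal.coe_inv, hs]
    rw [mul_assoc, ← Real.exp_add, mul_inv (δ : ℝ), ← mul_assoc (2 * Real.pi),
      Real.sqrt_mul (by positivity) ((1 + δ * e)⁻¹), mul_inv, Real.sqrt_inv (1 + δ * e), inv_inv]
    have hsq : √(1 + (δ : ℝ) * e) ≠ 0 := (Real.sqrt_pos.mpr hE').ne'
    rw [show (√(1 + (δ : ℝ) * e))⁻¹ * ((√(2 * Real.pi * (δ : ℝ)⁻¹))⁻¹ * √(1 + (δ : ℝ) * e) *
        Real.exp (-(T - 0) ^ 2 / (2 * ((δ : ℝ)⁻¹ * (1 + (δ : ℝ) * e)⁻¹)))) =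
        (√(2 * Real.pi * (δ : ℝ)⁻¹))⁻¹ *
        Real.exp (-(T - 0) ^ 2 / (2 * ((δ : ℝ)⁻¹ * (1 + (δ : ℝ) * e)⁻¹))) by field_simp]
    congr 2
    field_simp
    ring
  have h := integral_cexp_gaussianReal_inv hs0 y
  rw [integral_gaussianReal_eq_integral_smul (inv_ne_zero hs0)] at h
  rw [integral_gaussianReal_eq_integral_smul (inv_ne_zero hδ)]
  have h2 : ∀ T : ℝ, gaussianPDFReal 0 δ⁻¹ T • (Complex.exp (Complex.I * ((T * y : ℝ) : ℂ)) *
      ((Real.exp (-(δ ^ 2 * T ^ 2 * e / 2)) : ℝ) : ℂ)) =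
      (((√(1 + δ * e))⁻¹ : ℝ) : ℂ) * (gaussianPDFReal 0 s⁻¹ T •
        Complex.exp (Complex.I * ((T * y : ℝ) : ℂ))) := by
    intro T
    rw [Complex.real_smul, Complex.real_smul, ← mul_assoc (((√(1 + δ * e))⁻¹ : ℝ) : ℂ),
      ← Complex.ofReal_mul, ← hpdf]
    push_cast
    ring
  simp only [h2]
  rw [integral_const_mul, h, gaussOutput, hs]
  push_cast
  rfl

end Blur

/-! ### Moments of the output density over random projections -/

section Moments

variable {κ : Type*} [Fintype κ] {𝒳 : Type*} [Fintype 𝒳]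

lemma integral_sq_gaussianReal_inv (δ : ℝ≥0) :
    ∫ T, T ^ 2 ∂gaussianReal 0 δ⁻¹ = (δ : ℝ)⁻¹ := by
  rw [integral_sq_gaussianReal]; simp

/-- The first moment of the density of a random projection. -/
lemma abs_integral_exp_linear_sub_le {δ : ℝ≥0} (hδ : δ ≠ 0) (v : ℝ≥0) (z : κ → ℝ) {e : ℝ}
    (he : 0 ≤ e) (y : ℝ) :
    |∫ φ, Real.exp (-(y - δ * ∑ i, φ i * z i) ^ 2 / (2 * δ)) ∂rowLaw κ v - gaussOutput δ e y| ≤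
      δ / 2 * |v * ∑ i, z i ^ 2 - e| := by
  have hδ' : (0 : ℝ) < δ := by exact_mod_cast pos_iff_ne_zero.mpr hδ
  have h1 : ((∫ φ, Real.exp (-(y - δ * ∑ i, φ i * z i) ^ 2 / (2 * δ)) ∂rowLaw κ v : ℝ) : ℂ) =
      ∫ T, Complex.exp (Complex.I * ((T * y : ℝ) : ℂ)) *
        ((Real.exp (-(v * ∑ i, (T * (-δ * z i)) ^ 2 / 2)) : ℝ) : ℂ) ∂gaussianReal 0 δ⁻¹ := by
    rw [← integral_complex_ofReal]
    have h := integral_rowLaw_integral_cexp (κ := κ) (gaussianReal 0 δ⁻¹) v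
      (θ := fun T => T * y) (by fun_prop) (Z := fun T i => T * (-δ * z i)) (by fun_prop)
    simp only [neg_div, mul_div_assoc, Finset.sum_div] at h ⊢
    rw [← h]
    refine integral_congr_ae (ae_of_all _ fun φ => ?_)
    simp only
    rw [← neg_div, ← integral_cexp_gaussianReal_inv hδ]
    refine integral_congr_ae (ae_of_all _ fun T => ?_)
    simp only
    congr 3
    rw [mul_sub, sub_eq_add_neg]
    congr 1
    rw [Finset.mul_sum, Finset.mul_sum, ← Finset.sum_neg_distrib]
    exact Finset.sum_congr rfl fun i _ => by ring
  have h2 := integral_cexp_mul_exp_gaussianReal_inv hδ he y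
  rw [← Real.norm_eq_abs, ← Complex.norm_real, Complex.ofReal_sub, h1, ← h2]
  -- Both sides are now mixtures of the same phases. The exponents differ by `T² δ² / 2` times the
  -- error in the squared norm, and `T²` has mean `1 / δ`.
  refine (norm_integral_cexp_sub_le (gaussianReal 0 δ⁻¹) (θ := fun T => T * y)
    (A := fun T => v * ∑ i, (T * (-δ * z i)) ^ 2 / 2) (B := fun T => δ ^ 2 * T ^ 2 * e / 2)
    (G := fun T => T ^ 2 * (δ ^ 2 / 2 * |v * ∑ i, z i ^ 2 - e|)) (by fun_prop)
    (by fun_prop) (by fun_prop) (fun T => by positivity) (fun T => by positivity)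
    ((integrable_sq_gaussianReal _ _).mul_const _) ?_).trans (le_of_eq ?_)
  · intro T
    have : v * ∑ i, (T * (-δ * z i)) ^ 2 / 2 - δ ^ 2 * T ^ 2 * e / 2 =
        (T ^ 2 * (δ ^ 2 / 2)) * (v * ∑ i, z i ^ 2 - e) := by
      simp only [mul_pow, ← Finset.mul_sum, ← Finset.sum_div]
      ring
    rw [this, abs_mul, abs_of_nonneg (by positivity), mul_assoc]
  · rw [integral_mul_const, integral_sq_gaussianReal_inv]
    field_simp

/-- The correlation of the densities of the random projections of two points. -/
lemma abs_integral_exp_linear_mul_sub_le {δ : ℝ≥0} (hδ : δ ≠ 0) (v : ℝ≥0) (z z' : κ → ℝ) {e : ℝ}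
    (he : 0 ≤ e) (y : ℝ) :
    |∫ φ, Real.exp (-(y - δ * ∑ i, φ i * z i) ^ 2 / (2 * δ)) *
        Real.exp (-(y - δ * ∑ i, φ i * z' i) ^ 2 / (2 * δ)) ∂rowLaw κ v - gaussOutput δ e y ^ 2| ≤
      δ / 2 * (|v * ∑ i, z i ^ 2 - e| + |v * ∑ i, z' i ^ 2 - e| + 2 * |v * ∑ i, z i * z' i|) := by
  have hδ' : (0 : ℝ) < δ := by exact_mod_cast pos_iff_ne_zero.mpr hδ
  set g := gaussianReal 0 δ⁻¹
  set a := v * ∑ i, z i ^ 2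
  set a' := v * ∑ i, z' i ^ 2
  set c := v * ∑ i, z i * z' i
  have h1 : ((∫ φ, Real.exp (-(y - δ * ∑ i, φ i * z i) ^ 2 / (2 * δ)) *
      Real.exp (-(y - δ * ∑ i, φ i * z' i) ^ 2 / (2 * δ)) ∂rowLaw κ v : ℝ) : ℂ) =
      ∫ T : ℝ × ℝ, Complex.exp (Complex.I * ((T.1 * y + T.2 * y : ℝ) : ℂ)) *
        ((Real.exp (-(v * ∑ i, (T.1 * (-δ * z i) + T.2 * (-δ * z' i)) ^ 2 / 2)) : ℝ) : ℂ)
        ∂g.prod g := by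
    rw [← integral_complex_ofReal]
    -- One auxiliary Gaussian is used for each point. Averaging over their common row couples the
    -- two only through the overlap of `z` and `z'`.
    have h := integral_rowLaw_integral_cexp (κ := κ) (g.prod g) v
      (θ := fun T => T.1 * y + T.2 * y) (by fun_prop)
      (Z := fun T i => T.1 * (-δ * z i) + T.2 * (-δ * z' i)) (by fun_prop)
    simp only [neg_div, mul_div_assoc, Finset.sum_div] at h ⊢
    rw [← h]
    refine integral_congr_ae (ae_of_all _ fun φ => ?_)
    simp only
    rw [Complex.ofReal_mul, ← neg_div, ← neg_div, ← integral_cexp_gaussianReal_inv hδ,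
      ← integral_cexp_gaussianReal_inv hδ, ← integral_prod_mul]
    refine integral_congr_ae (ae_of_all _ fun T => ?_)
    simp only
    rw [← Complex.exp_add, ← mul_add, ← Complex.ofReal_add]
    congr 3
    simp only [mul_sub, mul_add, Finset.sum_add_distrib, Finset.mul_sum]
    have h3 : ∀ (t : ℝ) (z : κ → ℝ), ∑ i, φ i * (t * (-δ * z i)) = -∑ i, t * (δ * (φ i * z i)) := by
      intro t z
      rw [← Finset.sum_neg_distrib]
      exact Finset.sum_congr rfl fun i _ => by ring
    rw [h3, h3]
    ring
  have h2 : ((gaussOutput δ e y ^ 2 : ℝ) : ℂ) =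
      ∫ T : ℝ × ℝ, Complex.exp (Complex.I * ((T.1 * y + T.2 * y : ℝ) : ℂ)) *
        ((Real.exp (-(δ ^ 2 * (T.1 ^ 2 + T.2 ^ 2) * e / 2)) : ℝ) : ℂ) ∂g.prod g := by
    rw [sq, Complex.ofReal_mul, ← integral_cexp_mul_exp_gaussianReal_inv hδ he y,
      ← integral_prod_mul]
    refine integral_congr_ae (ae_of_all _ fun T => ?_)
    simp only
    rw [mul_mul_mul_comm, ← Complex.exp_add, ← mul_add, ← Complex.ofReal_add,
      ← Complex.ofReal_mul, ← Real.exp_add]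
    congr 4
    ring
  have hi1 : Integrable (fun T : ℝ × ℝ => T.1 ^ 2) (g.prod g) := by
    simpa using (integrable_sq_gaussianReal 0 δ⁻¹).mul_prod (integrable_const (μ := g) (1 : ℝ))
  have hi2 : Integrable (fun T : ℝ × ℝ => T.2 ^ 2) (g.prod g) := by
    simpa using (integrable_const (μ := g) (1 : ℝ)).mul_prod (integrable_sq_gaussianReal 0 δ⁻¹)
  have he1 : ∫ T : ℝ × ℝ, T.1 ^ 2 ∂g.prod g = (δ : ℝ)⁻¹ := by
    have := integral_prod_mul (μ := g) (ν := g) (fun T : ℝ => T ^ 2) (fun _ => (1 : ℝ))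
    simpa [g, integral_sq_gaussianReal_inv] using this
  have he2 : ∫ T : ℝ × ℝ, T.2 ^ 2 ∂g.prod g = (δ : ℝ)⁻¹ := by
    have := integral_prod_mul (μ := g) (ν := g) (fun _ => (1 : ℝ)) (fun T : ℝ => T ^ 2)
    simpa [g, integral_sq_gaussianReal_inv] using this
  rw [← Real.norm_eq_abs, ← Complex.norm_real, Complex.ofReal_sub, h1, h2]
  refine (norm_integral_cexp_sub_le (g.prod g) (θ := fun T => T.1 * y + T.2 * y)
    (A := fun T => v * ∑ i, (T.1 * (-δ * z i) + T.2 * (-δ * z' i)) ^ 2 / 2)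
    (B := fun T => δ ^ 2 * (T.1 ^ 2 + T.2 ^ 2) * e / 2)
    (G := fun T => T.1 ^ 2 * (δ ^ 2 / 2 * (|a - e| + |c|)) + T.2 ^ 2 * (δ ^ 2 / 2 * (|a' - e| + |c|)))
    (by fun_prop) (by fun_prop) (by fun_prop) (fun T => by positivity) (fun T => by positivity)
    ((hi1.mul_const _).add (hi2.mul_const _)) ?_).trans (le_of_eq ?_)
  · intro T
    have h4 : v * ∑ i, (T.1 * (-δ * z i) + T.2 * (-δ * z' i)) ^ 2 / 2 -
        δ ^ 2 * (T.1 ^ 2 + T.2 ^ 2) * e / 2 =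
        δ ^ 2 / 2 * (T.1 ^ 2 * (a - e) + T.2 ^ 2 * (a' - e) + 2 * T.1 * T.2 * c) := by
      have h5 : ∀ i, (T.1 * (-δ * z i) + T.2 * (-δ * z' i)) ^ 2 / 2 = (δ : ℝ) ^ 2 / 2 *
          (T.1 ^ 2 * z i ^ 2 + T.2 ^ 2 * z' i ^ 2 + 2 * T.1 * T.2 * (z i * z' i)) := fun i => by ring
      simp only [h5, ← Finset.mul_sum, Finset.sum_add_distrib]
      simp only [a, a', c]
      ring
    rw [h4, abs_mul, abs_of_nonneg (by positivity : (0 : ℝ) ≤ δ ^ 2 / 2)]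
    have h6 : |2 * T.1 * T.2| ≤ T.1 ^ 2 + T.2 ^ 2 :=
      abs_le.mpr ⟨by nlinarith [sq_nonneg (T.1 + T.2)], by nlinarith [sq_nonneg (T.1 - T.2)]⟩
    have h7 : |T.1 ^ 2 * (a - e) + T.2 ^ 2 * (a' - e) + 2 * T.1 * T.2 * c| ≤
        T.1 ^ 2 * |a - e| + T.2 ^ 2 * |a' - e| + (T.1 ^ 2 + T.2 ^ 2) * |c| := by
      refine (abs_add_three _ _ _).trans ?_
      rw [abs_mul, abs_mul, abs_mul _ c, abs_of_nonneg (sq_nonneg T.1),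
        abs_of_nonneg (sq_nonneg T.2)]
      exact add_le_add_right (mul_le_mul_of_nonneg_right h6 (abs_nonneg c)) _
    refine (mul_le_mul_of_nonneg_left h7 (by positivity)).trans (le_of_eq ?_)
    ring
  · rw [integral_add (hi1.mul_const _) (hi2.mul_const _), integral_mul_const, integral_mul_const,
      he1, he2]
    field_simp
    ring

/-- The fluctuations of the squared norms and of the overlaps of the features `X`, relative to the
variance `e` and the weights `w`. -/
def fluctuation (X : 𝒳 → κ → ℝ) (v : ℝ≥0) (w : 𝒳 → ℝ≥0) (e : ℝ) : ℝ :=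
  ∑ x, w x * |v * ∑ i, X x i ^ 2 - e| + ∑ x, ∑ x', w x * w x' * |v * ∑ i, X x i * X x' i|

lemma integrable_exp_linear (v δ : ℝ≥0) (z : κ → ℝ) (y : ℝ) :
    Integrable (fun φ : κ → ℝ => Real.exp (-(y - δ * ∑ i, φ i * z i) ^ 2 / (2 * δ))) (rowLaw κ v) := by
  have hm : Measurable fun φ : κ → ℝ => Real.exp (-(y - δ * ∑ i, φ i * z i) ^ 2 / (2 * δ)) := by
    fun_prop
  refine Integrable.of_bound hm.aestronglyMeasurable 1 (ae_of_all _ fun φ => ?_)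
  rw [Real.norm_eq_abs, abs_of_pos (Real.exp_pos _), Real.exp_le_one_iff, neg_div]
  exact neg_nonpos.mpr (by positivity)

lemma integrable_exp_linear_mul (v δ : ℝ≥0) (z z' : κ → ℝ) (y : ℝ) :
    Integrable (fun φ : κ → ℝ => Real.exp (-(y - δ * ∑ i, φ i * z i) ^ 2 / (2 * δ)) *
      Real.exp (-(y - δ * ∑ i, φ i * z' i) ^ 2 / (2 * δ))) (rowLaw κ v) := by
  refine Integrable.of_bound (by fun_prop) 1 (ae_of_all _ fun φ => ?_)
  rw [Real.norm_eq_abs, ← Real.exp_add, abs_of_pos (Real.exp_pos _), Real.exp_le_one_iff, neg_div,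
    neg_div, ← neg_add]
  exact neg_nonpos.mpr (by positivity)

variable (X : 𝒳 → κ → ℝ) (v : ℝ≥0) {δ : ℝ≥0} (hδ : δ ≠ 0) {w : 𝒳 → ℝ≥0} (hw : ∑ x, w x = 1)
  {e : ℝ} (he : 0 ≤ e) (y : ℝ)
include hδ hw he

lemma abs_integral_blurred_sub_le :
    Integrable (fun φ : κ → ℝ => blurred (fun x => ∑ i, φ i * X x i) δ w y) (rowLaw κ v) ∧
    |∫ φ, blurred (fun x => ∑ i, φ i * X x i) δ w y ∂rowLaw κ v - gaussOutput δ e y| ≤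
      δ * fluctuation X v w e := by
  have hi := fun x => (integrable_exp_linear v δ (X x) y).const_mul (w x : ℝ)
  refine ⟨integrable_finsetSum _ fun x _ => hi x, ?_⟩
  unfold blurred
  rw [integral_finsetSum _ fun x _ => hi x]
  have h1 : gaussOutput δ e y = ∑ x, w x * gaussOutput δ e y := by
    rw [← Finset.sum_mul, coe_sum_eq_one hw, one_mul]
  rw [h1, ← Finset.sum_sub_distrib]
  refine (Finset.abs_sum_le_sum_abs _ _).trans ?_
  have h2 : ∀ x, |∫ φ, w x * Real.exp (-(y - δ * ∑ i, φ i * X x i) ^ 2 / (2 * δ)) ∂rowLaw κ v -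
      w x * gaussOutput δ e y| ≤ δ * (w x * |v * ∑ i, X x i ^ 2 - e|) := by
    intro x
    rw [integral_const_mul, ← mul_sub, abs_mul, abs_of_nonneg (w x).coe_nonneg, mul_left_comm]
    refine mul_le_mul_of_nonneg_left ((abs_integral_exp_linear_sub_le hδ v (X x) he y).trans ?_)
      (w x).coe_nonneg
    have : 0 ≤ (δ : ℝ) * |v * ∑ i, X x i ^ 2 - e| := by positivity
    linarith
  refine (Finset.sum_le_sum fun x _ => h2 x).trans ?_
  rw [← Finset.mul_sum, fluctuation, mul_add]
  have : 0 ≤ (δ : ℝ) * ∑ x, ∑ x', w x * w x' * |v * ∑ i, X x i * X x' i| := by positivity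
  linarith

/-- Expanding the square gives pairs of inputs, each estimated by the two-point correlation. With
the first moment, this shows that the output density at `y` is close in mean square to the
deterministic Gaussian one. -/
lemma abs_integral_blurred_sq_sub_le :
    Integrable (fun φ : κ → ℝ => blurred (fun x => ∑ i, φ i * X x i) δ w y ^ 2) (rowLaw κ v) ∧
    |∫ φ, blurred (fun x => ∑ i, φ i * X x i) δ w y ^ 2 ∂rowLaw κ v - gaussOutput δ e y ^ 2| ≤
      δ * fluctuation X v w e := by
  have hi := fun x x' => (integrable_exp_linear_mul v δ (X x) (X x') y).const_mul
    ((w x : ℝ) * w x')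
  have hexp : ∀ φ : κ → ℝ, blurred (fun x => ∑ i, φ i * X x i) δ w y ^ 2 =
      ∑ x, ∑ x', (w x * w x' : ℝ) * (Real.exp (-(y - δ * ∑ i, φ i * X x i) ^ 2 / (2 * δ)) *
        Real.exp (-(y - δ * ∑ i, φ i * X x' i) ^ 2 / (2 * δ))) := by
    intro φ
    rw [blurred, sq, Finset.sum_mul_sum]
    exact Finset.sum_congr rfl fun x _ => Finset.sum_congr rfl fun x' _ => by ring
  simp only [hexp]
  refine ⟨integrable_finsetSum _ fun x _ => integrable_finsetSum _ fun x' _ => hi x x', ?_⟩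
  rw [integral_finsetSum _ fun x _ => integrable_finsetSum _ fun x' _ => hi x x']
  have h1 : gaussOutput δ e y ^ 2 = ∑ x, ∑ x', (w x * w x' : ℝ) * gaussOutput δ e y ^ 2 := by
    simp only [← Finset.sum_mul, ← Finset.sum_mul_sum, coe_sum_eq_one hw, one_mul]
  rw [h1, ← Finset.sum_sub_distrib]
  refine (Finset.abs_sum_le_sum_abs _ _).trans ?_
  set A : 𝒳 → ℝ := fun x => |v * ∑ i, X x i ^ 2 - e|
  have h2 : ∀ x, |∫ φ, ∑ x', (w x * w x' : ℝ) *
      (Real.exp (-(y - δ * ∑ i, φ i * X x i) ^ 2 / (2 * δ)) *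
        Real.exp (-(y - δ * ∑ i, φ i * X x' i) ^ 2 / (2 * δ))) ∂rowLaw κ v -
      ∑ x', (w x * w x' : ℝ) * gaussOutput δ e y ^ 2| ≤
      ∑ x', (w x * w x' : ℝ) * (δ / 2 * (A x + A x' + 2 * |v * ∑ i, X x i * X x' i|)) := by
    intro x
    rw [integral_finsetSum _ fun x' _ => hi x x', ← Finset.sum_sub_distrib]
    refine (Finset.abs_sum_le_sum_abs _ _).trans (Finset.sum_le_sum fun x' _ => ?_)
    rw [integral_const_mul, ← mul_sub, abs_mul, abs_of_nonneg (by positivity)]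
    exact mul_le_mul_of_nonneg_left (abs_integral_exp_linear_mul_sub_le hδ v (X x) (X x') he y)
      (by positivity)
  refine (Finset.sum_le_sum fun x _ => h2 x).trans (le_of_eq ?_)
  have h3 : ∀ x x', (w x * w x' : ℝ) * (δ / 2 * (A x + A x' + 2 * |v * ∑ i, X x i * X x' i|)) =
      δ / 2 * ((w x * A x) * w x') + δ / 2 * (w x * (w x' * A x')) +
      δ * (w x * w x' * |v * ∑ i, X x i * X x' i|) := fun x x' => by ring
  simp only [h3, Finset.sum_add_distrib, ← Finset.mul_sum, ← Finset.sum_mul, coe_sum_eq_one hw]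
  rw [fluctuation]
  ring

end Moments

/-! ### A central limit bound for the information of a random projection -/

section CLT

lemma gaussOutput_pos (δ : ℝ≥0) {e : ℝ} (he : 0 ≤ e) (y : ℝ) : 0 < gaussOutput δ e y := by
  unfold gaussOutput
  have : 0 < √(1 + δ * e) := Real.sqrt_pos.mpr (by positivity)
  positivity

lemma one_le_sqrt_one_add (δ : ℝ≥0) {e : ℝ} (he : 0 ≤ e) : 1 ≤ √(1 + δ * e) := by
  rw [Real.one_le_sqrt]
  have : 0 ≤ (δ : ℝ) * e := by positivity
  linarith

lemma gaussOutput_le_exp (δ : ℝ≥0) {e D : ℝ} (he : 0 ≤ e) (heD : e ≤ D) (y : ℝ) :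
    gaussOutput δ e y ≤ Real.exp (-y ^ 2 / (2 * (δ * (1 + δ * D)))) := by
  by_cases hδ : δ = 0
  · simp [gaussOutput, hδ]
  have hδ' : (0 : ℝ) < δ := by exact_mod_cast pos_iff_ne_zero.mpr hδ
  unfold gaussOutput
  refine (mul_le_of_le_one_left (Real.exp_pos _).le
    (inv_le_one_of_one_le₀ (one_le_sqrt_one_add δ he))).trans ?_
  rw [Real.exp_le_exp, neg_div, neg_div, neg_le_neg_iff]
  have : 0 < 1 + (δ : ℝ) * e := by positivity
  gcongr

lemma gaussOutput_le_one (δ : ℝ≥0) {e : ℝ} (he : 0 ≤ e) (y : ℝ) : gaussOutput δ e y ≤ 1 := by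
  refine (gaussOutput_le_exp δ he le_rfl y).trans ?_
  rw [Real.exp_le_one_iff, neg_div]
  exact neg_nonpos.mpr (by positivity)

lemma log_gaussOutput (δ : ℝ≥0) {e : ℝ} (he : 0 ≤ e) (y : ℝ) :
    -Real.log (gaussOutput δ e y) = Real.log (1 + δ * e) / 2 + y ^ 2 / (2 * (δ * (1 + δ * e))) := by
  have h : 0 < √(1 + δ * e) := Real.sqrt_pos.mpr (by positivity)
  rw [gaussOutput, Real.log_mul (inv_ne_zero h.ne') (Real.exp_pos _).ne', Real.log_exp,
    Real.log_inv, Real.log_sqrt (by positivity)]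
  ring

/-- Up to the constant factor, `gaussOutput` is the density of a centred Gaussian of variance `δ (1
+ δ e)` and its logarithm is quadratic, so the entropy is a second moment. -/
lemma integral_negMulLog_gaussOutput {δ : ℝ≥0} (hδ : δ ≠ 0) {e : ℝ} (he : 0 ≤ e) :
    Integrable (fun y => Real.negMulLog (gaussOutput δ e y)) ∧
    (√(2 * Real.pi * δ))⁻¹ * ∫ y, Real.negMulLog (gaussOutput δ e y) =
      Real.log (1 + δ * e) / 2 + 1 / 2 := by
  have hδ' : (0 : ℝ) < δ := by exact_mod_cast pos_iff_ne_zero.mpr hδ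
  have hE' : 0 < 1 + (δ : ℝ) * e := by positivity
  have hc : 0 < √(2 * Real.pi * δ) := Real.sqrt_pos.mpr (by positivity)
  let s : ℝ≥0 := δ * NNReal.mk (1 + δ * e) hE'.le
  have hs : (s : ℝ) = δ * (1 + δ * e) := rfl
  have hs0 : s ≠ 0 := by rw [← NNReal.coe_ne_zero, hs]; positivity
  have hs' : (0 : ℝ) < s := by exact_mod_cast pos_iff_ne_zero.mpr hs0
  have hpt : ∀ y, gaussianPDFReal 0 s y * (Real.log (1 + δ * e) / 2 + 0 * y + 1 / (2 * s) * y ^ 2) =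
      (√(2 * Real.pi * δ))⁻¹ * Real.negMulLog (gaussOutput δ e y) := by
    intro y
    have h1 : gaussianPDFReal 0 s y = (√(2 * Real.pi * δ))⁻¹ * gaussOutput δ e y := by
      rw [gaussianPDFReal, gaussOutput, hs, ← mul_assoc (2 * Real.pi), Real.sqrt_mul (by positivity)
        (1 + δ * e), mul_inv, sub_zero, mul_assoc]
    have h2 : Real.negMulLog (gaussOutput δ e y) =
        gaussOutput δ e y * (Real.log (1 + δ * e) / 2 + y ^ 2 / (2 * s)) := by
      rw [hs, ← log_gaussOutput δ he, Real.negMulLog]; ring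
    rw [h1, h2]; ring
  have hi := integrable_quadratic_gaussianReal 0 s (Real.log (1 + δ * e) / 2) 0 (1 / (2 * s))
  have hI := integral_quadratic_gaussianReal 0 s (Real.log (1 + δ * e) / 2) 0 (1 / (2 * s))
  constructor
  · rw [gaussianReal_of_var_ne_zero _ hs0, integrable_withDensity_iff_integrable_smul'
      (measurable_gaussianPDF _ _) (ae_of_all _ fun y => gaussianPDF_lt_top)] at hi
    simp only [toReal_gaussianPDF, smul_eq_mul, hpt] at hi
    refine (hi.const_mul (√(2 * Real.pi * δ))).congr (ae_of_all _ fun y => ?_)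
    simp only
    field_simp
  · rw [integral_gaussianReal_eq_integral_smul hs0] at hI
    simp only [smul_eq_mul, hpt] at hI
    rw [integral_const_mul] at hI
    rw [hI]
    field_simp
    ring

/-- An integrable bound for the entropy densities of all Gaussian outputs of variance at most `D`. -/
def outputBound (δ : ℝ≥0) (D : ℝ) (y : ℝ) : ℝ :=
  Real.exp (-(1 / (2 * (δ * (1 + δ * D)))) * y ^ 2) *
    (Real.log (1 + δ * D) / 2 + y ^ 2 / (2 * δ))

lemma negMulLog_gaussOutput_le {δ : ℝ≥0} (hδ : δ ≠ 0) {e D : ℝ} (he : 0 ≤ e) (heD : e ≤ D) (y : ℝ) :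
    Real.negMulLog (gaussOutput δ e y) ≤ outputBound δ D y := by
  have hδ' : (0 : ℝ) < δ := by exact_mod_cast pos_iff_ne_zero.mpr hδ
  have h1 : 0 ≤ (δ : ℝ) * e := by positivity
  have h2 := gaussOutput_le_exp δ he heD y
  rw [show -y ^ 2 / (2 * (δ * (1 + δ * D))) = -(1 / (2 * (δ * (1 + δ * D)))) * y ^ 2 by ring] at h2
  rw [show Real.negMulLog (gaussOutput δ e y) =
    gaussOutput δ e y * (Real.log (1 + δ * e) / 2 + y ^ 2 / (2 * (δ * (1 + δ * e)))) by
      rw [← log_gaussOutput δ he, Real.negMulLog]; ring]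
  have hlog : 0 ≤ Real.log (1 + δ * e) := Real.log_nonneg (by linarith)
  refine mul_le_mul h2 (add_le_add ?_ ?_) (by positivity) (Real.exp_pos _).le
  · have := Real.log_le_log (by positivity) (show 1 + (δ : ℝ) * e ≤ 1 + δ * D by gcongr)
    linarith
  · refine div_le_div_of_nonneg_left (sq_nonneg _) (by positivity) ?_
    have := mul_le_mul_of_nonneg_left (show (1 : ℝ) ≤ 1 + δ * e by linarith) hδ'.le
    linarith

lemma integrable_outputBound {δ : ℝ≥0} (hδ : δ ≠ 0) {D : ℝ} (hD : 0 ≤ D) :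
    Integrable (outputBound δ D) := by
  have hδ' : (0 : ℝ) < δ := by exact_mod_cast pos_iff_ne_zero.mpr hδ
  set b : ℝ := 1 / (2 * (δ * (1 + δ * D))) with hb
  have hb0 : 0 < b := by positivity
  have h1 := (integrable_exp_neg_mul_sq hb0).const_mul (Real.log (1 + δ * D) / 2)
  have h2 := (integrable_rpow_mul_exp_neg_mul_sq hb0 (s := 2) (by norm_num)).const_mul (1 / (2 * δ))
  refine (h1.add h2).congr (ae_of_all _ fun y => ?_)
  simp only [outputBound, Pi.add_apply, ← hb, Real.rpow_two]
  ring

/-- The common dominating function `outputBound` makes the tails uniformly small for all variances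
up to `D`, so one interval serves all of them. -/
lemma exists_setIntegral_negMulLog_ge {δ : ℝ≥0} (hδ : δ ≠ 0) {D r : ℝ} (hD : 0 ≤ D) (hr : 0 < r) :
    ∃ R : ℝ, 0 ≤ R ∧ ∀ e, 0 ≤ e → e ≤ D →
      (∫ y, Real.negMulLog (gaussOutput δ e y)) - r ≤
        ∫ y in Set.Icc (-R) R, Real.negMulLog (gaussOutput δ e y) := by
  have hi := integrable_outputBound hδ hD
  have hlim := intervalIntegral_tendsto_integral hi
    (tendsto_neg_atBot_iff.mpr tendsto_id) (tendsto_id (α := ℝ) (x := atTop))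
  obtain ⟨R, hR, hR0⟩ := ((hlim.eventually (lt_mem_nhds (sub_lt_self _ hr))).and
    (eventually_ge_atTop (0 : ℝ))).exists
  refine ⟨R, hR0, fun e he heD => ?_⟩
  simp only [id] at hR
  rw [intervalIntegral.integral_of_le (by linarith), ← integral_Icc_eq_integral_Ioc] at hR
  have hi2 := (integral_negMulLog_gaussOutput hδ he).1
  have h1 := integral_add_compl (μ := volume) (measurableSet_Icc (a := -R) (b := R)) hi
  have h2 := integral_add_compl (μ := volume) (measurableSet_Icc (a := -R) (b := R)) hi2
  have h3 : ∫ y in (Set.Icc (-R) R)ᶜ, Real.negMulLog (gaussOutput δ e y) ≤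
      ∫ y in (Set.Icc (-R) R)ᶜ, outputBound δ D y :=
    integral_mono hi2.integrableOn hi.integrableOn fun y => negMulLog_gaussOutput_le hδ he heD y
  linarith

/-! ### Entropy densities of projected mixtures -/

section Pointwise

variable {κ : Type*} [Fintype κ] {𝒳 : Type*} [Fintype 𝒳]

lemma measurable_negMulLog_blurred (X : 𝒳 → κ → ℝ) (δ : ℝ≥0) (w : 𝒳 → ℝ≥0) :
    Measurable fun p : (κ → ℝ) × ℝ =>
      Real.negMulLog (blurred (fun x => ∑ i, p.1 i * X x i) δ w p.2) := by
  refine Real.continuous_negMulLog.measurable.comp ?_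
  simp only [blurred]
  fun_prop

lemma measurable_negMulLog_blurred_right (X : 𝒳 → κ → ℝ) (δ : ℝ≥0) (w : 𝒳 → ℝ≥0) (y : ℝ) :
    Measurable fun φ : κ → ℝ => Real.negMulLog (blurred (fun x => ∑ i, φ i * X x i) δ w y) := by
  refine Real.continuous_negMulLog.measurable.comp ?_
  simp only [blurred]
  fun_prop

lemma negMulLog_blurred_nonneg (u : 𝒳 → ℝ) (δ : ℝ≥0) {w : 𝒳 → ℝ≥0} (hw : ∑ x, w x = 1) (y : ℝ) :
    0 ≤ Real.negMulLog (blurred u δ w y) :=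
  Real.negMulLog_nonneg (blurred_nonneg _ _ _ _) (blurred_le_one _ _ hw _)

lemma norm_negMulLog_blurred_le (u : 𝒳 → ℝ) (δ : ℝ≥0) {w : 𝒳 → ℝ≥0} (hw : ∑ x, w x = 1) (y : ℝ) :
    ‖Real.negMulLog (blurred u δ w y)‖ ≤ 1 := by
  rw [Real.norm_eq_abs, abs_of_nonneg (negMulLog_blurred_nonneg u δ hw y)]
  have h0 := blurred_nonneg u δ w y
  have := Real.mul_log_ge h0 one_pos
  rw [Real.log_one] at this
  rw [Real.negMulLog]
  linarith

lemma inv_gaussOutput_le {δ : ℝ≥0} (hδ : δ ≠ 0) {D e R y : ℝ} (he : 0 ≤ e) (heD : e ≤ D)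
    (hy : y ∈ Set.Icc (-R) R) :
    (gaussOutput δ e y)⁻¹ ≤ √(1 + δ * D) * Real.exp (R ^ 2 / (2 * δ)) := by
  have hδ' : (0 : ℝ) < δ := by exact_mod_cast pos_iff_ne_zero.mpr hδ
  rw [gaussOutput, mul_inv, inv_inv, ← Real.exp_neg]
  have : 0 ≤ (δ : ℝ) * e := by positivity
  refine mul_le_mul (Real.sqrt_le_sqrt (by gcongr)) (Real.exp_le_exp.mpr ?_)
    (Real.exp_pos _).le (Real.sqrt_nonneg _)
  rw [neg_div, neg_neg]
  have hy2 : y ^ 2 ≤ R ^ 2 := sq_le_sq' hy.1 hy.2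
  refine div_le_div₀ (sq_nonneg _) hy2 (by positivity) ?_
  have := mul_le_mul_of_nonneg_left (show (1 : ℝ) ≤ 1 + δ * e by linarith) hδ'.le
  linarith

/-- Bound `-Q log Q` below by `(1 - log q) Q - Q² / q`, with equality at `Q = q`. Its average uses
only the first two moments of `Q`, each within `δ` times the fluctuation of those of `q`, and both
coefficients are at most `K`. -/
lemma negMulLog_gaussOutput_sub_le (X : 𝒳 → κ → ℝ) (v : ℝ≥0) {δ : ℝ≥0} (hδ : δ ≠ 0)
    {w : 𝒳 → ℝ≥0} (hw : ∑ x, w x = 1) {e K : ℝ} (he : 0 ≤ e) (y : ℝ)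
    (hinv : (gaussOutput δ e y)⁻¹ ≤ K) :
    Real.negMulLog (gaussOutput δ e y) - 2 * K * δ * fluctuation X v w e ≤
      ∫ φ, Real.negMulLog (blurred (fun x => ∑ i, φ i * X x i) δ w y) ∂rowLaw κ v := by
  have hqpos : 0 < gaussOutput δ e y := gaussOutput_pos δ he y
  have hq1 := gaussOutput_le_one δ he y
  obtain ⟨hi1, h1⟩ := abs_integral_blurred_sub_le X v hδ hw he y
  obtain ⟨hi2, h2⟩ := abs_integral_blurred_sq_sub_le X v hδ hw he y
  generalize fluctuation X v w e = fl at *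
  generalize gaussOutput δ e y = q at *
  have hm : Measurable fun φ : κ → ℝ =>
      Real.negMulLog (blurred (fun x => ∑ i, φ i * X x i) δ w y) := measurable_negMulLog_blurred_right X δ w y
  have hiη : Integrable (fun φ : κ → ℝ =>
      Real.negMulLog (blurred (fun x => ∑ i, φ i * X x i) δ w y)) (rowLaw κ v) :=
    Integrable.of_bound hm.aestronglyMeasurable 1
      (ae_of_all _ fun φ => norm_negMulLog_blurred_le _ _ hw _)
  have hlow : ∀ φ : κ → ℝ, (1 - Real.log q) * blurred (fun x => ∑ i, φ i * X x i) δ w y -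
      q⁻¹ * blurred (fun x => ∑ i, φ i * X x i) δ w y ^ 2 ≤
      Real.negMulLog (blurred (fun x => ∑ i, φ i * X x i) δ w y) := by
    intro φ
    have h0 := blurred_nonneg (fun x => ∑ i, φ i * X x i) δ w y
    generalize blurred (fun x => ∑ i, φ i * X x i) δ w y = Q at *
    have := Real.mul_log_le h0 hqpos
    rw [Real.negMulLog]
    have h3 : Q * (Q / q - 1) = q⁻¹ * Q ^ 2 - Q := by field_simp
    rw [h3] at this
    linarith
  have h4 := integral_mono ((hi1.const_mul (1 - Real.log q)).sub (hi2.const_mul q⁻¹)) hiη hlow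
  simp only [Pi.sub_apply] at h4
  rw [integral_sub (hi1.const_mul _) (hi2.const_mul _), integral_const_mul, integral_const_mul]
    at h4
  refine le_trans ?_ h4
  generalize (∫ φ, blurred (fun x => ∑ i, φ i * X x i) δ w y ∂rowLaw κ v) = A at *
  generalize (∫ φ, blurred (fun x => ∑ i, φ i * X x i) δ w y ^ 2 ∂rowLaw κ v) = B at *
  have hK0 : 0 ≤ K := (inv_nonneg.mpr hqpos.le).trans hinv
  have hlog : 1 - Real.log q ≤ q⁻¹ := by
    have := Real.log_le_sub_one_of_pos (inv_pos.mpr hqpos)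
    rw [Real.log_inv] at this
    linarith
  have hlog0 : 0 ≤ 1 - Real.log q := by
    have := Real.log_nonpos hqpos.le hq1
    linarith
  have h5 : -(K * (δ * fl)) ≤ (1 - Real.log q) * (A - q) := by
    have h6 : |(1 - Real.log q) * (A - q)| ≤ K * (δ * fl) := by
      rw [abs_mul, abs_of_nonneg hlog0]
      exact mul_le_mul (hlog.trans hinv) h1 (abs_nonneg _) hK0
    exact (abs_le.mp h6).1
  have h7 : q⁻¹ * (B - q ^ 2) ≤ K * (δ * fl) := by
    have h8 : |q⁻¹ * (B - q ^ 2)| ≤ K * (δ * fl) := by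
      rw [abs_mul, abs_of_nonneg (inv_nonneg.mpr hqpos.le)]
      exact mul_le_mul hinv h2 (abs_nonneg _) hK0
    exact (abs_le.mp h8).2
  have h9 : q⁻¹ * q ^ 2 = q := by field_simp
  rw [mul_sub, h9] at h7
  rw [Real.negMulLog]
  linarith

/-- The information of a random projection is controlled by the entropy density on an interval. -/
lemma setIntegral_le_entropy_sub_rowChannel (X : 𝒳 → κ → ℝ) (v : ℝ≥0) {δ : ℝ≥0} (hδ : δ ≠ 0)
    {w : 𝒳 → ℝ≥0} (hw : ∑ x, w x = 1) (R : ℝ) :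
    IntegrableOn (fun y => ∫ φ, Real.negMulLog (blurred (fun x => ∑ i, φ i * X x i) δ w y)
      ∂rowLaw κ v) (Set.Icc (-R) R) ∧
    (√(2 * Real.pi * δ))⁻¹ * (∫ y in Set.Icc (-R) R, ∫ φ,
      Real.negMulLog (blurred (fun x => ∑ i, φ i * X x i) δ w y) ∂rowLaw κ v) - 1 / 2 ≤
      Functional.entropyFun w - (rowChannel X v δ).op (Functional.entropy 𝒳) w := by
  have hD := fun φ : κ → ℝ => entropy_sub_gaussChannel_eq (fun x => ∑ i, φ i * X x i) hδ hw
  obtain ⟨hiop, hop⟩ := rowChannel_op_apply X v δ (Functional.entropy 𝒳) w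
  have hc0 : 0 ≤ (√(2 * Real.pi * δ))⁻¹ := by positivity
  generalize (√(2 * Real.pi * δ))⁻¹ = c at *
  have hmono : ∀ φ : κ → ℝ, c * (∫ y in Set.Icc (-R) R,
      Real.negMulLog (blurred (fun x => ∑ i, φ i * X x i) δ w y)) - 1 / 2 ≤
      Functional.entropyFun w -
        (gaussChannel (fun x => ∑ i, φ i * X x i) δ).op (Functional.entropy 𝒳) w := by
    intro φ
    rw [(hD φ).2]
    refine sub_le_sub_right (mul_le_mul_of_nonneg_left ?_ hc0) _
    -- The nonnegativity of the entropy density is what permits the truncation.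
    exact setIntegral_le_integral (hD φ).1 (ae_of_all _ fun y => negMulLog_blurred_nonneg _ _ hw y)
  have hprod : Integrable (fun p : (κ → ℝ) × ℝ =>
      Real.negMulLog (blurred (fun x => ∑ i, p.1 i * X x i) δ w p.2))
      ((rowLaw κ v).prod (volume.restrict (Set.Icc (-R) R))) :=
    Integrable.of_bound (measurable_negMulLog_blurred X δ w).aestronglyMeasurable 1
      (ae_of_all _ fun p => norm_negMulLog_blurred_le _ _ hw _)
  have hswap := integral_integral_swap
    (f := fun (φ : κ → ℝ) y => Real.negMulLog (blurred (fun x => ∑ i, φ i * X x i) δ w y)) hprod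
  have hiL := hprod.integral_prod_left
  refine ⟨hprod.integral_prod_right, ?_⟩
  have h10 := integral_mono ((hiL.const_mul c).sub (integrable_const (1 / 2 : ℝ)))
    ((integrable_const (Functional.entropyFun w)).sub hiop) hmono
  simp only [Pi.sub_apply] at h10
  rw [integral_sub (hiL.const_mul c) (integrable_const _), integral_sub (integrable_const _) hiop,
    integral_const_mul, hswap, ← hop] at h10
  simpa only [integral_const, probReal_univ, one_smul] using h10

end Pointwise

/-- A lower bound for the information of a random Gaussian projection, when the squared norms and
the overlaps concentrate. -/
theorem exists_le_entropy_sub_rowChannel {δ : ℝ≥0} (hδ : δ ≠ 0) {D r : ℝ} (hD : 0 ≤ D) (hr : 0 < r) :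
    ∃ C : ℝ, 0 ≤ C ∧ ∀ {𝒳 κ : Type} [Fintype 𝒳] [Fintype κ] (X : 𝒳 → κ → ℝ) (v : ℝ≥0)
      (w : 𝒳 → ℝ≥0), ∑ x, w x = 1 → ∀ e, 0 ≤ e → e ≤ D →
      Real.log (1 + δ * e) / 2 - r - C * fluctuation X v w e ≤
        Functional.entropyFun w - (rowChannel X v δ).op (Functional.entropy 𝒳) w := by
  have hδ' : (0 : ℝ) < δ := by exact_mod_cast pos_iff_ne_zero.mpr hδ
  have hc0 : 0 < (√(2 * Real.pi * δ))⁻¹ := by positivity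
  obtain ⟨R, hR0, hR⟩ := exists_setIntegral_negMulLog_ge hδ hD (div_pos hr hc0)
  -- Prefactor, length of the interval, and the pointwise error coefficient with `1 / gaussOutput`
  -- bounded on that interval. The tail was chosen as `r` divided by the prefactor.
  refine ⟨(√(2 * Real.pi * δ))⁻¹ * (2 * R) *
    (2 * (√(1 + δ * D) * Real.exp (R ^ 2 / (2 * δ))) * δ), by positivity, ?_⟩
  intro 𝒳 κ _ _ X v w hw e he heD
  obtain ⟨hi, h1⟩ := setIntegral_le_entropy_sub_rowChannel X v hδ hw R
  refine le_trans ?_ h1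
  obtain ⟨hiq, h13⟩ := integral_negMulLog_gaussOutput hδ he
  have hpoint := fun y (hy : y ∈ Set.Icc (-R) R) =>
    negMulLog_gaussOutput_sub_le X v hδ hw he y (inv_gaussOutput_le hδ he heD hy)
  generalize √(1 + δ * D) * Real.exp (R ^ 2 / (2 * δ)) = K at *
  generalize fluctuation X v w e = fl at *
  generalize (√(2 * Real.pi * δ))⁻¹ = c at *
  have h11 := setIntegral_mono_on (hiq.integrableOn.sub (integrable_const (2 * K * δ * fl)))
    hi measurableSet_Icc hpoint
  simp only [Pi.sub_apply] at h11
  rw [integral_sub hiq.integrableOn (integrable_const _)] at h11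
  simp only [integral_const, smul_eq_mul] at h11
  have hvol : (volume.restrict (Set.Icc (-R) R)).real Set.univ = 2 * R := by
    rw [measureReal_restrict_apply_univ, Real.volume_real_Icc_of_le (by linarith)]
    ring
  rw [hvol] at h11
  have h14 := mul_le_mul_of_nonneg_left (hR e he heD) hc0.le
  have h15 := mul_le_mul_of_nonneg_left h11 hc0.le
  rw [mul_sub, h13, mul_div_cancel₀ _ hc0.ne'] at h14
  rw [mul_sub] at h15
  linarith

end CLT

/-! ### Revealing single labels -/

section Pinning

variable {𝒳 A ι : Type*} [Fintype 𝒳] [Fintype A] [DecidableEq A] [MeasurableSpace A]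
  [MeasurableSingletonClass A] [Fintype ι]

/-- The noiseless observation of a label. -/
def labelChannel (t : 𝒳 → A) : Channel A 𝒳 where
  ref := Measure.count
  sfinite := inferInstance
  dens k x := if t x = k then 1 else 0
  measurable_dens := measurable_of_finite _
  lintegral_dens x := by
    rw [lintegral_fintype, Finset.sum_eq_single (t x)]
    · simp
    · intro k _ hk
      simp [Ne.symm hk]
    · simp

lemma labelChannel_op_apply (t : 𝒳 → A) (F : Functional 𝒳) (w : 𝒳 → ℝ≥0) :
    (labelChannel t).op F w = ∑ k, F ((labelChannel t).update w k) := by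
  rw [Channel.op_apply]
  show ∫ k, _ ∂Measure.count = _
  rw [integral_fintype]
  · simp
  · exact Integrable.of_finite

lemma coe_labelChannel_update (t : 𝒳 → A) (w : 𝒳 → ℝ≥0) (k : A) (x : 𝒳) :
    ((labelChannel t).update w k x : ℝ) = if t x = k then (w x : ℝ) else 0 := by
  simp only [Channel.update, labelChannel]
  split_ifs <;> simp

lemma sum_sum_labelChannel_update (t : 𝒳 → A) (w : 𝒳 → ℝ≥0) (g : A → ℝ) (f : 𝒳 → ℝ) :
    ∑ k, g k * ∑ x, ((labelChannel t).update w k x : ℝ) * f x = ∑ x, w x * (g (t x) * f x) := by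
  simp only [coe_labelChannel_update, Finset.mul_sum]
  rw [Finset.sum_comm]
  refine Finset.sum_congr rfl fun x _ => ?_
  rw [Finset.sum_eq_single (t x)]
  · simp; ring
  · intro k _ hk; simp [Ne.symm hk]
  · simp

/-- Revealing a label decreases the entropy by a bounded amount. -/
lemma entropy_sub_labelChannel_le (t : 𝒳 → A) :
    Functional.entropy 𝒳 - (labelChannel t).op (Functional.entropy 𝒳) ≤
      (Fintype.card A : ℝ) • Functional.mass 𝒳 := by
  intro w
  -- The entropy lost is exactly the entropy of the label, so the crude cardinality bound applies to
  -- its marginal.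
  have h := Functional.entropyFun_le_card fun k => ∑ x, (labelChannel t).update w k x
  have h1 := sum_sum_labelChannel_update t w (fun _ => 1) (fun _ => 1)
  have h2 := sum_sum_labelChannel_update t w (fun _ => 1) (fun x => Real.log (w x))
  simp only [one_mul, mul_one] at h1 h2
  rw [Functional.entropyFun_eq] at h
  simp only [NNReal.coe_sum, h1] at h
  show Functional.entropyFun w - (labelChannel t).op (Functional.entropy 𝒳) w ≤
    Fintype.card A * Functional.mass 𝒳 w
  rw [labelChannel_op_apply, Functional.mass_apply, Functional.entropyFun_eq]
  simp only [Functional.entropy_apply, Functional.entropyFun_eq, Finset.sum_sub_distrib]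
  have h3 : ∀ k x, ((labelChannel t).update w k x : ℝ) *
      Real.log ((labelChannel t).update w k x) =
      ((labelChannel t).update w k x : ℝ) * Real.log (w x) := by
    intro k x
    rw [coe_labelChannel_update]
    split_ifs <;> simp
  simp only [h3, h2]
  linarith

/-- The weightedCovariance under a weight vector. -/
def weightedCovariance (f h : 𝒳 → ℝ) (w : 𝒳 → ℝ≥0) : ℝ :=
  ∑ x, w x * (f x * h x) - (∑ x, w x * f x) * ∑ x, w x * h x

/-- A function of a label has small weightedCovariance with `f` if revealing the label does not decrease
the variance of `f` much. -/
lemma weightedCovariance_sq_le (t : 𝒳 → A) (f : 𝒳 → ℝ) {g : A → ℝ} {G : ℝ} (hg : ∀ k, |g k| ≤ G)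
    {w : 𝒳 → ℝ≥0} (hw : ∑ x, w x = 1) :
    weightedCovariance f (fun x => g (t x)) w ^ 2 ≤
      G ^ 2 * (Functional.variance f - (labelChannel t).op (Functional.variance f)) w := by
  set W : A → ℝ := fun k => ∑ x, ((labelChannel t).update w k x : ℝ) with hW
  set m : A → ℝ := fun k => ∑ x, ((labelChannel t).update w k x : ℝ) * f x with hm
  set μ := ∑ x, w x * f x with hμ
  have hW0 : ∀ k, 0 ≤ W k := fun k => Finset.sum_nonneg fun x _ => NNReal.coe_nonneg _
  have hmW : ∀ k, W k = 0 → m k = 0 := by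
    intro k hk
    exact Finset.sum_eq_zero fun x _ => by rw [Functional.eq_zero_of_sum_coe hk x]; simp
  have hsumW : ∑ k, W k = 1 := by
    have := sum_sum_labelChannel_update t w (fun _ => 1) (fun _ => 1)
    simp only [one_mul, mul_one, coe_sum_eq_one hw] at this
    exact this
  have hsumm : ∑ k, m k = μ := by
    have := sum_sum_labelChannel_update t w (fun _ => 1) f
    simpa only [one_mul] using this
  have hgm : ∑ k, g k * m k = ∑ x, w x * (f x * g (t x)) := by
    rw [hm, sum_sum_labelChannel_update]
    exact Finset.sum_congr rfl fun x _ => by ring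
  have hgW : ∑ k, g k * W k = ∑ x, w x * g (t x) := by
    have := sum_sum_labelChannel_update t w g (fun _ => 1)
    simpa only [mul_one] using this
  -- Law of total variance: what the label removes is the variance between the classes it defines.
  have hgap : (Functional.variance f - (labelChannel t).op (Functional.variance f)) w =
      ∑ k, (m k - W k * μ) ^ 2 / W k := by
    rw [Functional.sub_apply, labelChannel_op_apply]
    simp only [Functional.variance_apply, Functional.varianceFun, Finset.sum_sub_distrib]
    have h1 := sum_sum_labelChannel_update t w (fun _ => 1) (fun x => f x ^ 2)
    simp only [one_mul] at h1
    rw [h1, coe_sum_eq_one hw, div_one]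
    have h2 : ∀ k, (m k - W k * μ) ^ 2 / W k = m k ^ 2 / W k - 2 * μ * m k + μ ^ 2 * W k := by
      intro k
      by_cases hk : W k = 0
      · simp [hk, hmW k hk]
      · field_simp; ring
    simp only [h2, Finset.sum_add_distrib, Finset.sum_sub_distrib, ← Finset.mul_sum, hsumm, hsumW]
    ring
  have hcov : weightedCovariance f (fun x => g (t x)) w = ∑ k, g k * (m k - W k * μ) := by
    rw [weightedCovariance, ← hgm, ← hgW, ← hμ, Finset.mul_sum, ← Finset.sum_sub_distrib]
    exact Finset.sum_congr rfl fun k _ => by ring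
  rw [hcov, hgap]
  -- Cauchy-Schwarz over the classes separates the size of `g` from the variance between classes.
  have hCS := Finset.sum_sq_le_sum_mul_sum_of_sq_le_mul Finset.univ
    (r := fun k => g k * (m k - W k * μ)) (f := fun k => g k ^ 2 * W k)
    (g := fun k => (m k - W k * μ) ^ 2 / W k) (fun k _ => mul_nonneg (sq_nonneg _) (hW0 k))
    (fun k _ => div_nonneg (sq_nonneg _) (hW0 k)) (fun k _ => by
      by_cases hk : W k = 0
      · simp [hk, hmW k hk]
      · exact (by field_simp : _ = _).le)
  refine hCS.trans (mul_le_mul_of_nonneg_right ?_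
    (Finset.sum_nonneg fun k _ => div_nonneg (sq_nonneg _) (hW0 k)))
  rw [← mul_one (G ^ 2), ← hsumW, Finset.mul_sum]
  refine Finset.sum_le_sum fun k _ => mul_le_mul_of_nonneg_right ?_ (hW0 k)
  rw [← sq_abs]
  exact pow_le_pow_left₀ (abs_nonneg _) (hg k) 2

/-- Revealing the label of a uniformly random section. -/
def pinOp (s : 𝒳 → ι → A) : Module.End ℝ (Functional 𝒳) :=
  ∑ l, ((Fintype.card ι : ℝ)⁻¹) • (labelChannel fun x => s x l).op

/-- The average variance of the label indicators. -/
def labelVariance (s : 𝒳 → ι → A) : Functional 𝒳 :=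
  ((Fintype.card ι : ℝ)⁻¹) • ∑ l, ∑ k, Functional.variance fun x => if s x l = k then 1 else 0

variable [Nonempty ι] (s : 𝒳 → ι → A)

lemma sum_inv_card : ∑ _l : ι, ((Fintype.card ι : ℝ)⁻¹) = 1 := by
  have : (Fintype.card ι : ℝ) ≠ 0 := by exact_mod_cast Fintype.card_ne_zero
  simp [this]

lemma isAveraging_pinOp : IsAveraging (pinOp s) :=
  IsAveraging.convex (fun _ => by positivity) sum_inv_card fun _ => Channel.isAveraging_op _

lemma pinOp_entropy_le : pinOp s (Functional.entropy 𝒳) ≤ Functional.entropy 𝒳 := by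
  have h : Functional.entropy 𝒳 = ∑ _l : ι, ((Fintype.card ι : ℝ)⁻¹) • Functional.entropy 𝒳 := by
    rw [← Finset.sum_smul, sum_inv_card, one_smul]
  conv_rhs => rw [h]
  rw [pinOp, LinearMap.sum_apply]
  refine Finset.sum_le_sum fun l _ w => ?_
  exact mul_le_mul_of_nonneg_left (Channel.op_entropy_le _ w) (by positivity)

lemma entropy_sub_pinOp_le : Functional.entropy 𝒳 - pinOp s (Functional.entropy 𝒳) ≤
    (Fintype.card A : ℝ) • Functional.mass 𝒳 := by
  intro w
  have h : ∀ c : ℝ, c = ∑ _l : ι, ((Fintype.card ι : ℝ)⁻¹) * c := fun c => by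
    rw [← Finset.sum_mul, sum_inv_card, one_mul]
  have h1 : (Functional.entropy 𝒳 - pinOp s (Functional.entropy 𝒳)) w =
      ∑ l, ((Fintype.card ι : ℝ)⁻¹) * (Functional.entropy 𝒳 -
        (labelChannel fun x => s x l).op (Functional.entropy 𝒳)) w := by
    simp only [Functional.sub_apply, pinOp, LinearMap.sum_apply, Functional.sum_apply,
      LinearMap.smul_apply, Functional.smul_apply, mul_sub, Finset.sum_sub_distrib]
    rw [← h]
  show (Functional.entropy 𝒳 - pinOp s (Functional.entropy 𝒳)) w ≤ _
  rw [h1, h (((Fintype.card A : ℝ) • Functional.mass 𝒳 : Functional 𝒳) w)]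
  exact Finset.sum_le_sum fun l _ =>
    mul_le_mul_of_nonneg_left (entropy_sub_labelChannel_le (fun x => s x l) w) (by positivity)

lemma labelVariance_nonneg : 0 ≤ labelVariance s := by
  have h : (0 : Functional 𝒳) ≤ ∑ l, ∑ k, Functional.variance fun x => if s x l = k then 1 else 0 :=
    Finset.sum_nonneg fun l _ => Finset.sum_nonneg fun k _ => Functional.variance_nonneg _
  intro w
  exact mul_nonneg (by positivity) (h w)

lemma labelVariance_le : labelVariance s ≤ (Fintype.card A : ℝ) • Functional.mass 𝒳 := by
  have h : ∑ l, ∑ k, Functional.variance (fun x => if s x l = k then 1 else 0) ≤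
      ∑ _l : ι, (Fintype.card A : ℝ) • Functional.mass 𝒳 := by
    refine Finset.sum_le_sum fun l _ => ?_
    rw [Nat.cast_smul_eq_nsmul, ← Finset.card_univ, ← Finset.sum_const]
    refine Finset.sum_le_sum fun k _ => ?_
    have := Functional.variance_le_mass (f := fun x => if s x l = k then (1 : ℝ) else 0) (c := 1)
      fun x => by split_ifs <;> simp
    rwa [one_smul] at this
  intro w
  have h1 := mul_le_mul_of_nonneg_left (h w) (show (0 : ℝ) ≤ (Fintype.card ι : ℝ)⁻¹ by positivity)
  refine h1.trans (le_of_eq ?_)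
  rw [Functional.sum_apply]
  have : (Fintype.card ι : ℝ) ≠ 0 := by exact_mod_cast Fintype.card_ne_zero
  simp [this]

/-- The total decrease of the label variances under pinning. -/
lemma labelVariance_sub_pinOp_apply (w : 𝒳 → ℝ≥0) :
    (labelVariance s - pinOp s (labelVariance s)) w =
      ((Fintype.card ι : ℝ)⁻¹) ^ 2 * ∑ l, ∑ l', ∑ k,
        (Functional.variance (fun x => if s x l = k then 1 else 0) -
          (labelChannel fun x => s x l').op
            (Functional.variance fun x => if s x l = k then 1 else 0)) w := by
  have : (Fintype.card ι : ℝ) ≠ 0 := by exact_mod_cast Fintype.card_ne_zero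
  rw [Functional.sub_apply, labelVariance, pinOp, LinearMap.sum_apply]
  simp only [LinearMap.smul_apply, map_smul, map_sum, Functional.smul_apply, Functional.sum_apply,
    Functional.sub_apply, Finset.sum_sub_distrib, Finset.sum_const, Finset.card_univ,
    nsmul_eq_mul, ← Finset.mul_sum]
  field_simp
  congr 1
  exact Finset.sum_comm

end Pinning

/-! ### Fluctuations of labelled features -/

section LabelFluctuation

variable {𝒳 A ι κ : Type*} [Fintype 𝒳] [Fintype A] [DecidableEq A] [MeasurableSpace A]
  [MeasurableSingletonClass A] [Fintype ι] [Fintype κ]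

/-- The decrease of the variance of a label indicator when another label is revealed. -/
def labelGap (s : 𝒳 → ι → A) (w : 𝒳 → ℝ≥0) (l l' : ι) (k : A) : ℝ :=
  (Functional.variance (fun x => if s x l = k then 1 else 0) -
    (labelChannel fun x => s x l').op
      (Functional.variance fun x => if s x l = k then 1 else 0)) w

/-- Expand `g` in indicators of the label at `l`. Cauchy-Schwarz over the alphabet costs its
cardinality, and each covariance with an indicator is bounded by the variance lost on revealing the
label at `l'`. -/
lemma weightedCovariance_label_sq_le (s : 𝒳 → ι → A) {w : 𝒳 → ℝ≥0} (hw : ∑ x, w x = 1)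
    {D D' : ℝ} (g h : A → ℝ) (hg : ∀ k, |g k| ≤ D) (hh : ∀ k, |h k| ≤ D') (l l' : ι) :
    weightedCovariance (fun x => g (s x l)) (fun x => h (s x l')) w ^ 2 ≤
      Fintype.card A * D ^ 2 * D' ^ 2 * ∑ k, labelGap s w l l' k := by
  have h1 : weightedCovariance (fun x => g (s x l)) (fun x => h (s x l')) w =
      ∑ k, g k * weightedCovariance (fun x => if s x l = k then 1 else 0)
        (fun x => h (s x l')) w := by
    have key : ∀ f : 𝒳 → ℝ, ∑ k, g k * ∑ x, (w x : ℝ) * ((if s x l = k then 1 else 0) * f x) =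
        ∑ x, w x * (g (s x l) * f x) := by
      intro f
      simp only [Finset.mul_sum]
      rw [Finset.sum_comm]
      refine Finset.sum_congr rfl fun x _ => ?_
      rw [Finset.sum_eq_single (s x l)]
      · simp; ring
      · intro k _ hk; simp [Ne.symm hk]
      · simp
    have k1 := key fun x => h (s x l')
    have k2 := key fun x => 1
    simp only [mul_one] at k2
    simp only [weightedCovariance, mul_sub, Finset.sum_sub_distrib, ← mul_assoc,
      ← Finset.sum_mul]
    simp only [mul_assoc, k2]
    rw [← k2, Finset.sum_mul]
    simp only [mul_assoc, k1]
  rw [h1]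
  have h2 : (∑ k, g k * weightedCovariance (fun x => if s x l = k then 1 else 0)
      (fun x => h (s x l')) w) ^ 2 ≤ Fintype.card A * ∑ k, (g k *
        weightedCovariance (fun x => if s x l = k then 1 else 0) (fun x => h (s x l')) w) ^ 2 := by
    have := sq_sum_le_card_mul_sum_sq (s := (Finset.univ : Finset A)) (f := fun k => g k *
        weightedCovariance (fun x => if s x l = k then 1 else 0) (fun x => h (s x l')) w)
    simpa [Finset.card_univ] using this
  refine h2.trans ?_
  rw [mul_assoc, mul_assoc]
  refine mul_le_mul_of_nonneg_left ?_ (by positivity)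
  rw [Finset.mul_sum, Finset.mul_sum]
  refine Finset.sum_le_sum fun k _ => ?_
  rw [mul_pow]
  refine mul_le_mul ?_ (weightedCovariance_sq_le (fun x => s x l') _ hh hw) (sq_nonneg _)
    (sq_nonneg _)
  rw [← sq_abs]
  exact pow_le_pow_left₀ (abs_nonneg _) (hg k) 2

variable [Nonempty ι]

lemma sum_labelGap (s : 𝒳 → ι → A) (w : 𝒳 → ℝ≥0) :
    ((Fintype.card ι : ℝ)⁻¹) ^ 2 * ∑ l, ∑ l', ∑ k, labelGap s w l l' k =
      (labelVariance s - pinOp s (labelVariance s)) w :=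
  (labelVariance_sub_pinOp_apply s w).symm

/-- Averaged over all pairs of sections, the variance losses are precisely the decrease of
`labelVariance` under `pinOp`. A small decrease therefore forces most pairs to be nearly
uncorrelated. -/
lemma sum_sq_weightedCovariance_le (s : 𝒳 → ι → A) {w : 𝒳 → ℝ≥0} (hw : ∑ x, w x = 1)
    {D : ℝ} (g h : ι → A → ℝ) (hg : ∀ l k, |g l k| ≤ D) (hh : ∀ l k, |h l k| ≤ D) :
    ((Fintype.card ι : ℝ)⁻¹) ^ 2 * ∑ l, ∑ l',
        weightedCovariance (fun x => g l (s x l)) (fun x => h l' (s x l')) w ^ 2 ≤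
      Fintype.card A * D ^ 4 * (labelVariance s - pinOp s (labelVariance s)) w := by
  rw [← sum_labelGap, ← mul_assoc, mul_comm (_ * _) (((Fintype.card ι : ℝ)⁻¹) ^ 2), mul_assoc]
  refine mul_le_mul_of_nonneg_left ?_ (by positivity)
  simp only [Finset.mul_sum]
  refine Finset.sum_le_sum fun l _ => Finset.sum_le_sum fun l' _ => ?_
  rw [← Finset.mul_sum]
  have := weightedCovariance_label_sq_le s hw (g l) (h l') (hg l) (hh l') l l'
  calc _ ≤ _ := this
    _ = _ := by ring

/-- The variance of an average of functions of the labels is small if pinning does not decrease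
the label variance much. -/
lemma sum_abs_sub_mean_le (s : 𝒳 → ι → A) {w : 𝒳 → ℝ≥0} (hw : ∑ x, w x = 1)
    {D : ℝ} (g : ι → A → ℝ) (hg : ∀ l k, |g l k| ≤ D) {r : ℝ} (hr : 0 < r) :
    ∑ x, w x * |(Fintype.card ι : ℝ)⁻¹ * ∑ l, g l (s x l) -
        ∑ x, w x * ((Fintype.card ι : ℝ)⁻¹ * ∑ l, g l (s x l))| ≤
      r + Fintype.card A * D ^ 4 / (4 * r ^ 3) *
        (labelVariance s - pinOp s (labelVariance s)) w := by
  set f : 𝒳 → ℝ := fun x => (Fintype.card ι : ℝ)⁻¹ * ∑ l, g l (s x l) with hf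
  set e : ℝ := ∑ x, w x * f x with he
  have hw' := coe_sum_eq_one hw
  have h1 : ∑ x, w x * |f x - e| ≤ r / 2 + (∑ x, w x * (f x - e) ^ 2) / (2 * r) := by
    calc ∑ x, w x * |f x - e| ≤ ∑ x, w x * (r / 2 + (f x - e) ^ 2 / (2 * r)) :=
          Finset.sum_le_sum fun x _ =>
            mul_le_mul_of_nonneg_left (abs_le_half_add_sq hr) (NNReal.coe_nonneg _)
      _ = _ := by
          simp only [mul_add, Finset.sum_add_distrib, ← Finset.sum_mul, hw', one_mul,
            ← mul_div_assoc, ← Finset.sum_div]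
  -- The variance of an average is the average of the pairwise covariances.
  have h2 : ∑ x, w x * (f x - e) ^ 2 = ((Fintype.card ι : ℝ)⁻¹) ^ 2 * ∑ l, ∑ l',
      weightedCovariance (fun x => g l (s x l)) (fun x => g l' (s x l')) w := by
    have : ∑ x, w x * (f x - e) ^ 2 = ∑ x, w x * (f x * f x) - e * e := by
      have : ∀ x, w x * (f x - e) ^ 2 = w x * (f x * f x) - 2 * e * (w x * f x) + e ^ 2 * w x := by
        intro x; ring
      simp only [this, Finset.sum_add_distrib, Finset.sum_sub_distrib, ← Finset.mul_sum, hw', ← he]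
      ring
    rw [this, he]
    simp only [weightedCovariance, Finset.sum_sub_distrib, mul_sub]
    congr 1
    · simp only [hf, Finset.mul_sum, Finset.sum_mul]
      rw [Finset.sum_comm]
      refine Finset.sum_congr rfl fun l _ => ?_
      rw [Finset.sum_comm]
      refine Finset.sum_congr rfl fun l' _ => Finset.sum_congr rfl fun x _ => ?_
      ring
    · have : ∑ x, w x * f x = (Fintype.card ι : ℝ)⁻¹ * ∑ l, ∑ x, w x * g l (s x l) := by
        simp only [hf, Finset.mul_sum]
        rw [Finset.sum_comm]
        refine Finset.sum_congr rfl fun l _ => Finset.sum_congr rfl fun x _ => ?_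
        ring
      rw [this]
      simp only [← Finset.mul_sum, ← Finset.sum_mul]
      ring
  -- Only squares of covariances are controlled, so the arithmetic-geometric inequality is used a
  -- second time, now with parameter `r ^ 2` to match the later division by `2 * r`.
  have h3 : ∑ x, w x * (f x - e) ^ 2 ≤ r ^ 2 / 2 + Fintype.card A * D ^ 4 *
      (labelVariance s - pinOp s (labelVariance s)) w / (2 * r ^ 2) := by
    have hL : ((Fintype.card ι : ℝ)⁻¹) ^ 2 * ∑ _l : ι, ∑ _l' : ι, (1 : ℝ) = 1 := by
      have : (Fintype.card ι : ℝ) ≠ 0 := by exact_mod_cast Fintype.card_ne_zero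
      simp; field_simp
    calc _ = _ := h2
      _ ≤ ((Fintype.card ι : ℝ)⁻¹) ^ 2 * ∑ l, ∑ l', (r ^ 2 / 2 * 1 +
          (2 * r ^ 2)⁻¹ *
          weightedCovariance (fun x => g l (s x l)) (fun x => g l' (s x l')) w ^ 2) := by
          refine mul_le_mul_of_nonneg_left ?_ (by positivity)
          refine Finset.sum_le_sum fun l _ => Finset.sum_le_sum fun l' _ => ?_
          refine (le_abs_self _).trans ((abs_le_half_add_sq (s := r ^ 2) (by positivity)).trans ?_)
          rw [mul_one, div_eq_inv_mul (_ ^ 2) (2 * r ^ 2)]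
      _ ≤ _ := by
          simp only [Finset.sum_add_distrib, ← Finset.mul_sum]
          have := sum_sq_weightedCovariance_le s hw g g hg hg
          have h4 := mul_le_mul_of_nonneg_left this (show 0 ≤ (2 * r ^ 2)⁻¹ by positivity)
          calc _ = r ^ 2 / 2 * (((Fintype.card ι : ℝ)⁻¹) ^ 2 * ∑ _l : ι, ∑ _l' : ι, (1 : ℝ)) +
                (2 * r ^ 2)⁻¹ * (((Fintype.card ι : ℝ)⁻¹) ^ 2 * ∑ l, ∑ l',
                  weightedCovariance (fun x => g l (s x l)) (fun x => g l' (s x l')) w ^ 2) := by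
                ring
            _ ≤ _ := by
                rw [hL, div_eq_inv_mul _ (2 * r ^ 2), mul_one]
                linarith
  refine h1.trans ?_
  have h5 := div_le_div_of_nonneg_right h3 (show 0 ≤ 2 * r by positivity)
  calc _ ≤ r / 2 + (r ^ 2 / 2 + Fintype.card A * D ^ 4 *
      (labelVariance s - pinOp s (labelVariance s)) w / (2 * r ^ 2)) / (2 * r) := by linarith
    _ = r * (3 / 4) + Fintype.card A * D ^ 4 / (4 * r ^ 3) *
        (labelVariance s - pinOp s (labelVariance s)) w := by field_simp; ring
    _ ≤ _ := by linarith

/-- The features centered under a weight vector. -/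
def centered {κ : Type*} (X : 𝒳 → κ → ℝ) (w : 𝒳 → ℝ≥0) (x : 𝒳) (i : κ) : ℝ :=
  X x i - ∑ x', w x' * X x' i

/-- For two independent samples of centred features, the mean square of the overlap is the
normalised sum of the squared covariances of all pairs of features, which pinning controls. -/
lemma sum_abs_overlap_le (s : 𝒳 → ι → A) {w : 𝒳 → ℝ≥0} (hw : ∑ x, w x = 1)
    {U : ℝ} (a : A → κ → ℝ) (ha : ∀ k b, |a k b| ≤ U) {r : ℝ} (hr : 0 < r) :
    ∑ x, ∑ x', (w x : ℝ) * w x' * |(Fintype.card ι : ℝ)⁻¹ * ∑ i,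
        centered (fun x => sectionFeatures a (s x)) w x i *
          centered (fun x => sectionFeatures a (s x)) w x' i| ≤
      r + Fintype.card A * U ^ 4 * Fintype.card κ ^ 2 / (2 * r) *
        (labelVariance s - pinOp s (labelVariance s)) w := by
  set X := centered (fun x => sectionFeatures a (s x)) w with hX
  set q : 𝒳 → 𝒳 → ℝ := fun x x' => (Fintype.card ι : ℝ)⁻¹ * ∑ i, X x i * X x' i with hq
  have hw' := coe_sum_eq_one hw
  have h1 : ∑ x, ∑ x', (w x : ℝ) * w x' * |q x x'| ≤
      r / 2 + (∑ x, ∑ x', (w x : ℝ) * w x' * q x x' ^ 2) / (2 * r) := by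
    calc _ ≤ ∑ x, ∑ x', (w x : ℝ) * w x' * (r / 2 + q x x' ^ 2 / (2 * r)) :=
          Finset.sum_le_sum fun x _ => Finset.sum_le_sum fun x' _ =>
            mul_le_mul_of_nonneg_left (abs_le_half_add_sq hr) (by positivity)
      _ = _ := by
          simp only [mul_add, Finset.sum_add_distrib, ← Finset.sum_mul, ← Finset.mul_sum, hw',
            mul_one, one_mul, ← mul_div_assoc, ← Finset.sum_div]
  have hcov : ∀ i j : ι × κ, ∑ x, (w x : ℝ) * (X x i * X x j) =
      weightedCovariance (fun x => a (s x i.1) i.2) (fun x => a (s x j.1) j.2) w := by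
    intro i j
    simp only [hX, centered, sectionFeatures, weightedCovariance]
    set m := ∑ x, (w x : ℝ) * a (s x i.1) i.2
    set m' := ∑ x, (w x : ℝ) * a (s x j.1) j.2
    have : ∀ x, (w x : ℝ) * ((a (s x i.1) i.2 - m) * (a (s x j.1) j.2 - m')) =
        w x * (a (s x i.1) i.2 * a (s x j.1) j.2) - m' * (w x * a (s x i.1) i.2) -
          m * (w x * a (s x j.1) j.2) + m * m' * w x := by intro x; ring
    simp only [this, Finset.sum_add_distrib, Finset.sum_sub_distrib, ← Finset.mul_sum, hw']
    ring
  have h2 : ∑ x, ∑ x', (w x : ℝ) * w x' * q x x' ^ 2 =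
      ((Fintype.card ι : ℝ)⁻¹) ^ 2 * ∑ i : ι × κ, ∑ j : ι × κ,
        weightedCovariance (fun x => a (s x i.1) i.2) (fun x => a (s x j.1) j.2) w ^ 2 := by
    simp only [← hcov]
    have : ∀ x x', (w x : ℝ) * w x' * q x x' ^ 2 = ((Fintype.card ι : ℝ)⁻¹) ^ 2 *
        ∑ i : ι × κ, ∑ j : ι × κ, (w x * (X x i * X x j)) * (w x' * (X x' i * X x' j)) := by
      intro x x'
      rw [hq]
      simp only
      rw [mul_pow, sq (∑ i, X x i * X x' i), Finset.sum_mul_sum]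
      simp only [Finset.mul_sum]
      refine Finset.sum_congr rfl fun i _ => Finset.sum_congr rfl fun j _ => ?_
      ring
    simp only [this, ← Finset.mul_sum]
    congr 1
    have h3 : ∀ i j : ι × κ, (∑ x, (w x : ℝ) * (X x i * X x j)) ^ 2 = ∑ x, ∑ x',
        (w x * (X x i * X x j)) * (w x' * (X x' i * X x' j)) := by
      intro i j
      rw [sq, Finset.sum_mul_sum]
    simp only [h3]
    rw [Finset.sum_congr rfl fun x _ => Finset.sum_comm]
    rw [Finset.sum_comm]
    refine Finset.sum_congr rfl fun i _ => ?_
    rw [Finset.sum_congr rfl fun x _ => Finset.sum_comm]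
    rw [Finset.sum_comm]
  have h3 : ∑ x, ∑ x', (w x : ℝ) * w x' * q x x' ^ 2 ≤ Fintype.card A * U ^ 4 *
      Fintype.card κ ^ 2 * (labelVariance s - pinOp s (labelVariance s)) w := by
    rw [h2]
    have h4 : ∀ b b' : κ, _ := fun b b' => sum_sq_weightedCovariance_le s hw
      (fun _ k => a k b) (fun _ k => a k b') (fun _ k => ha k b) (fun _ k => ha k b')
    calc _ = ∑ b, ∑ b', ((Fintype.card ι : ℝ)⁻¹) ^ 2 * ∑ l, ∑ l',
          weightedCovariance (fun x => a (s x l) b) (fun x => a (s x l') b') w ^ 2 := by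
          simp only [Fintype.sum_prod_type_right, ← Finset.mul_sum]
          congr 1
          exact Finset.sum_congr rfl fun b _ => Finset.sum_comm
      _ ≤ ∑ _b : κ, ∑ _b' : κ, Fintype.card A * U ^ 4 *
          (labelVariance s - pinOp s (labelVariance s)) w :=
          Finset.sum_le_sum fun b _ => Finset.sum_le_sum fun b' _ => h4 b b'
      _ = _ := by simp; ring
  refine h1.trans ?_
  have h5 := div_le_div_of_nonneg_right h3 (show 0 ≤ 2 * r by positivity)
  calc _ ≤ r / 2 + (Fintype.card A * U ^ 4 * Fintype.card κ ^ 2 *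
        (labelVariance s - pinOp s (labelVariance s)) w) / (2 * r) := by linarith
    _ = r / 2 + Fintype.card A * U ^ 4 * Fintype.card κ ^ 2 / (2 * r) *
        (labelVariance s - pinOp s (labelVariance s)) w := by ring
    _ ≤ _ := by linarith

end LabelFluctuation

/-- Normalised squared norms are averages of bounded functions of the labels, with mean equal to the
variance per section; overlaps are centred. Both parts of the fluctuation thus reduce to pair
covariances, with half of `r` spent on each. -/
lemma exists_fluctuation_le (A κ : Type*) [Fintype A] [DecidableEq A] [MeasurableSpace A]
    [MeasurableSingletonClass A] [Fintype κ] (U : ℝ) {r : ℝ} (hr : 0 < r) :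
    ∃ C, 0 ≤ C ∧ ∀ {𝒳 ι : Type} [Fintype 𝒳] [Fintype ι] [Nonempty ι] (s : 𝒳 → ι → A)
      (a : A → κ → ℝ), (∀ k b, |a k b| ≤ U) → ∀ {v : ℝ≥0}, (v : ℝ) = (Fintype.card ι : ℝ)⁻¹ →
      ∀ {w : 𝒳 → ℝ≥0}, ∑ x, w x = 1 →
      fluctuation (centered (fun x => sectionFeatures a (s x)) w) v w
        (v * totalVariance (fun x => sectionFeatures a (s x)) w) ≤
      r + C * (labelVariance s - pinOp s (labelVariance s)) w := by
  refine ⟨Fintype.card A * (Fintype.card κ * (2 * U) ^ 2) ^ 4 / (4 * (r / 2) ^ 3) +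
    Fintype.card A * U ^ 4 * Fintype.card κ ^ 2 / (2 * (r / 2)), by positivity, ?_⟩
  intro 𝒳 ι _ _ _ s a ha v hv w hw
  have hw' := coe_sum_eq_one hw
  have h2 := sum_abs_overlap_le s hw a ha (r := r / 2) (by positivity)
  set m : ι → κ → ℝ := fun l b => ∑ x, w x * a (s x l) b with hm
  have hmU : ∀ l b, |m l b| ≤ U := by
    intro l b
    refine (Finset.abs_sum_le_sum_abs _ _).trans ?_
    calc _ ≤ ∑ x, (w x : ℝ) * U := Finset.sum_le_sum fun x _ => by
          rw [abs_mul, NNReal.abs_eq]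
          exact mul_le_mul_of_nonneg_left (ha _ _) (NNReal.coe_nonneg _)
      _ = U := by rw [← Finset.sum_mul, hw', one_mul]
  set g : ι → A → ℝ := fun l k => ∑ b, (a k b - m l b) ^ 2 with hg
  have hgD : ∀ l k, |g l k| ≤ Fintype.card κ * (2 * U) ^ 2 := by
    intro l k
    rw [abs_of_nonneg (Finset.sum_nonneg fun b _ => sq_nonneg _)]
    calc _ ≤ ∑ _b : κ, (2 * U) ^ 2 := Finset.sum_le_sum fun b _ => by
          rw [← sq_abs]
          refine pow_le_pow_left₀ (abs_nonneg _) ?_ 2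
          have := abs_sub (a k b) (m l b)
          linarith [ha k b, hmU l b]
      _ = _ := by simp
  have h1 := sum_abs_sub_mean_le s hw g hgD (r := r / 2) (by positivity)
  have hsq : ∀ x, ∑ i, centered (fun x => sectionFeatures a (s x)) w x i ^ 2 =
      ∑ l, g l (s x l) := by
    intro x
    rw [Fintype.sum_prod_type]
    rfl
  have he : v * totalVariance (fun x => sectionFeatures a (s x)) w =
      ∑ x, w x * ((Fintype.card ι : ℝ)⁻¹ * ∑ l, g l (s x l)) := by
    rw [totalVariance_apply, hv]
    simp only [← hsq, Functional.varianceFun_eq, hw', div_one, Finset.mul_sum]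
    rw [Finset.sum_comm]
    refine Finset.sum_congr rfl fun x _ => Finset.sum_congr rfl fun i _ => ?_
    simp only [centered]
    ring
  rw [fluctuation, he]
  simp only [hv, hsq]
  have h3 := add_le_add h1 h2
  refine h3.trans (le_of_eq ?_)
  ring

lemma rowChannel_op_sub_const {𝒳 κ : Type*} [Fintype 𝒳] [Fintype κ] (X : 𝒳 → κ → ℝ) (m : κ → ℝ)
    (v δ : ℝ≥0) : (rowChannel (fun x i => X x i - m i) v δ).op = (rowChannel X v δ).op := by
  refine LinearMap.ext fun F => Functional.ext' fun w => ?_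
  rw [(rowChannel_op_apply _ v δ F w).2, (rowChannel_op_apply X v δ F w).2]
  refine integral_congr_ae (.of_forall fun φ => ?_)
  have : (fun x => ∑ i, φ i * (X x i - m i)) =
      fun x => ∑ i, φ i * X x i + -∑ i, φ i * m i := by
    funext x
    simp only [mul_sub, Finset.sum_sub_distrib]
    ring
  simp only [this, gaussChannel_op_add_const]

/-! ### Joint and separate measurements of blocks -/

section Blocks

variable {A κ : Type} [Fintype A] [Fintype κ]

/-- A measurement of all sections at once, with row entries of variance one over their number. -/
def jointOp {𝒳 ι : Type} [Fintype 𝒳] [Fintype ι] (s : 𝒳 → ι → A) (a : A → κ → ℝ) (δ : ℝ≥0) :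
    Module.End ℝ (Functional 𝒳) :=
  (rowChannel (fun x => sectionFeatures a (s x)) ((Fintype.card ι : ℝ≥0)⁻¹) δ).op

/-- A measurement of a single block of sections, chosen with probability proportional to its
size. -/
def blockOp {β 𝒳 : Type} [Fintype 𝒳] [Fintype β] {σ : β → Type} [∀ b, Fintype (σ b)]
    (s : 𝒳 → (Σ b, σ b) → A) (a : A → κ → ℝ) (δ : ℝ≥0) : Module.End ℝ (Functional 𝒳) :=
  ∑ b, ((Fintype.card (σ b) : ℝ) / Fintype.card (Σ b, σ b)) • jointOp (fun x l => s x ⟨b, l⟩) a δ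

lemma sum_blockWeight (β : Type) [Fintype β] (σ : β → Type) [∀ b, Fintype (σ b)]
    [Nonempty (Σ b, σ b)] :
    ∑ b, (Fintype.card (σ b) : ℝ) / Fintype.card (Σ b, σ b) = 1 := by
  rw [← Finset.sum_div, ← Nat.cast_sum, ← Fintype.card_sigma, div_self]
  exact_mod_cast Fintype.card_ne_zero

lemma isAveraging_jointOp {𝒳 ι : Type} [Fintype 𝒳] [Fintype ι] (s : 𝒳 → ι → A) (a : A → κ → ℝ)
    (δ : ℝ≥0) : IsAveraging (jointOp s a δ) := Channel.isAveraging_op _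

lemma totalVariance_sectionFeatures_le {𝒳 ι : Type} [Fintype 𝒳] [Fintype ι] (s : 𝒳 → ι → A)
    {a : A → κ → ℝ} {U : ℝ} (ha : ∀ k b, |a k b| ≤ U) :
    totalVariance (fun x => sectionFeatures a (s x)) ≤
      (Fintype.card ι * (Fintype.card κ * U ^ 2)) • Functional.mass 𝒳 := by
  intro w
  have h : ∀ i : ι × κ, Functional.varianceFun (fun x => sectionFeatures a (s x) i) w ≤
      U ^ 2 * Functional.mass 𝒳 w := fun i =>
    Functional.variance_le_mass (f := fun x => sectionFeatures a (s x) i) (c := U ^ 2) (fun x => by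
      rw [← sq_abs]
      exact pow_le_pow_left₀ (abs_nonneg _) (ha _ _) 2) w
  show totalVariance (fun x => sectionFeatures a (s x)) w ≤ _ * Functional.mass 𝒳 w
  rw [totalVariance_apply]
  refine (Finset.sum_le_sum fun i _ => h i).trans (le_of_eq ?_)
  simp
  ring

variable [DecidableEq A] [MeasurableSpace A] [MeasurableSingletonClass A]

/-- Both sides are compared with `log (1 + δ e) / 2`, where `e` is the variance per section. A joint
row falls short of it only by the fluctuation error. Block rows cannot exceed it on average: their
bounds are tangent lines at the common point `e`, and the block variances average to `e`. -/
lemma exists_jointOp_entropy_le (A κ : Type) [Fintype A] [Fintype κ] [DecidableEq A]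
    [MeasurableSpace A] [MeasurableSingletonClass A] (U : ℝ) {δ : ℝ≥0} (hδ : δ ≠ 0) {r : ℝ}
    (hr : 0 < r) :
    ∃ C : ℝ, 0 ≤ C ∧ ∀ {β 𝒳 : Type} [Fintype β] [Fintype 𝒳] {σ : β → Type} [∀ b, Fintype (σ b)]
      [Nonempty (Σ b, σ b)] (s : 𝒳 → (Σ b, σ b) → A) (a : A → κ → ℝ), (∀ k b, |a k b| ≤ U) →
      jointOp s a δ (Functional.entropy 𝒳) ≤ blockOp s a δ (Functional.entropy 𝒳) +
        r • Functional.mass 𝒳 + C • (labelVariance s - pinOp s (labelVariance s)) := by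
  obtain ⟨C₁, hC₁, h₁⟩ := exists_le_entropy_sub_rowChannel hδ
    (show 0 ≤ (Fintype.card κ : ℝ) * U ^ 2 by positivity) (half_pos hr)
  -- The tolerance is divided by `C₁ + 1` so that multiplication by `C₁` leaves at most `r / 2`,
  -- even when `C₁` vanishes.
  obtain ⟨C₂, hC₂, h₂⟩ := exists_fluctuation_le A κ U
    (show 0 < r / (2 * (C₁ + 1)) by positivity)
  refine ⟨C₁ * C₂, by positivity, ?_⟩
  intro β 𝒳 _ _ σ _ _ s a ha
  refine Functional.le_of_forall_prob fun w hw => ?_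
  set v : ℝ≥0 := (Fintype.card (Σ b, σ b) : ℝ≥0)⁻¹ with hv
  have hcard : (0 : ℝ) < Fintype.card (Σ b, σ b) := by exact_mod_cast Fintype.card_pos
  have hv' : (v : ℝ) = (Fintype.card (Σ b, σ b) : ℝ)⁻¹ := by simp [hv]
  have hmass : Functional.mass 𝒳 w = 1 := by rw [Functional.mass_apply, coe_sum_eq_one hw]
  set X := fun x => sectionFeatures a (s x) with hX
  set e : ℝ := v * totalVariance X w with he
  have he0 : 0 ≤ e := mul_nonneg v.2 (totalVariance_nonneg X w)
  have heD : e ≤ Fintype.card κ * U ^ 2 := by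
    have h := totalVariance_sectionFeatures_le s ha w
    have h' : totalVariance X w ≤
      (Fintype.card (Σ b, σ b) * (Fintype.card κ * U ^ 2)) * Functional.mass 𝒳 w := h
    rw [hmass, mul_one] at h'
    calc e ≤ v * _ := mul_le_mul_of_nonneg_left h' v.2
      _ = _ := by rw [hv']; field_simp
  have hlow := h₁ (centered X w) v w hw e he0 heD
  have hfl := h₂ s a ha hv' hw
  have hshift : (rowChannel (centered X w) v δ).op = jointOp s a δ :=
    rowChannel_op_sub_const X (fun i => ∑ x', w x' * X x' i) v δ
  rw [hshift] at hlow
  set Q := (labelVariance s - pinOp s (labelVariance s)) w with hQ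
  have hup : Functional.entropyFun w - blockOp s a δ (Functional.entropy 𝒳) w ≤
      Real.log (1 + δ * e) / 2 := by
    have hb : ∀ b, Functional.entropyFun w -
        jointOp (fun x l => s x ⟨b, l⟩) a δ (Functional.entropy 𝒳) w ≤
        (Real.log (1 + δ * e) / 2 - δ * e / (1 + δ * e) / 2) +
        (δ / (1 + δ * e) / 2 * (Fintype.card (σ b) : ℝ)⁻¹) *
          totalVariance (fun x => sectionFeatures a fun l => s x ⟨b, l⟩) w := by
      intro b
      have h : Functional.entropyFun w -
        jointOp (fun x l => s x ⟨b, l⟩) a δ (Functional.entropy 𝒳) w ≤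
        (Real.log (1 + δ * e) / 2 - δ * e / (1 + δ * e) / 2) * Functional.mass 𝒳 w +
        (δ / (1 + δ * e) / 2 * ((Fintype.card (σ b) : ℝ≥0)⁻¹ : ℝ≥0)) *
          totalVariance (fun x => sectionFeatures a fun l => s x ⟨b, l⟩) w :=
        entropy_sub_rowChannel_le (fun x => sectionFeatures a fun l => s x ⟨b, l⟩)
          ((Fintype.card (σ b) : ℝ≥0)⁻¹) δ he0 w
      rw [hmass, mul_one] at h
      simpa using h
    have hsum := Finset.sum_le_sum fun b (_ : b ∈ Finset.univ) => mul_le_mul_of_nonneg_left (hb b)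
      (show 0 ≤ (Fintype.card (σ b) : ℝ) / Fintype.card (Σ b, σ b) by positivity)
    have hL : ∑ b, (Fintype.card (σ b) : ℝ) / Fintype.card (Σ b, σ b) * (Functional.entropyFun w -
        jointOp (fun x l => s x ⟨b, l⟩) a δ (Functional.entropy 𝒳) w) =
        Functional.entropyFun w - blockOp s a δ (Functional.entropy 𝒳) w := by
      simp only [mul_sub, Finset.sum_sub_distrib, ← Finset.sum_mul, sum_blockWeight, one_mul,
        blockOp, LinearMap.sum_apply, Functional.sum_apply, LinearMap.smul_apply,
        Functional.smul_apply]
    -- The probability of choosing a block cancels the normalisation of its row by its size, so the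
    -- mean block variance is exactly `e`; empty blocks contribute nothing.
    have hV : ∑ b, (Fintype.card (σ b) : ℝ) / Fintype.card (Σ b, σ b) *
        ((Fintype.card (σ b) : ℝ)⁻¹ *
          totalVariance (fun x => sectionFeatures a fun l => s x ⟨b, l⟩) w) = e := by
      rw [he, hv', totalVariance_apply, Fintype.sum_prod_type, Fintype.sum_sigma, Finset.mul_sum]
      refine Finset.sum_congr rfl fun b _ => ?_
      rw [totalVariance_apply, Fintype.sum_prod_type]
      by_cases h0 : Fintype.card (σ b) = 0
      · have := Fintype.card_eq_zero_iff.1 h0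
        simp
      · have : (Fintype.card (σ b) : ℝ) ≠ 0 := by exact_mod_cast h0
        rw [← mul_assoc]
        congr 1
        field_simp
    rw [hL] at hsum
    refine hsum.trans (le_of_eq ?_)
    have : ∀ b, (Fintype.card (σ b) : ℝ) / Fintype.card (Σ b, σ b) *
        ((Real.log (1 + δ * e) / 2 - δ * e / (1 + δ * e) / 2) +
        (δ / (1 + δ * e) / 2 * (Fintype.card (σ b) : ℝ)⁻¹) *
          totalVariance (fun x => sectionFeatures a fun l => s x ⟨b, l⟩) w) =
        (Fintype.card (σ b) : ℝ) / Fintype.card (Σ b, σ b) *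
          (Real.log (1 + δ * e) / 2 - δ * e / (1 + δ * e) / 2) +
        δ / (1 + δ * e) / 2 * ((Fintype.card (σ b) : ℝ) / Fintype.card (Σ b, σ b) *
        ((Fintype.card (σ b) : ℝ)⁻¹ *
          totalVariance (fun x => sectionFeatures a fun l => s x ⟨b, l⟩) w)) := by
      intro b; ring
    simp only [this, Finset.sum_add_distrib, ← Finset.mul_sum, hV, ← Finset.sum_mul,
      sum_blockWeight]
    ring
  have hC : C₁ * fluctuation (centered X w) v w e ≤ r / 2 + C₁ * C₂ * Q := by
    have h := mul_le_mul_of_nonneg_left hfl hC₁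
    have h' : C₁ * (r / (2 * (C₁ + 1))) ≤ r / 2 := by
      rw [← mul_div_assoc, div_le_div_iff₀ (by positivity) (by positivity)]
      nlinarith
    calc _ ≤ _ := h
      _ = C₁ * (r / (2 * (C₁ + 1))) + C₁ * C₂ * Q := by ring
      _ ≤ _ := by linarith
  show jointOp s a δ (Functional.entropy 𝒳) w ≤ blockOp s a δ (Functional.entropy 𝒳) w +
    r * Functional.mass 𝒳 w + C₁ * C₂ * Q
  rw [hmass, mul_one]
  linarith

end Blocks

/-! ### Comparison of powers of averaging operators -/

section Comparison

variable {𝒳 : Type*} [Fintype 𝒳] {S T P : Module.End ℝ (Functional 𝒳)}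

lemma Functional.smul_le_smul {F G : Functional 𝒳} (h : F ≤ G) {c : ℝ} (hc : 0 ≤ c) :
    c • F ≤ c • G := fun w => mul_le_mul_of_nonneg_left (h w) hc

lemma Functional.smul_mass_le {c d : ℝ} (h : c ≤ d) :
    c • Functional.mass 𝒳 ≤ d • Functional.mass 𝒳 := fun w =>
  mul_le_mul_of_nonneg_right h (Functional.mass_nonneg w)

lemma IsAveraging.map_smul_mass (hT : IsAveraging T) (c : ℝ) :
    T (c • Functional.mass 𝒳) = c • Functional.mass 𝒳 := by rw [map_smul, hT.mass]

lemma IsAveraging.pow_le (hT : IsAveraging T) {H : Functional 𝒳} (h : T H ≤ H) (n : ℕ) :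
    (T ^ n) H ≤ H := by
  induction n with
  | zero => simp
  | succ n ih => rw [pow_succ, Module.End.mul_apply]; exact ((hT.pow n).mono h).trans ih

lemma IsAveraging.le_pow_add (hT : IsAveraging T) {H : Functional 𝒳} {c : ℝ}
    (h : H - T H ≤ c • Functional.mass 𝒳) (n : ℕ) :
    H ≤ (T ^ n) H + (n * c) • Functional.mass 𝒳 := by
  induction n with
  | zero => simp
  | succ n ih =>
    have h1 := (hT.pow n).mono (sub_le_iff_le_add.1 h)
    rw [map_add, (hT.pow n).map_smul_mass, ← Module.End.mul_apply, ← pow_succ] at h1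
    calc H ≤ (T ^ n) H + (n * c) • Functional.mass 𝒳 := ih
      _ ≤ (c • Functional.mass 𝒳 + (T ^ (n + 1)) H) + (n * c) • Functional.mass 𝒳 := by
          gcongr
      _ = _ := by push_cast; module

/-- The sums of the powers of an averaging operator. -/
lemma sum_pow_mono (hP : IsAveraging P) (N : ℕ) {F G : Functional 𝒳} (h : F ≤ G) :
    (∑ t ∈ Finset.range N, P ^ t) F ≤ (∑ t ∈ Finset.range N, P ^ t) G := by
  rw [LinearMap.sum_apply, LinearMap.sum_apply]
  exact Finset.sum_le_sum fun t _ => (hP.pow t).mono h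

lemma sum_pow_smul_mass (hP : IsAveraging P) (N : ℕ) (c : ℝ) :
    (∑ t ∈ Finset.range N, P ^ t) (c • Functional.mass 𝒳) = (N * c) • Functional.mass 𝒳 := by
  simp only [LinearMap.sum_apply, (hP.pow _).map_smul_mass, Finset.sum_const, Finset.card_range]
  module

lemma sum_pow_sub (N : ℕ) (V : Functional 𝒳) :
    (∑ t ∈ Finset.range N, P ^ t) (V - P V) = V - (P ^ N) V := by
  have h : ∀ t, (P ^ t) (V - P V) = (P ^ t) V - (P ^ (t + 1)) V := fun t => by
    rw [map_sub, pow_succ, Module.End.mul_apply]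
  rw [LinearMap.sum_apply]
  simp only [h]
  have := Finset.sum_range_sub' (fun t => (P ^ t) V) N
  simpa using this

/-- If a single step of `T` exceeds a single step of `S` only by a multiple of what `P` takes off
a bounded functional, then the powers of `T` do not exceed those of `S` by much. -/
lemma pow_sub_pow_le (hT : IsAveraging T) (hS : IsAveraging S) (hP : IsAveraging P)
    (hTS : Commute T S) (hTP : Commute T P) (hSP : Commute S P) {H V : Functional 𝒳}
    {r C c₀ c : ℝ} (hC : 0 ≤ C) (hc : 0 ≤ c)
    (h : T H ≤ S H + r • Functional.mass 𝒳 + C • (V - P V)) (hV : 0 ≤ V)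
    (hV' : V ≤ c₀ • Functional.mass 𝒳) (hH : P H ≤ H) (hH' : H - P H ≤ c • Functional.mass 𝒳)
    (M N : ℕ) {w : 𝒳 → ℝ≥0} (hw : ∑ x, w x = 1) :
    N * ((T ^ M) H w - (S ^ M) H w) ≤ M * (N * r + C * c₀) + N ^ 2 * c := by
  set R := ∑ t ∈ Finset.range N, P ^ t with hR
  have hRT : Commute T R := Commute.sum_right _ _ _ fun t _ => hTP.pow_right t
  have hRS : Commute S R := Commute.sum_right _ _ _ fun t _ => hSP.pow_right t
  set d := N * r + C * c₀ with hd
  -- Summing over the numbers `0, …, N - 1` of revelations telescopes the error term, leaving at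
  -- most `C c₀` instead of `N` times that.
  have h1 : R (T H) ≤ R (S H) + d • Functional.mass 𝒳 := by
    refine (sum_pow_mono hP N h).trans ?_
    rw [map_add, map_add, sum_pow_smul_mass hP, map_smul, sum_pow_sub, ← hR, add_assoc, hd,
      add_smul, mul_smul C]
    gcongr
    refine Functional.smul_le_smul ?_ hC
    exact (sub_le_self _ ((hP.pow N).nonneg V hV)).trans hV'
  -- The `M` factors are exchanged one at a time; commutation moves each `T` next to `H`, where the
  -- one-step bound applies.
  have h2 : ∀ M : ℕ, R ((T ^ M) H) ≤ R ((S ^ M) H) + (M * d) • Functional.mass 𝒳 := by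
    intro M
    induction M with
    | zero => simp
    | succ M ih =>
      have e1 : R ((T ^ (M + 1)) H) = T (R ((T ^ M) H)) := by
        rw [pow_succ', Module.End.mul_apply, ← Module.End.mul_apply R T, ← hRT.eq,
          Module.End.mul_apply]
      have e2 : T (R ((S ^ M) H)) = (S ^ M) (R (T H)) := by
        simp only [← Module.End.mul_apply]
        congr 1
        rw [← mul_assoc, hRT.eq, mul_assoc, (hTS.pow_right M).eq, ← mul_assoc,
          ← (hRS.pow_left M).eq, mul_assoc]
      have e3 : (S ^ M) (R (S H)) = R ((S ^ (M + 1)) H) := by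
        simp only [← Module.End.mul_apply]
        congr 1
        rw [← mul_assoc, (hRS.pow_left M).eq, mul_assoc, pow_succ]
      have h3 := hT.mono ih
      rw [map_add, hT.map_smul_mass, ← e1, e2] at h3
      have h4 := (hS.pow M).mono h1
      rw [map_add, (hS.pow M).map_smul_mass, e3] at h4
      calc _ ≤ _ := h3
        _ ≤ R ((S ^ (M + 1)) H) + d • Functional.mass 𝒳 + (M * d) • Functional.mass 𝒳 := by
            gcongr
        _ = _ := by push_cast; module
  -- Removing the revelations: `t` of them lower the entropy by at most `t c ≤ N c`, and they never
  -- raise the subtracted term.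
  have h3 : ∀ t ∈ Finset.range N, (T ^ M) H - (S ^ M) H ≤
      (P ^ t) ((T ^ M) H) - (P ^ t) ((S ^ M) H) + (N * c) • Functional.mass 𝒳 := by
    intro t ht
    have i1 := (hT.pow M).mono (hP.le_pow_add hH' t)
    rw [map_add, (hT.pow M).map_smul_mass, ← Module.End.mul_apply,
      (hTP.pow_pow M t).eq, Module.End.mul_apply] at i1
    have i2 := (hS.pow M).mono (hP.pow_le hH t)
    rw [← Module.End.mul_apply, (hSP.pow_pow M t).eq, Module.End.mul_apply] at i2
    have i3 : (t * c) • Functional.mass 𝒳 ≤ (N * c) • Functional.mass 𝒳 :=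
      Functional.smul_mass_le (mul_le_mul_of_nonneg_right
        (by exact_mod_cast (Finset.mem_range.1 ht).le) hc)
    rw [sub_le_iff_le_add]
    calc _ ≤ _ := i1
      _ ≤ (P ^ t) ((T ^ M) H) + (N * c) • Functional.mass 𝒳 := by gcongr
      _ = (P ^ t) ((T ^ M) H) - (P ^ t) ((S ^ M) H) + (N * c) • Functional.mass 𝒳 +
          (P ^ t) ((S ^ M) H) := by abel
      _ ≤ _ := by gcongr
  have hmass : Functional.mass 𝒳 w = 1 := by rw [Functional.mass_apply, coe_sum_eq_one hw]
  have h4 := Finset.sum_le_sum fun t ht => h3 t ht w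
  have h5 : R ((T ^ M) H) w ≤ R ((S ^ M) H) w + (M * d) * Functional.mass 𝒳 w := h2 M w
  have h6 : ∑ t ∈ Finset.range N, ((T ^ M) H w - (S ^ M) H w) ≤ ∑ t ∈ Finset.range N,
      ((P ^ t) ((T ^ M) H) w - (P ^ t) ((S ^ M) H) w + (N * c) * Functional.mass 𝒳 w) := h4
  rw [hR, LinearMap.sum_apply, LinearMap.sum_apply, Functional.sum_apply, Functional.sum_apply,
    hmass] at h5
  simp only [Finset.sum_add_distrib, Finset.sum_sub_distrib, Finset.sum_const, Finset.card_range,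
    nsmul_eq_mul, hmass] at h6
  nlinarith

end Comparison

/-! ### Iterated joint and block measurements -/

section

variable {A κ : Type} [Fintype A] [Fintype κ]

lemma jointOp_entropy_le {𝒳 ι : Type} [Fintype 𝒳] [Fintype ι] (s : 𝒳 → ι → A) (a : A → κ → ℝ)
    (δ : ℝ≥0) : jointOp s a δ (Functional.entropy 𝒳) ≤ Functional.entropy 𝒳 :=
  Channel.op_entropy_le _

lemma isAveraging_blockOp {β 𝒳 : Type} [Fintype 𝒳] [Fintype β] {σ : β → Type}
    [∀ b, Fintype (σ b)] [Nonempty (Σ b, σ b)] (s : 𝒳 → (Σ b, σ b) → A) (a : A → κ → ℝ)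
    (δ : ℝ≥0) : IsAveraging (blockOp s a δ) :=
  IsAveraging.convex (fun _ => by positivity) (sum_blockWeight β σ) fun _ =>
    isAveraging_jointOp _ _ _

lemma commute_jointOp_blockOp {β 𝒳 : Type} [Fintype 𝒳] [Fintype β] {σ : β → Type}
    [∀ b, Fintype (σ b)] [Nonempty (Σ b, σ b)] (s : 𝒳 → (Σ b, σ b) → A) (a : A → κ → ℝ)
    (δ : ℝ≥0) : Commute (jointOp s a δ) (blockOp s a δ) :=
  Commute.sum_right _ _ _ fun _ _ => (Channel.commute_op _ _).smul_right _

variable [DecidableEq A] [MeasurableSpace A] [MeasurableSingletonClass A]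

lemma commute_jointOp_pinOp {𝒳 ι ι' : Type} [Fintype 𝒳] [Fintype ι] [Fintype ι'] (s : 𝒳 → ι → A)
    (s' : 𝒳 → ι' → A) (a : A → κ → ℝ) (δ : ℝ≥0) : Commute (jointOp s a δ) (pinOp s') :=
  Commute.sum_right _ _ _ fun _ _ => (Channel.commute_op _ _).smul_right _

lemma commute_blockOp_pinOp {β 𝒳 : Type} [Fintype 𝒳] [Fintype β] {σ : β → Type}
    [∀ b, Fintype (σ b)] [Nonempty (Σ b, σ b)] (s : 𝒳 → (Σ b, σ b) → A) (a : A → κ → ℝ)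
    (δ : ℝ≥0) : Commute (blockOp s a δ) (pinOp s) :=
  Commute.sum_left _ _ _ fun _ _ => (commute_jointOp_pinOp _ _ _ _).smul_left _

/-- Joint measurements of all blocks leave at most slightly more uncertainty than separate
measurements of randomly chosen blocks. -/
lemma exists_jointOp_pow_entropy_le (A κ : Type) [Fintype A] [Fintype κ] [DecidableEq A]
    [MeasurableSpace A] [MeasurableSingletonClass A] (U : ℝ) {δ : ℝ≥0} (hδ : δ ≠ 0) {r : ℝ}
    (hr : 0 < r) :
    ∃ C : ℝ, 0 ≤ C ∧ ∀ {β 𝒳 : Type} [Fintype β] [Fintype 𝒳] {σ : β → Type} [∀ b, Fintype (σ b)]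
      [Nonempty (Σ b, σ b)] (s : 𝒳 → (Σ b, σ b) → A) (a : A → κ → ℝ), (∀ k b, |a k b| ≤ U) →
      ∀ (M N : ℕ) {w : 𝒳 → ℝ≥0}, ∑ x, w x = 1 →
      N * (((jointOp s a δ) ^ M) (Functional.entropy 𝒳) w -
        ((blockOp s a δ) ^ M) (Functional.entropy 𝒳) w) ≤
        M * (N * r + C) + N ^ 2 * Fintype.card A := by
  obtain ⟨C, hC, h⟩ := exists_jointOp_entropy_le A κ U hδ hr
  refine ⟨C * Fintype.card A, by positivity, ?_⟩
  intro β 𝒳 _ _ σ _ _ s a ha M N w hw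
  exact pow_sub_pow_le (isAveraging_jointOp s a δ) (isAveraging_blockOp s a δ)
    (isAveraging_pinOp s) (commute_jointOp_blockOp s a δ) (commute_jointOp_pinOp s s a δ)
    (commute_blockOp_pinOp s a δ) hC (by positivity) (h s a ha) (labelVariance_nonneg s)
    (labelVariance_le s) (pinOp_entropy_le s) (entropy_sub_pinOp_le s) M N hw

end

/-! ### Relabelling -/

lemma integral_rowLaw_comp_equiv {κ κ' : Type*} [Fintype κ] [Fintype κ'] (e : κ ≃ κ') (v : ℝ≥0)
    (f : (κ' → ℝ) → ℝ) :
    ∫ φ, f (fun i => φ (e.symm i)) ∂rowLaw κ v = ∫ φ, f φ ∂rowLaw κ' v := by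
  have h := measurePreserving_arrowCongr' (fun _ : κ => gaussianReal 0 v)
    (fun _ : κ' => gaussianReal 0 v) e (MeasurableEquiv.refl ℝ) fun _ => MeasurePreserving.id _
  exact h.integral_comp' f

lemma gaussChannel_op_comp_equiv {𝒳 𝒳' : Type*} [Fintype 𝒳] [Fintype 𝒳'] (e : 𝒳 ≃ 𝒳')
    (u : 𝒳' → ℝ) (δ : ℝ≥0) {F : Functional 𝒳} {F' : Functional 𝒳'}
    (h : ∀ w : 𝒳' → ℝ≥0, F (fun x => w (e x)) = F' w) (w : 𝒳' → ℝ≥0) :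
    (gaussChannel (fun x => u (e x)) δ).op F (fun x => w (e x)) = (gaussChannel u δ).op F' w := by
  rw [Channel.op_apply, Channel.op_apply]
  exact integral_congr_ae (.of_forall fun y => h ((gaussChannel u δ).update w y))

section Transport

variable {A κ : Type} [Fintype A] [Fintype κ]

lemma jointOp_comp_equiv {𝒳 𝒳' ι ι' : Type} [Fintype 𝒳] [Fintype 𝒳'] [Fintype ι] [Fintype ι']
    (e : 𝒳 ≃ 𝒳') (f : ι ≃ ι') (s' : 𝒳' → ι' → A) (a : A → κ → ℝ) (δ : ℝ≥0)
    {F : Functional 𝒳} {F' : Functional 𝒳'} (h : ∀ w : 𝒳' → ℝ≥0, F (fun x => w (e x)) = F' w)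
    (w : 𝒳' → ℝ≥0) :
    jointOp (fun x l => s' (e x) (f l)) a δ F (fun x => w (e x)) = jointOp s' a δ F' w := by
  rw [jointOp, jointOp, (rowChannel_op_apply _ _ δ _ _).2, (rowChannel_op_apply _ _ δ _ _).2,
    Fintype.card_congr f, ← integral_rowLaw_comp_equiv (f.prodCongr (Equiv.refl κ))]
  refine integral_congr_ae (.of_forall fun φ => ?_)
  simp only
  rw [← gaussChannel_op_comp_equiv e _ δ h]
  have : (fun x => ∑ i, φ i * sectionFeatures a (fun l => s' (e x) (f l)) i) = fun x =>
      ∑ i, φ ((f.prodCongr (Equiv.refl κ)).symm i) * sectionFeatures a (s' (e x)) i := by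
    funext x
    rw [← (f.prodCongr (Equiv.refl κ)).sum_comp]
    refine Finset.sum_congr rfl fun i _ => ?_
    rw [Equiv.symm_apply_apply]
    rfl
  rw [this]

/-- Blocks index sections by pairs, while `residualEntropy` uses consecutive integers; independent
identically distributed row entries make the choice of indexing immaterial. -/
lemma jointOp_pow_entropy_comp_equiv {𝒳 𝒳' ι ι' : Type} [Fintype 𝒳] [Fintype 𝒳'] [Fintype ι]
    [Fintype ι'] (e : 𝒳 ≃ 𝒳') (f : ι ≃ ι') (s' : 𝒳' → ι' → A) (a : A → κ → ℝ) (δ : ℝ≥0) (M : ℕ)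
    (w : 𝒳' → ℝ≥0) :
    ((jointOp (fun x l => s' (e x) (f l)) a δ) ^ M) (Functional.entropy 𝒳) (fun x => w (e x)) =
      ((jointOp s' a δ) ^ M) (Functional.entropy 𝒳') w := by
  induction M generalizing w with
  | zero =>
    simp only [pow_zero, Module.End.one_apply, Functional.entropy_apply, Functional.entropyFun_eq]
    rw [e.sum_comp fun x => (w x : ℝ), e.sum_comp fun x => (w x : ℝ) * Real.log (w x)]
  | succ M ih =>
    rw [pow_succ', pow_succ', Module.End.mul_apply, Module.End.mul_apply]
    exact jointOp_comp_equiv e f s' a δ ih w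

/-! ### The uncertainty left by joint measurements -/

/-- The law of independent sections. -/
def iidWeight (ι : Type) [Fintype ι] (p : A → ℝ≥0) (x : ι → A) : ℝ≥0 := ∏ l, p (x l)

lemma sum_iidWeight (ι : Type) [Fintype ι] [DecidableEq ι] {p : A → ℝ≥0} (hp : ∑ k, p k = 1) :
    ∑ x, iidWeight ι p x = 1 := by
  have := Finset.prod_univ_sum (fun _ : ι => (Finset.univ : Finset A)) fun _ k => p k
  simpa [hp, iidWeight] using this.symm

/-- The entropy of `n` independent sections that is left by `M` measurements. -/
def residualEntropy (p : A → ℝ≥0) (a : A → κ → ℝ) (δ : ℝ≥0) (n M : ℕ) : ℝ :=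
  ((jointOp (fun x : Fin n → A => x) a δ) ^ M) (Functional.entropy _) (iidWeight (Fin n) p)

variable {p : A → ℝ≥0} {a : A → κ → ℝ} {U : ℝ}

lemma residualEntropy_nonneg (p : A → ℝ≥0) (a : A → κ → ℝ) (δ : ℝ≥0) (n M : ℕ) :
    0 ≤ residualEntropy p a δ n M :=
  ((isAveraging_jointOp _ a δ).pow M).nonneg _ Functional.entropy_nonneg _

/-- The tangent at `E = 0` bounds the information by half the signal-to-noise ratio. Normalising the
row by the number of sections makes this bound independent of that number. -/
lemma entropy_sub_jointOp_le {𝒳 ι : Type} [Fintype 𝒳] [Fintype ι] (s : 𝒳 → ι → A)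
    (ha : ∀ k b, |a k b| ≤ U) (δ : ℝ≥0) :
    Functional.entropy 𝒳 - jointOp s a δ (Functional.entropy 𝒳) ≤
      (δ / 2 * (Fintype.card κ * U ^ 2)) • Functional.mass 𝒳 := by
  have h := entropy_sub_rowChannel_le (fun x => sectionFeatures a (s x))
    ((Fintype.card ι : ℝ≥0)⁻¹) δ le_rfl
  refine h.trans fun w => ?_
  have h1 : totalVariance (fun x => sectionFeatures a (s x)) w ≤
      (Fintype.card ι * (Fintype.card κ * U ^ 2)) * Functional.mass 𝒳 w :=
    totalVariance_sectionFeatures_le s ha w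
  have hm : 0 ≤ Functional.mass 𝒳 w := Functional.mass_nonneg w
  show _ * Functional.mass 𝒳 w + _ * totalVariance (fun x => sectionFeatures a (s x)) w ≤
    _ * Functional.mass 𝒳 w
  simp only [mul_zero, add_zero, Real.log_one, zero_div, sub_zero, zero_mul, zero_add, div_one]
  by_cases h0 : Fintype.card ι = 0
  · simp only [h0, Nat.cast_zero, inv_zero, NNReal.coe_zero, mul_zero, zero_mul]
    positivity
  · have : (Fintype.card ι : ℝ) ≠ 0 := by exact_mod_cast h0
    calc _ ≤ _ := mul_le_mul_of_nonneg_left h1 (by positivity)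
      _ = _ := by push_cast; field_simp

lemma residualEntropy_anti (p : A → ℝ≥0) (a : A → κ → ℝ) (δ : ℝ≥0) (n : ℕ) :
    Antitone (residualEntropy p a δ n) := by
  refine antitone_nat_of_succ_le fun M => ?_
  rw [residualEntropy, residualEntropy, pow_succ, Module.End.mul_apply]
  exact ((isAveraging_jointOp _ a δ).pow M).mono (jointOp_entropy_le _ a δ) _

lemma residualEntropy_le_add (hp : ∑ k, p k = 1) (ha : ∀ k b, |a k b| ≤ U) (δ : ℝ≥0)
    (n M k : ℕ) : residualEntropy p a δ n M ≤ residualEntropy p a δ n (M + k) +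
      k * (δ / 2 * (Fintype.card κ * U ^ 2)) := by
  have h := (isAveraging_jointOp (fun x : Fin n → A => x) a δ).le_pow_add
    (entropy_sub_jointOp_le (fun x : Fin n → A => x) ha δ) k
  have h1 := ((isAveraging_jointOp (fun x : Fin n → A => x) a δ).pow M).mono h (iidWeight _ p)
  rw [map_add, ((isAveraging_jointOp _ a δ).pow M).map_smul_mass, ← Module.End.mul_apply,
    ← pow_add] at h1
  refine h1.trans (le_of_eq ?_)
  show residualEntropy p a δ n (M + k) + _ * Functional.mass _ (iidWeight _ p) = _
  rw [Functional.mass_apply, coe_sum_eq_one (sum_iidWeight _ hp), mul_one]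

/-- Each row takes away a nonnegative amount bounded uniformly in `n`. Two sequences with the same
rate hence have the same limit per section. -/
lemma abs_residualEntropy_sub_le (hp : ∑ k, p k = 1) (ha : ∀ k b, |a k b| ≤ U) (δ : ℝ≥0)
    (n M M' : ℕ) : |residualEntropy p a δ n M - residualEntropy p a δ n M'| ≤
      (δ / 2 * (Fintype.card κ * U ^ 2)) * |(M : ℝ) - M'| := by
  wlog h : M ≤ M' generalizing M M'
  · rw [abs_sub_comm, abs_sub_comm (M : ℝ)]
    exact this M' M (le_of_not_ge h)
  obtain ⟨k, rfl⟩ := Nat.exists_eq_add_of_le h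
  have h1 := residualEntropy_le_add hp ha δ n M k
  have h2 := residualEntropy_anti p a δ n h
  rw [abs_of_nonneg (by linarith), abs_sub_comm, abs_of_nonneg (by push_cast; linarith)]
  push_cast
  linarith

lemma residualEntropy_le (hp : ∑ k, p k = 1) (a : A → κ → ℝ) (δ : ℝ≥0) (n M : ℕ) :
    residualEntropy p a δ n M ≤ n * Functional.entropyFun p := by
  refine (residualEntropy_anti p a δ n (Nat.zero_le M)).trans (le_of_eq ?_)
  have := (decomposes_entropy (β := Fin n) (𝒳 := fun _ => A)).apply_prob (w := fun _ => p)
    fun _ => hp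
  simp only [Finset.sum_const, Finset.card_univ, Fintype.card_fin, nsmul_eq_mul] at this
  exact this

/-- The entropy of `n` sections left by a binomial number of measurements. -/
def lazyResidualEntropy (p : A → ℝ≥0) (a : A → κ → ℝ) (δ : ℝ≥0) (n : ℕ) (π : ℝ) (M : ℕ) : ℝ :=
  ((π • jointOp (fun x : Fin n → A => x) a δ + (1 - π) • 1) ^ M) (Functional.entropy _)
    (iidWeight (Fin n) p)

lemma lazyResidualEntropy_le (hp : ∑ k, p k = 1) (ha : ∀ k b, |a k b| ≤ U) (δ : ℝ≥0)
    (n : ℕ) {π : ℝ} (h0 : 0 ≤ π) (h1 : π ≤ 1) {s : ℝ} (hs : 0 < s) (M m : ℕ) :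
    lazyResidualEntropy p a δ n π M ≤ residualEntropy p a δ n m +
      (δ / 2 * (Fintype.card κ * U ^ 2)) *
        (s / 2 + ((M * π - m) ^ 2 + M * (π * (1 - π))) / (2 * s)) :=
  lazy_pow_apply_le (isAveraging_jointOp _ a δ) (jointOp_entropy_le _ a δ)
    (entropy_sub_jointOp_le _ ha δ) (sum_iidWeight _ hp) h0 h1 hs M m

lemma lazyResidualEntropy_le_entropy (hp : ∑ k, p k = 1) (a : A → κ → ℝ) (δ : ℝ≥0)
    (n : ℕ) {π : ℝ} (h0 : 0 ≤ π) (h1 : π ≤ 1) (M : ℕ) :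
    lazyResidualEntropy p a δ n π M ≤ n * Functional.entropyFun p := by
  have hT : IsAveraging (π • jointOp (fun x : Fin n → A => x) a δ + (1 - π) • 1) := by
    have := IsAveraging.convex (ι := Bool) (c := fun b => if b then π else 1 - π)
      (T := fun b => if b then jointOp (fun x : Fin n → A => x) a δ else 1)
      (by rintro (_ | _) <;> simp [h0, h1]) (by simp)
      (by rintro (_ | _) <;> simp [isAveraging_jointOp, IsAveraging.one])
    simpa using this
  refine (hT.pow_le (H := Functional.entropy _) ?_ M _).trans
    (le_of_eq_of_le ?_ (residualEntropy_le hp a δ n 0))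
  · have h := Functional.smul_le_smul (jointOp_entropy_le (fun x : Fin n → A => x) a δ) h0
    rw [LinearMap.add_apply, LinearMap.smul_apply, LinearMap.smul_apply, Module.End.one_apply]
    calc _ ≤ π • Functional.entropy (Fin n → A) + (1 - π) • Functional.entropy (Fin n → A) := by
          gcongr
      _ = _ := by module
  · simp [residualEntropy]

variable [DecidableEq A] [MeasurableSpace A] [MeasurableSingletonClass A]

/-- The sections can be measured in separate blocks with little loss. -/
lemma exists_residualEntropy_le (A κ : Type) [Fintype A] [Fintype κ] [DecidableEq A]
    [MeasurableSpace A] [MeasurableSingletonClass A] (U : ℝ) {δ : ℝ≥0} (hδ : δ ≠ 0) {r : ℝ}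
    (hr : 0 < r) :
    ∃ C : ℝ, 0 ≤ C ∧ ∀ {β : Type} [Fintype β] [DecidableEq β] (size : β → ℕ) {p : A → ℝ≥0}
      {a : A → κ → ℝ}, ∑ b, size b ≠ 0 → ∑ k, p k = 1 → (∀ k b, |a k b| ≤ U) → ∀ M N : ℕ,
      N * (residualEntropy p a δ (∑ b, size b) M -
        ∑ b, lazyResidualEntropy p a δ (size b) ((size b : ℝ) / ((∑ b, size b : ℕ) : ℝ)) M) ≤
        M * (N * r + C) + N ^ 2 * Fintype.card A := by
  obtain ⟨C, hC, h⟩ := exists_jointOp_pow_entropy_le A κ U hδ hr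
  refine ⟨C, hC, ?_⟩
  intro β _ _ size p a hsize hp ha M N
  have hcard : Fintype.card (Σ b, Fin (size b)) = ∑ b, size b := by simp
  have : Nonempty (Σ b, Fin (size b)) := by
    rw [← Fintype.card_pos_iff, hcard]
    exact Nat.pos_of_ne_zero hsize
  let s : (∀ b, Fin (size b) → A) → (Σ b, Fin (size b)) → A := fun x i => x i.1 i.2
  have hw : ∑ x, prodWeight (fun b => iidWeight (Fin (size b)) p) x = 1 := by
    have := Finset.prod_univ_sum (fun b : β => (Finset.univ : Finset (Fin (size b) → A)))
      fun b x => iidWeight (Fin (size b)) p x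
    rw [Fintype.piFinset_univ] at this
    rw [← Finset.prod_const_one, ← Finset.prod_congr rfl fun b _ => sum_iidWeight (Fin (size b)) hp]
    exact this.symm
  have h1 := h s a ha M N hw
  have h2 : ((jointOp s a δ) ^ M) (Functional.entropy _)
      (prodWeight fun b => iidWeight (Fin (size b)) p) =
      residualEntropy p a δ (∑ b, size b) M := by
    let f : (Σ b, Fin (size b)) ≃ Fin (∑ b, size b) := Fintype.equivFinOfCardEq hcard
    let e : (∀ b, Fin (size b) → A) ≃ (Fin (∑ b, size b) → A) :=
      (Equiv.piCurry fun _ _ => A).symm.trans (Equiv.arrowCongr f (Equiv.refl A))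
    have h3 := jointOp_pow_entropy_comp_equiv e f (fun x => x) a δ M (iidWeight _ p)
    have hs : ∀ x i, e x (f i) = s x i := by
      intro x i
      show s x (f.symm (f i)) = s x i
      rw [f.symm_apply_apply]
    have hw' : (fun x => iidWeight _ p (e x)) =
        prodWeight fun b => iidWeight (Fin (size b)) p := by
      funext x
      simp only [prodWeight, iidWeight]
      rw [← f.prod_comp, Fintype.prod_sigma]
      simp only [hs, s]
    rw [show (fun x l => e x (f l)) = s from funext fun x => funext fun i => hs x i, hw'] at h3
    exact h3
  have h4 : ((blockOp s a δ) ^ M) (Functional.entropy _)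
      (prodWeight fun b => iidWeight (Fin (size b)) p) =
      ∑ b, lazyResidualEntropy p a δ (size b) ((size b : ℝ) / ((∑ b, size b : ℕ) : ℝ)) M := by
    -- Block measurements preserve additivity over the independent blocks, and each block sees its
    -- own channel with probability equal to its share of the sections.
    have h5 := (Decomposes.average_pow (decomposes_entropy (𝒳 := fun b => Fin (size b) → A))
      (fun b => rowChannel (sectionFeatures a) ((Fintype.card (Fin (size b)) : ℝ≥0)⁻¹) δ)
      (sum_blockWeight β fun b => Fin (size b)) M).apply_prob
      (w := fun b => iidWeight (Fin (size b)) p) fun b => sum_iidWeight _ hp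
    rw [hcard] at h5
    simp only [Fintype.card_fin] at h5
    simp only [blockOp, jointOp, lazyResidualEntropy, hcard, Fintype.card_fin]
    exact h5
  rw [h2, h4] at h1
  exact h1

end Transport

/-! ### The limit of the uncertainty per section -/

/-- A bounded sequence that is eventually not much larger than any of its late terms converges. -/
lemma exists_tendsto_of_eventually_le {y : ℕ → ℝ} {b : ℝ} (h0 : ∀ n, 0 ≤ y n) (hb : ∀ n, y n ≤ b)
    {e : ℕ → ℝ} (he : Tendsto e atTop (𝓝 0))
    (h : ∀ᶠ n in atTop, ∀ ε > 0, ∀ᶠ L in atTop, y L ≤ y n + e n + ε) :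
    ∃ l, Tendsto y atTop (𝓝 l) := by
  have hbdd : IsBoundedUnder (· ≤ ·) atTop y := isBoundedUnder_of ⟨b, hb⟩
  have hbdd' : IsBoundedUnder (· ≥ ·) atTop y := isBoundedUnder_of ⟨0, h0⟩
  refine ⟨liminf y atTop, tendsto_of_le_liminf_of_limsup_le le_rfl ?_ hbdd hbdd'⟩
  refine le_of_forall_pos_le_add fun ε hε => ?_
  -- Pick `n` with `y n` close to the lower limit and `e n` small; the hypothesis at this `n` then
  -- bounds the upper limit.
  have h1 : ∃ᶠ n in atTop, y n < liminf y atTop + ε / 3 :=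
    frequently_lt_of_liminf_lt hbdd.isCoboundedUnder_ge (by linarith)
  have h2 : ∀ᶠ n in atTop, e n < ε / 3 := he.eventually (gt_mem_nhds (by positivity))
  obtain ⟨n, hn1, hn2, hn3⟩ := (h1.and_eventually (h2.and h)).exists
  refine limsup_le_of_le hbdd'.isCoboundedUnder_le ?_
  filter_upwards [hn3 (ε / 3) (by positivity)] with L hL
  linarith

section Limit

variable {A κ : Type} [Fintype A] [Fintype κ] [DecidableEq A] [MeasurableSpace A]
  [MeasurableSingletonClass A] {p : A → ℝ≥0} {a : A → κ → ℝ} {U : ℝ} {δ : ℝ≥0}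

/-- A full block of size `n` receives a binomial number of rows with mean `(M / L) n`, compared with
a free target `m`. The remainder block is charged its whole entropy, which is `O(1 / L)` per
section. -/
lemma exists_residualEntropy_div_le (hp : ∑ k, p k = 1) (ha : ∀ k b, |a k b| ≤ U) (hδ : δ ≠ 0)
    {r : ℝ} (hr : 0 < r) :
    ∃ C : ℝ, 0 ≤ C ∧ ∀ {n L N : ℕ}, n ≠ 0 → L ≠ 0 → N ≠ 0 → ∀ {s : ℝ}, 0 < s → ∀ M m : ℕ,
      residualEntropy p a δ L M / L ≤
        (residualEntropy p a δ n m + (δ / 2 * (Fintype.card κ * U ^ 2)) *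
          (s / 2 + (((M / L : ℝ) * n - m) ^ 2 + (M / L : ℝ) * n) / (2 * s))) / n +
        n * Functional.entropyFun p * (1 / L : ℝ) + (M / L : ℝ) * (r + C / N) +
        N * Fintype.card A * (1 / L : ℝ) := by
  obtain ⟨C, hC, h⟩ := exists_residualEntropy_le A κ U hδ hr
  refine ⟨C, hC, ?_⟩
  intro n L N hn hL hN s hs M m
  -- `some` indexes the `L / n` full blocks and `none` the remainder, which may be empty.
  set size : Option (Fin (L / n)) → ℕ := fun b => b.elim (L % n) fun _ => n with hsize
  have hsum : ∑ b, size b = L := by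
    rw [Fintype.sum_option]
    simp only [hsize, Option.elim_none, Option.elim_some, Finset.sum_const, Finset.card_univ,
      Fintype.card_fin, smul_eq_mul]
    rw [mul_comm]
    exact Nat.mod_add_div L n
  have h1 := h size (by rwa [hsum]) hp ha M N
  rw [hsum, Fintype.sum_option] at h1
  simp only [hsize, Option.elim_none, Option.elim_some] at h1
  have hn' : (0 : ℝ) < n := by exact_mod_cast Nat.pos_of_ne_zero hn
  have hL' : (0 : ℝ) < L := by exact_mod_cast Nat.pos_of_ne_zero hL
  have hN' : (0 : ℝ) < N := by exact_mod_cast Nat.pos_of_ne_zero hN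
  have hH : 0 ≤ Functional.entropyFun p := Functional.entropyFun_nonneg p
  have hmod : ((L % n : ℕ) : ℝ) ≤ L := by exact_mod_cast Nat.mod_le L n
  have hmod' : ((L % n : ℕ) : ℝ) ≤ n := by
    exact_mod_cast (Nat.mod_lt L (Nat.pos_of_ne_zero hn)).le
  have h2 : lazyResidualEntropy p a δ (L % n) (((L % n : ℕ) : ℝ) / L) M ≤
      n * Functional.entropyFun p :=
    (lazyResidualEntropy_le_entropy hp a δ _ (by positivity) ((div_le_one hL').2 hmod) M).trans
      (mul_le_mul_of_nonneg_right hmod' hH)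
  set D := residualEntropy p a δ n m + (δ / 2 * (Fintype.card κ * U ^ 2)) *
    (s / 2 + (((M / L : ℝ) * n - m) ^ 2 + (M / L : ℝ) * n) / (2 * s)) with hD
  have hD0 : 0 ≤ D := by
    have := residualEntropy_nonneg p a δ n m
    positivity
  have h3 : ∑ _b : Fin (L / n), lazyResidualEntropy p a δ n ((n : ℝ) / L) M ≤ L / n * D := by
    have h4 : ∀ b : Fin (L / n), lazyResidualEntropy p a δ n ((n : ℝ) / L) M ≤ D := by
      intro b
      -- The index `b` witnesses that a full block exists; for `L < n` there are none. Thus `n / L`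
      -- is a legitimate probability.
      have hnL : n ≤ L := by
        by_contra hlt
        have := Nat.div_eq_of_lt (not_le.1 hlt)
        have := b.2
        omega
      have hπ : (n : ℝ) / L ≤ 1 := (div_le_one hL').2 (by exact_mod_cast hnL)
      refine (lazyResidualEntropy_le hp ha δ n (by positivity) hπ hs M m).trans ?_
      rw [hD]
      gcongr ?_ + _ * (_ + (?_ + ?_) / _)
      · exact le_rfl
      · exact le_of_eq (by ring)
      · have : (0 : ℝ) ≤ n / L := by positivity
        calc (M : ℝ) * (n / L * (1 - n / L)) ≤ M * (n / L * 1) := by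
              gcongr
              linarith
          _ = _ := by ring
    refine (Finset.sum_le_sum fun b _ => h4 b).trans ?_
    rw [Finset.sum_const, Finset.card_univ, Fintype.card_fin, nsmul_eq_mul]
    exact mul_le_mul_of_nonneg_right Nat.cast_div_le hD0
  set R := residualEntropy p a δ L M
  have h5 : R ≤ L / n * D + n * Functional.entropyFun p + M * (r + C / N) +
      N * Fintype.card A := by
    have h6 : R - (lazyResidualEntropy p a δ (L % n) (((L % n : ℕ) : ℝ) / L) M +
        ∑ _b : Fin (L / n), lazyResidualEntropy p a δ n ((n : ℝ) / L) M) ≤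
        M * (r + C / N) + N * Fintype.card A := by
      rw [← mul_le_mul_iff_right₀ hN']
      refine h1.trans (le_of_eq ?_)
      field_simp
    linarith
  calc R / L ≤ _ := div_le_div_of_nonneg_right h5 hL'.le
    _ = _ := by field_simp

/-- As `L → ∞` with `n` fixed, the boundary and pinning terms vanish. The choice `s = √n` balances
`s / 2` against the binomial variance over `2 s`, so the number of rows per block costs `O(1 / √n)`
per section. -/
lemma eventually_residualEntropy_div_le (hp : ∑ k, p k = 1) (ha : ∀ k b, |a k b| ≤ U)
    (hδ : δ ≠ 0) {γ : ℝ} (hγ : 0 ≤ γ) {M : ℕ → ℕ}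
    (hM : Tendsto (fun L : ℕ => (M L : ℝ) / L) atTop (𝓝 γ)) {n : ℕ} (hn : n ≠ 0) {ε : ℝ}
    (hε : 0 < ε) :
    ∀ᶠ L in atTop, residualEntropy p a δ L (M L) / L ≤
      residualEntropy p a δ n ⌊γ * n⌋₊ / n +
        (δ / 2 * (Fintype.card κ * U ^ 2)) * (1 + γ / 2) * (1 / √n) + ε := by
  have hn' : (0 : ℝ) < n := by exact_mod_cast Nat.pos_of_ne_zero hn
  have hn1 : (1 : ℝ) ≤ n := by exact_mod_cast Nat.pos_of_ne_zero hn
  obtain ⟨C, hC, h⟩ := exists_residualEntropy_div_le hp ha hδ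
    (r := ε / (4 * (γ + 1))) (by positivity)
  -- Together with the choice of `r`, this keeps each of the two error terms multiplied by `γ` at
  -- most `ε / 4`.
  obtain ⟨N, hN⟩ := exists_nat_gt (4 * (γ + 1) * C / ε)
  have hN0 : N ≠ 0 := by
    rintro rfl
    have : 0 ≤ 4 * (γ + 1) * C / ε := by positivity
    simp at hN
    linarith
  have hN' : (0 : ℝ) < N := by exact_mod_cast Nat.pos_of_ne_zero hN0
  set c : ℝ := δ / 2 * (Fintype.card κ * U ^ 2) with hc
  set m := ⌊γ * n⌋₊
  have hlim : Tendsto (fun L : ℕ => (residualEntropy p a δ n m + c *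
      (√n / 2 + (((M L / L : ℝ) * n - m) ^ 2 + (M L / L : ℝ) * n) / (2 * √n))) / n +
      n * Functional.entropyFun p * (1 / L : ℝ) + (M L / L : ℝ) * (ε / (4 * (γ + 1)) + C / N) +
      N * Fintype.card A * (1 / L : ℝ)) atTop
      (𝓝 ((residualEntropy p a δ n m + c *
      (√n / 2 + ((γ * n - m) ^ 2 + γ * n) / (2 * √n))) / n +
      n * Functional.entropyFun p * 0 + γ * (ε / (4 * (γ + 1)) + C / N) +
      N * Fintype.card A * 0)) := by
    have hi : Tendsto (fun L : ℕ => (1 / L : ℝ)) atTop (𝓝 0) := tendsto_one_div_atTop_nhds_zero_nat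
    have h1 : Tendsto (fun L : ℕ => (((M L / L : ℝ) * n - m) ^ 2 + (M L / L : ℝ) * n)) atTop
        (𝓝 ((γ * n - m) ^ 2 + γ * n)) :=
      (((hM.mul_const _).sub_const _).pow 2).add (hM.mul_const _)
    exact (((((((h1.div_const _).const_add _).const_mul _).const_add _).div_const _).add
      (hi.const_mul _)).add (hM.mul_const _)).add (hi.const_mul _)
  have hlt : (residualEntropy p a δ n m + c *
      (√n / 2 + ((γ * n - m) ^ 2 + γ * n) / (2 * √n))) / n +
      n * Functional.entropyFun p * 0 + γ * (ε / (4 * (γ + 1)) + C / N) +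
      N * Fintype.card A * 0 < residualEntropy p a δ n m / n + c * (1 + γ / 2) * (1 / √n) + ε := by
    have h1 : γ * (ε / (4 * (γ + 1)) + C / N) < ε := by
      have i1 : γ * (ε / (4 * (γ + 1))) ≤ ε / 4 := by
        rw [← mul_div_assoc, div_le_div_iff₀ (by positivity) (by positivity)]
        nlinarith
      have i2 : γ * (C / N) ≤ ε / 4 := by
        rw [← mul_div_assoc, div_le_div_iff₀ hN' (by positivity)]
        rw [div_lt_iff₀ hε] at hN
        nlinarith
      linarith
    have h2 : c * (√n / 2 + ((γ * n - m) ^ 2 + γ * n) / (2 * √n)) / n ≤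
        c * (1 + γ / 2) * (1 / √n) := by
      have hsq : √(n : ℝ) * √n = n := Real.mul_self_sqrt hn'.le
      have hs0 : 0 < √(n : ℝ) := Real.sqrt_pos.2 hn'
      have hm1 : (m : ℝ) ≤ γ * n := Nat.floor_le (by positivity)
      have hm2 : γ * n < m + 1 := Nat.lt_floor_add_one _
      -- The rounding error lies in `[0, 1)`, and `1 ≤ n`.
      have h3 : (γ * n - m) ^ 2 ≤ n := by nlinarith
      have h4 : √n / 2 + ((γ * n - m) ^ 2 + γ * n) / (2 * √n) ≤ (1 + γ / 2) * √n := by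
        calc √n / 2 + ((γ * n - m) ^ 2 + γ * n) / (2 * √n) ≤
            √n / 2 + (n + γ * n) / (2 * √n) := by gcongr
          _ = √n / 2 + (√n * √n + γ * (√n * √n)) / (2 * √n) := by rw [hsq]
          _ = _ := by field_simp; ring
      have h5 : 0 ≤ c := by rw [hc]; positivity
      calc _ ≤ c * ((1 + γ / 2) * √n) / n := by gcongr
        _ = c * ((1 + γ / 2) * √n) / (√n * √n) := by rw [hsq]
        _ = _ := by field_simp
    rw [add_div]
    linarith
  filter_upwards [hlim.eventually (gt_mem_nhds hlt), eventually_ne_atTop 0] with L h1 h2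
  exact (h hn h2 hN0 (Real.sqrt_pos.2 hn') (M L) m).trans h1.le

/-- The uncertainty per section left by joint measurements converges. -/
lemma exists_tendsto_residualEntropy_div (hp : ∑ k, p k = 1) (ha : ∀ k b, |a k b| ≤ U)
    (hδ : δ ≠ 0) {γ : ℝ} (hγ : 0 ≤ γ) :
    ∃ l, ∀ M : ℕ → ℕ, Tendsto (fun L : ℕ => (M L : ℝ) / L) atTop (𝓝 γ) →
      Tendsto (fun L : ℕ => residualEntropy p a δ L (M L) / L) atTop (𝓝 l) := by
  have hfloor : Tendsto (fun L : ℕ => (⌊γ * L⌋₊ : ℝ) / L) atTop (𝓝 γ) :=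
    (tendsto_nat_floor_mul_div_atTop hγ).comp tendsto_natCast_atTop_atTop
  set c : ℝ := δ / 2 * (Fintype.card κ * U ^ 2) with hc
  have hsqrt : Tendsto (fun n : ℕ => c * (1 + γ / 2) * (1 / √(n : ℝ))) atTop (𝓝 0) := by
    have h1 : Tendsto (fun n : ℕ => √(n : ℝ)) atTop atTop :=
      Real.tendsto_sqrt_atTop.comp tendsto_natCast_atTop_atTop
    have h2 := (h1.inv_tendsto_atTop).const_mul (c * (1 + γ / 2))
    simpa using h2
  obtain ⟨l, hl⟩ := exists_tendsto_of_eventually_le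
    (y := fun L : ℕ => residualEntropy p a δ L ⌊γ * L⌋₊ / L) (b := Functional.entropyFun p)
    (fun n => div_nonneg (residualEntropy_nonneg p a δ _ _) (Nat.cast_nonneg _))
    (fun n => by
      by_cases hn : n = 0
      · subst hn
        simpa using Functional.entropyFun_nonneg p
      · have hn' : (0 : ℝ) < n := by exact_mod_cast Nat.pos_of_ne_zero hn
        rw [div_le_iff₀ hn', mul_comm (Functional.entropyFun p)]
        exact residualEntropy_le hp a δ _ _) hsqrt
    (by
      filter_upwards [eventually_ne_atTop 0] with n hn ε hε
      exact eventually_residualEntropy_div_le hp ha hδ hγ hfloor hn hε)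
  refine ⟨l, fun M hM => ?_⟩
  -- The Lipschitz estimate in the number of rows carries the limit along the floor sequence over to
  -- any sequence of the same rate.
  have h1 : Tendsto (fun L : ℕ => c * |(M L : ℝ) / L - (⌊γ * L⌋₊ : ℝ) / L|) atTop (𝓝 0) := by
    simpa using ((hM.sub hfloor).abs).const_mul c
  have h2 : Tendsto (fun L : ℕ => residualEntropy p a δ L (M L) / L -
      residualEntropy p a δ L ⌊γ * L⌋₊ / L) atTop (𝓝 0) := by
    refine squeeze_zero_norm (fun L => ?_) h1
    rw [Real.norm_eq_abs, ← sub_div, ← sub_div, abs_div, abs_div, Nat.abs_cast, ← mul_div_assoc]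
    exact div_le_div_of_nonneg_right (abs_residualEntropy_sub_le hp ha δ L _ _) (Nat.cast_nonneg _)
  simpa using h2.add hl

end Limit

/-! ### The replica symmetric bound -/

lemma le_list_prod_add {𝒳 : Type*} [Fintype 𝒳] {l : List (Module.End ℝ (Functional 𝒳))}
    {F : Functional 𝒳} {c : ℝ}
    (h : ∀ T ∈ l, IsAveraging T ∧ F - T F ≤ c • Functional.mass 𝒳) :
    F ≤ l.prod F + (l.length * c) • Functional.mass 𝒳 := by
  induction l with
  | nil => simp
  | cons T l ih =>
    have hT := h T (by simp)
    have h1 := hT.1.mono (ih fun S hS => h S (by simp [hS]))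
    rw [map_add, hT.1.map_smul_mass] at h1
    rw [List.prod_cons, Module.End.mul_apply, List.length_cons]
    calc F ≤ c • Functional.mass 𝒳 + T F := sub_le_iff_le_add.1 hT.2
      _ ≤ c • Functional.mass 𝒳 + (T (l.prod F) + (l.length * c) • Functional.mass 𝒳) := by gcongr
      _ = _ := by push_cast; module

section Scalar

variable {A κ : Type} [Fintype A] [Fintype κ] {p : A → ℝ≥0} {a : A → κ → ℝ} {U : ℝ}

lemma entropy_sub_sideOp_le (ha : ∀ k b, |a k b| ≤ U) (l : ℝ≥0) :
    Functional.entropy A ≤ sideOp a l (Functional.entropy A) +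
      (Fintype.card κ * (l / 2 * U ^ 2)) • Functional.mass A := by
  have h := le_list_prod_add (F := Functional.entropy A) (c := l / 2 * U ^ 2)
    (l := (Finset.univ : Finset κ).toList.map fun i => (gaussChannel (fun x => a x i) l).op) ?_
  · simpa [sideOp] using h
  · intro T hT
    obtain ⟨i, -, rfl⟩ := List.mem_map.1 hT
    refine ⟨Channel.isAveraging_op _, ?_⟩
    have h1 := entropy_sub_gaussChannel_le (fun x => a x i) l le_rfl
    have h2 := Functional.variance_le_mass (f := fun x => a x i) (c := U ^ 2) fun x => by
      rw [← sq_abs]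
      exact pow_le_pow_left₀ (abs_nonneg _) (ha _ _) 2
    have h3 := Functional.smul_le_smul h2 (show (0 : ℝ) ≤ l / 2 by positivity)
    simp only [mul_zero, add_zero, Real.log_one, zero_div, sub_zero, zero_smul, zero_add,
      div_one] at h1
    rw [mul_smul]
    exact h1.trans h3

/-- The entropy of a section left by an observation of all its features under Gaussian noise of
precision `l`. -/
def scalarResidualEntropy (p : A → ℝ≥0) (a : A → κ → ℝ) (l : ℝ≥0) : ℝ :=
  sideOp a l (Functional.entropy A) p

lemma scalarResidualEntropy_add_le (p : A → ℝ≥0) (a : A → κ → ℝ) (l d : ℝ≥0) :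
    scalarResidualEntropy p a (l + d) ≤ scalarResidualEntropy p a l := by
  rw [scalarResidualEntropy, ← sideOp_mul, Module.End.mul_apply]
  exact (isAveraging_sideOp a l).mono (sideOp_entropy_le a d) p

lemma scalarResidualEntropy_le_add (hp : ∑ k, p k = 1) (ha : ∀ k b, |a k b| ≤ U) (l d : ℝ≥0) :
    scalarResidualEntropy p a l ≤ scalarResidualEntropy p a (l + d) +
      Fintype.card κ * (d / 2 * U ^ 2) := by
  have h := (isAveraging_sideOp a l).mono (entropy_sub_sideOp_le ha d)
  rw [map_add, (isAveraging_sideOp a l).map_smul_mass, ← Module.End.mul_apply, sideOp_mul] at h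
  refine (h p).trans (le_of_eq ?_)
  show scalarResidualEntropy p a (l + d) + _ * Functional.mass A p = _
  rw [Functional.mass_apply, coe_sum_eq_one hp, mul_one]

/-- Precisions add, so an increment `d` of precision is one more observation, which reveals between
zero and a constant times `d`. -/
lemma continuous_scalarResidualEntropy (hp : ∑ k, p k = 1) (ha : ∀ k b, |a k b| ≤ U) :
    Continuous (scalarResidualEntropy p a) := by
  refine (LipschitzWith.of_dist_le_mul (K := Real.toNNReal (Fintype.card κ * (U ^ 2 / 2)))
    fun l l' => ?_).continuous
  rw [Real.coe_toNNReal _ (by positivity)]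
  wlog h : l ≤ l' generalizing l l'
  · rw [dist_comm, dist_comm l]
    exact this l' l (le_of_not_ge h)
  obtain ⟨d, rfl⟩ := exists_add_of_le h
  have h1 := scalarResidualEntropy_add_le p a l d
  have h2 := scalarResidualEntropy_le_add hp ha l d
  rw [Real.dist_eq, abs_of_nonneg (by linarith), NNReal.dist_eq, NNReal.coe_add, sub_add_cancel_left,
    abs_neg, NNReal.abs_eq]
  linarith

/-- The side observation treats sections separately and repeated uses add their precisions. On
independent sections it leaves `L` copies of a single denoising problem. -/
lemma sideOp_sectionFeatures_pow_apply (hp : ∑ k, p k = 1) (a : A → κ → ℝ) (L n : ℕ) (ε : ℝ≥0) :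
    ((sideOp (sectionFeatures a : (Fin L → A) → Fin L × κ → ℝ) ε) ^ n) (Functional.entropy _)
      (iidWeight (Fin L) p) = L * scalarResidualEntropy p a (n * ε) := by
  have := ((decomposes_entropy (β := Fin L) (𝒳 := fun _ => A)).sideOp a (n * ε)).apply_prob
    (w := fun _ => p) fun _ => hp
  simp only [Finset.sum_const, Finset.card_univ, Fintype.card_fin, nsmul_eq_mul] at this
  rw [sideOp_pow]
  exact this

/-- The interpolation bound with row variance `1 / L`, divided by `L`. The `M + N` side uses give
each section the precision `(M + N) / L` times `δ / (1 + δ E)`, and the boundary term of the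
telescoping is of order `1 / N`. -/
lemma le_residualEntropy_div (hp : ∑ k, p k = 1) (ha : ∀ k b, |a k b| ≤ U) (δ E : ℝ≥0)
    {L N : ℕ} (hL : L ≠ 0) (hN : N ≠ 0) (M : ℕ) :
    scalarResidualEntropy p a (((M / L : ℝ≥0) + N * (1 / L : ℝ≥0)) * (δ / (1 + δ * E))) -
      (M / L : ℝ) * (Real.log (1 + δ * E) / 2 - δ * E / (1 + δ * E) / 2) -
      (M / L : ℝ) * ((δ / (1 + δ * E) / 2 * (Fintype.card κ * U ^ 2)) / N) ≤
      residualEntropy p a δ L M / L := by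
  have hL' : (0 : ℝ) < L := by exact_mod_cast Nat.pos_of_ne_zero hL
  have hN' : (0 : ℝ) < N := by exact_mod_cast Nat.pos_of_ne_zero hN
  set v : ℝ≥0 := ((Fintype.card (Fin L) : ℝ≥0)⁻¹) with hv
  have hv' : (v : ℝ) = (L : ℝ)⁻¹ := by simp [hv]
  have hβ : v • totalVariance (sectionFeatures a : (Fin L → A) → Fin L × κ → ℝ) ≤
      (Fintype.card κ * U ^ 2 : ℝ) • Functional.mass (Fin L → A) := by
    intro w
    have h1 : totalVariance (sectionFeatures a : (Fin L → A) → Fin L × κ → ℝ) w ≤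
        (Fintype.card (Fin L) * (Fintype.card κ * U ^ 2)) * Functional.mass _ w :=
      totalVariance_sectionFeatures_le (fun x : Fin L → A => x) ha w
    rw [Fintype.card_fin] at h1
    show (v : ℝ) * totalVariance (sectionFeatures a : (Fin L → A) → Fin L × κ → ℝ) w ≤
      (Fintype.card κ * U ^ 2 : ℝ) * Functional.mass (Fin L → A) w
    rw [hv']
    calc _ ≤ (L : ℝ)⁻¹ * _ := mul_le_mul_of_nonneg_left h1 (by positivity)
      _ = _ := by field_simp
  have h := sideOp_le_rowChannel (sectionFeatures a : (Fin L → A) → Fin L × κ → ℝ) v δ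
    (δ * v / (1 + δ * E)) (E := E) E.2 (by push_cast; rfl) hβ M N (iidWeight (Fin L) p)
  rw [sideOp_sectionFeatures_pow_apply hp, Functional.mass_apply,
    coe_sum_eq_one (sum_iidWeight _ hp), mul_one] at h
  have hR : ((rowChannel (sectionFeatures a : (Fin L → A) → Fin L × κ → ℝ) v δ).op ^ M)
      (Functional.entropy _) (iidWeight (Fin L) p) = residualEntropy p a δ L M := rfl
  rw [hR] at h
  have harg : ((M + N : ℕ) : ℝ≥0) * (δ * v / (1 + δ * E)) =
      ((M / L : ℝ≥0) + N * (1 / L : ℝ≥0)) * (δ / (1 + δ * E)) := by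
    rw [hv, Fintype.card_fin]
    push_cast
    simp only [div_eq_mul_inv]
    ring
  rw [harg] at h
  set G := scalarResidualEntropy p a (((M / L : ℝ≥0) + N * (1 / L : ℝ≥0)) * (δ / (1 + δ * E)))
  set R := residualEntropy p a δ L M
  set ψ := Real.log (1 + δ * E) / 2 - δ * E / (1 + δ * E) / 2
  set k := (δ : ℝ) / (1 + δ * E) / 2 * (Fintype.card κ * U ^ 2)
  have h2 : G * L - M * ψ - M * (k / N) ≤ R := by
    rw [← mul_le_mul_iff_right₀ hN']
    have : N * (G * L - M * ψ - M * (k / N)) = N * (L * G) - N * (M * ψ) - M * k := by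
      field_simp
    rw [this]
    linarith
  calc _ = (G * L - M * ψ - M * (k / N)) / L := by field_simp
    _ ≤ _ := div_le_div_of_nonneg_right h2 hL'.le

/-- The replica symmetric bound on the limit of the uncertainty per section. -/
lemma le_of_tendsto_residualEntropy_div (hp : ∑ k, p k = 1) (ha : ∀ k b, |a k b| ≤ U)
    (δ E γ : ℝ≥0) {M : ℕ → ℕ} (hM : Tendsto (fun L : ℕ => (M L : ℝ) / L) atTop (𝓝 γ)) {l : ℝ}
    (hl : Tendsto (fun L : ℕ => residualEntropy p a δ L (M L) / L) atTop (𝓝 l)) :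
    scalarResidualEntropy p a (γ * (δ / (1 + δ * E))) -
      γ * (Real.log (1 + δ * E) / 2 - δ * E / (1 + δ * E) / 2) ≤ l := by
  set ψ := Real.log (1 + δ * E) / 2 - δ * E / (1 + δ * E) / 2
  set k := (δ : ℝ) / (1 + δ * E) / 2 * (Fintype.card κ * U ^ 2) with hk
  have hM' : Tendsto (fun L : ℕ => (M L / L : ℝ≥0)) atTop (𝓝 γ) := by
    rw [← NNReal.tendsto_coe]
    simpa using hM
  have hi : Tendsto (fun L : ℕ => (1 / L : ℝ≥0)) atTop (𝓝 0) := by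
    rw [← NNReal.tendsto_coe]
    simpa using tendsto_inv_atTop_nhds_zero_nat (𝕜 := ℝ)
  have h1 : ∀ N : ℕ, N ≠ 0 → scalarResidualEntropy p a (γ * (δ / (1 + δ * E))) - γ * ψ -
      γ * (k / N) ≤ l := by
    intro N hN
    have h2 : Tendsto (fun L : ℕ => ((M L / L : ℝ≥0) + N * (1 / L : ℝ≥0)) * (δ / (1 + δ * E)))
        atTop (𝓝 ((γ + N * 0) * (δ / (1 + δ * E)))) :=
      (hM'.add (hi.const_mul _)).mul_const _
    rw [mul_zero, add_zero] at h2
    have h3 := (((continuous_scalarResidualEntropy hp ha).tendsto _).comp h2).sub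
      (hM.mul_const ψ) |>.sub (hM.mul_const (k / N))
    refine le_of_tendsto_of_tendsto h3 hl ?_
    filter_upwards [eventually_ne_atTop 0] with L hL
    exact le_residualEntropy_div hp ha δ E hL hN (M L)
  -- The limits are taken in this order: `L → ∞` at fixed `N` removes the extra precision, then `N →
  -- ∞` removes the boundary error.
  have h4 : Tendsto (fun N : ℕ => scalarResidualEntropy p a (γ * (δ / (1 + δ * E))) - γ * ψ -
      γ * (k / N)) atTop (𝓝 (scalarResidualEntropy p a (γ * (δ / (1 + δ * E))) - γ * ψ - γ * 0)) :=
    ((tendsto_const_div_atTop_nhds_zero_nat k).const_mul _).const_sub _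
  rw [mul_zero, sub_zero] at h4
  refine le_of_tendsto h4 ?_
  filter_upwards [eventually_ne_atTop 0] with N hN using h1 N hN

end Scalar

/-! ### Independent channel uses -/

lemma lintegral_pi_prod {ι : Type*} [Fintype ι] {Y : ι → Type*} [∀ i, MeasurableSpace (Y i)]
    (μ : ∀ i, Measure (Y i)) [∀ i, IsProbabilityMeasure (μ i)] {f : ∀ i, Y i → ENNReal}
    (hf : ∀ i, Measurable (f i)) :
    ∫⁻ y, ∏ i, f i (y i) ∂Measure.pi μ = ∏ i, ∫⁻ y, f i y ∂μ i := by
  refine (lintegral_prod_eq_prod_lintegral_of_indepFun Finset.univ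
    (fun i (y : ∀ i, Y i) => f i (y i)) (iIndepFun_pi fun i => (hf i).aemeasurable)
    fun i => (hf i).comp (measurable_pi_apply i)).trans ?_
  exact Finset.prod_congr rfl fun i _ =>
    (measurePreserving_eval μ i).lintegral_comp (hf i)

lemma pi_withDensity {ι : Type*} [Fintype ι] {Y : ι → Type*} [∀ i, MeasurableSpace (Y i)]
    (μ ν : ∀ i, Measure (Y i)) [∀ i, IsProbabilityMeasure (μ i)] [∀ i, IsProbabilityMeasure (ν i)]
    {f : ∀ i, Y i → ENNReal} (hf : ∀ i, Measurable (f i)) (h : ∀ i, ν i = (μ i).withDensity (f i)) :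
    Measure.pi ν = (Measure.pi μ).withDensity fun y => ∏ i, f i (y i) := by
  refine Measure.pi_eq fun s hs => ?_
  rw [withDensity_apply _ (MeasurableSet.univ_pi hs), ← lintegral_indicator (MeasurableSet.univ_pi hs)]
  have h1 : ∀ y : ∀ i, Y i, (Set.univ.pi s).indicator (fun y => ∏ i, f i (y i)) y =
      ∏ i, (s i).indicator (f i) (y i) := by
    intro y
    by_cases hy : y ∈ Set.univ.pi s
    · rw [Set.indicator_of_mem hy]
      exact Finset.prod_congr rfl fun i _ => (Set.indicator_of_mem (hy i trivial) _).symm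
    · rw [Set.indicator_of_notMem hy]
      obtain ⟨i, hi⟩ : ∃ i, y i ∉ s i := by simpa [Set.mem_univ_pi] using hy
      exact (Finset.prod_eq_zero (Finset.mem_univ i) (Set.indicator_of_notMem hi _)).symm
  simp only [h1]
  rw [lintegral_pi_prod μ fun i => (hf i).indicator (hs i)]
  refine Finset.prod_congr rfl fun i _ => ?_
  rw [lintegral_indicator (hs i), h i, withDensity_apply _ (hs i)]

namespace Channel

variable {Y 𝒳 : Type*} [MeasurableSpace Y] [Fintype 𝒳] {n : ℕ}

/-- Independent uses of several channels with the same input. -/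
protected def pi (C : Fin n → Channel Y 𝒳) [∀ i, IsProbabilityMeasure (C i).ref] :
    Channel (Fin n → Y) 𝒳 where
  ref := Measure.pi fun i => (C i).ref
  sfinite := inferInstance
  dens y x := ∏ i, (C i).dens (y i) x
  measurable_dens := by
    refine measurable_pi_lambda _ fun x => Finset.measurable_prod _ fun i _ => ?_
    exact ((measurable_pi_apply x).comp (C i).measurable_dens).comp (measurable_pi_apply i)
  lintegral_dens x := by
    simp only [ENNReal.ofNNReal_finsetProd]
    rw [lintegral_pi_prod (fun i => (C i).ref) (f := fun i y => ((C i).dens y x : ENNReal))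
      fun i => ((measurable_pi_apply x).comp (C i).measurable_dens).coe_nnreal_ennreal]
    simp [(C _).lintegral_dens]

lemma pi_dens (C : Fin n → Channel Y 𝒳) [∀ i, IsProbabilityMeasure (C i).ref] (y : Fin n → Y)
    (x : 𝒳) : (Channel.pi C).dens y x = ∏ i, (C i).dens (y i) x := rfl

/-- Observing a vector of conditionally independent outputs is the same as updating successively,
since the joint density is a product. The induction splits off the first coordinate. -/
lemma op_pi (C : Fin n → Channel Y 𝒳) [∀ i, IsProbabilityMeasure (C i).ref] :
    (Channel.pi C).op = (List.ofFn fun i => (C i).op).prod := by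
  induction n with
  | zero =>
    refine LinearMap.ext fun F => Functional.ext' fun w => ?_
    rw [op_apply]
    show ∫ y, F ((Channel.pi C).update w y) ∂(Measure.pi fun i => (C i).ref) = _
    rw [Measure.pi_of_empty, integral_dirac]
    have : ∀ y : Fin 0 → Y, (Channel.pi C).update w y = w := fun y => by
      funext x
      simp [update, pi_dens]
    rw [this]
    simp
  | succ n ih =>
    rw [List.ofFn_succ, List.prod_cons, ← ih fun i => C i.succ]
    refine LinearMap.ext fun F => Functional.ext' fun w => ?_
    have hint := integrable_prod_update (C 0) (Channel.pi fun i => C i.succ) F w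
    rw [Module.End.mul_apply, op_apply, op_apply]
    simp only [op_apply]
    rw [← integral_prod (μ := (C 0).ref) (ν := (Channel.pi fun i => C i.succ).ref)
      (fun p => F ((Channel.pi fun i => C i.succ).update ((C 0).update w p.1) p.2)) hint]
    have hmp := measurePreserving_piFinSuccAbove (fun i => (C i).ref) 0
    have h1 := hmp.integral_comp' fun p =>
      F ((Channel.pi fun i => C i.succ).update ((C 0).update w p.1) p.2)
    refine Eq.trans ?_ h1
    refine integral_congr_ae (.of_forall fun y => ?_)
    have : (Channel.pi C).update w y =
        (Channel.pi fun i => C i.succ).update ((C 0).update w (y 0)) fun i => y i.succ := by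
      funext x
      simp only [update, pi_dens, Fin.prod_univ_succ, mul_assoc]
    simp only [this]
    rfl

/-! ### Mutual information of a channel -/

/-- The logarithm of the density of the output relative to its marginal density. -/
def informationDensity (C : Channel Y 𝒳) (w : 𝒳 → ℝ≥0) (x : 𝒳) (y : Y) : ℝ :=
  Real.log ((C.dens y x : ℝ) / ∑ x', (w x' : ℝ) * C.dens y x')

lemma measurable_dens_apply (C : Channel Y 𝒳) (x : 𝒳) : Measurable fun y => C.dens y x :=
  (measurable_pi_apply x).comp C.measurable_dens

lemma measurable_informationDensity (C : Channel Y 𝒳) (w : 𝒳 → ℝ≥0) (x : 𝒳) :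
    Measurable (C.informationDensity w x) := by
  have := C.measurable_dens_apply
  unfold informationDensity
  fun_prop

/-- The output density is at least `w x` times the conditional one, which bounds the logarithm above
by `-log (w x)`. Below, `1 - 1 / t ≤ log t` reduces the product to a difference of densities.
Letters of zero weight lack the upper bound and are excluded. -/
lemma integrable_dens_mul_informationDensity (C : Channel Y 𝒳) (hC : ∀ y x, C.dens y x ≠ 0)
    (w : 𝒳 → ℝ≥0) {x : 𝒳} (hx : w x ≠ 0) :
    Integrable (fun y => C.dens y x * C.informationDensity w x y) C.ref := by
  have hW : Integrable (fun y => ∑ x', (w x' : ℝ) * C.dens y x') C.ref :=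
    integrable_finsetSum _ fun x' _ => (C.integrable_dens x').const_mul _
  refine Integrable.mono' (((C.integrable_dens x).const_mul (|Real.log (w x)| + 1)).add hW)
    ((C.measurable_dens_apply x).coe_nnreal_real.mul
      (C.measurable_informationDensity w x)).aestronglyMeasurable (.of_forall fun y => ?_)
  have hd : (0 : ℝ) < C.dens y x := by exact_mod_cast pos_iff_ne_zero.2 (hC y x)
  have hwx : (0 : ℝ) < w x := by exact_mod_cast pos_iff_ne_zero.2 hx
  set W := ∑ x', (w x' : ℝ) * C.dens y x' with hWdef
  have hWge : w x * C.dens y x ≤ W :=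
    Finset.single_le_sum (f := fun x' => (w x' : ℝ) * C.dens y x')
      (fun x' _ => by positivity) (Finset.mem_univ x)
  have hW0 : 0 < W := lt_of_lt_of_le (by positivity) hWge
  have hup : Real.log (C.dens y x / W) ≤ |Real.log (w x)| := by
    have h1 : Real.log (C.dens y x / W) ≤ Real.log (w x)⁻¹ := by
      refine Real.log_le_log (by positivity) ?_
      rw [div_le_iff₀ hW0, inv_mul_eq_div, le_div_iff₀ hwx]
      linarith
    rw [Real.log_inv] at h1
    exact h1.trans (neg_le_abs _)
  have hlow : C.dens y x - W ≤ C.dens y x * Real.log (C.dens y x / W) := by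
    have h1 := Real.one_sub_inv_le_log_of_pos (show 0 < C.dens y x / W by positivity)
    have h2 := mul_le_mul_of_nonneg_left h1 hd.le
    calc (C.dens y x : ℝ) - W = C.dens y x * (1 - (C.dens y x / W)⁻¹) := by field_simp
      _ ≤ _ := h2
  show |(C.dens y x : ℝ) * Real.log (C.dens y x / W)| ≤
    (|Real.log (w x)| + 1) * C.dens y x + W
  have h3 := mul_le_mul_of_nonneg_left hup hd.le
  have h4 := mul_nonneg (abs_nonneg (Real.log (w x))) hd.le
  rw [abs_le]
  constructor <;> nlinarith

/-- Pointwise, the weighted information densities equal minus the sum of updated weights times log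
prior, minus the posterior entropy. The first part is linear in the updated weights and integrates
to the prior entropy. -/
lemma sum_integral_dens_mul_informationDensity (C : Channel Y 𝒳) (hC : ∀ y x, C.dens y x ≠ 0)
    (w : 𝒳 → ℝ≥0) (hw : ∑ x, w x = 1) :
    ∑ x, w x * ∫ y, C.dens y x * C.informationDensity w x y ∂C.ref =
      Functional.entropyFun w - C.op (Functional.entropy 𝒳) w := by
  have h1 : ∀ y, ∑ x, (w x : ℝ) * (C.dens y x * C.informationDensity w x y) =
      -(∑ x, (C.update w y x : ℝ) * Real.log (w x)) - Functional.entropy 𝒳 (C.update w y) := by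
    intro y
    rw [Functional.entropy_apply, Functional.entropyFun_eq]
    set W := ∑ x, (C.update w y x : ℝ) with hW
    have hW' : ∑ x', (w x' : ℝ) * C.dens y x' = W := by simp [hW, update]
    have h2 : ∀ x, (w x : ℝ) * (C.dens y x * C.informationDensity w x y) =
        C.update w y x * Real.log (C.update w y x) - C.update w y x * Real.log (w x) -
          C.update w y x * Real.log W := by
      intro x
      by_cases hx : w x = 0
      · simp [hx, update]
      have hd : (0 : ℝ) < C.dens y x := by exact_mod_cast pos_iff_ne_zero.2 (hC y x)
      have hwx : (0 : ℝ) < w x := by exact_mod_cast pos_iff_ne_zero.2 hx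
      have hWge : w x * C.dens y x ≤ W := by
        rw [← hW']
        exact Finset.single_le_sum (f := fun x' => (w x' : ℝ) * C.dens y x')
          (fun x' _ => by positivity) (Finset.mem_univ x)
      have hW0 : 0 < W := lt_of_lt_of_le (by positivity) hWge
      rw [informationDensity, hW', Real.log_div hd.ne' hW0.ne']
      simp only [update, NNReal.coe_mul]
      rw [Real.log_mul hwx.ne' hd.ne']
      ring
    simp only [h2, Finset.sum_sub_distrib, ← Finset.sum_mul, ← hW]
    ring
  have hint : ∀ x, Integrable (fun y => (w x : ℝ) *
      (C.dens y x * C.informationDensity w x y)) C.ref := by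
    intro x
    by_cases hx : w x = 0
    · simp [hx]
    · exact (C.integrable_dens_mul_informationDensity hC w hx).const_mul _
  calc _ = ∑ x, ∫ y, (w x : ℝ) * (C.dens y x * C.informationDensity w x y) ∂C.ref := by
        simp only [integral_const_mul]
    _ = ∫ y, ∑ x, (w x : ℝ) * (C.dens y x * C.informationDensity w x y) ∂C.ref :=
        (integral_finsetSum _ fun x _ => hint x).symm
    _ = ∫ y, (-(∑ x, (C.update w y x : ℝ) * Real.log (w x)) -
          Functional.entropy 𝒳 (C.update w y)) ∂C.ref := by simp only [h1]
    _ = _ := by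
        rw [integral_sub (C.integrable_sum_update w fun x => Real.log (w x)).fun_neg (C.integrable_comp_update _ w),
          integral_neg, C.integral_sum_update, op_apply, Functional.entropyFun_eq,
          coe_sum_eq_one hw]
        simp

/-- The mutual information of a channel that is realized on another space. -/
lemma integrable_informationDensity_comp {Ω : Type*} [MeasurableSpace Ω] {P : Measure Ω}
    (C : Channel Y 𝒳) (hC : ∀ y x, C.dens y x ≠ 0) (w : 𝒳 → ℝ≥0) {x : 𝒳} {g : Ω → Y}
    (hg : MeasurePreserving g P (C.ref.withDensity fun y => C.dens y x)) (hx : w x ≠ 0) :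
    Integrable (fun ω => C.informationDensity w x (g ω)) P := by
  refine hg.integrable_comp_of_integrable (g := C.informationDensity w x) ?_
  rw [integrable_withDensity_iff_integrable_coe_smul (C.measurable_dens_apply x)]
  exact C.integrable_dens_mul_informationDensity hC w hx

lemma sum_integral_informationDensity_comp {Ω : Type*} [MeasurableSpace Ω] {P : Measure Ω}
    (C : Channel Y 𝒳) (hC : ∀ y x, C.dens y x ≠ 0) (w : 𝒳 → ℝ≥0) (hw : ∑ x, w x = 1)
    {g : 𝒳 → Ω → Y}
    (hg : ∀ x, MeasurePreserving (g x) P (C.ref.withDensity fun y => C.dens y x)) :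
    ∑ x, w x * ∫ ω, C.informationDensity w x (g x ω) ∂P =
      Functional.entropyFun w - C.op (Functional.entropy 𝒳) w := by
  rw [← C.sum_integral_dens_mul_informationDensity hC w hw]
  refine Finset.sum_congr rfl fun x _ => ?_
  congr 1
  rw [← integral_map (hg x).measurable.aemeasurable
    (C.measurable_informationDensity w x).aestronglyMeasurable, (hg x).map_eq,
    integral_withDensity_eq_integral_smul (C.measurable_dens_apply x)]
  rfl

end Channel

/-! ### Finite mixtures -/

section Mixture

variable {𝒳 S Ω Q : Type*} [Fintype 𝒳] [MeasurableSpace S] [MeasurableSpace Ω] [MeasurableSpace Q]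

lemma sum_smul_dirac_prod (w : 𝒳 → ℝ≥0) (s : 𝒳 → S) (ν : Measure Ω) [SFinite ν] :
    (∑ x, (w x : ENNReal) • Measure.dirac (s x)).prod ν =
      ∑ x, (w x : ENNReal) • ν.map (Prod.mk (s x)) := by
  rw [← Measure.sum_fintype, Measure.prod_sum_left, Measure.sum_fintype]
  refine Finset.sum_congr rfl fun x _ => ?_
  rw [Measure.prod_smul_left, Measure.dirac_prod]

lemma prod_sum_smul (w : 𝒳 → ℝ≥0) (μ : Measure Q) (ν : 𝒳 → Measure Ω) [∀ x, SFinite (ν x)] :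
    μ.prod (∑ x, (w x : ENNReal) • ν x) = ∑ x, (w x : ENNReal) • μ.prod (ν x) := by
  rw [← Measure.sum_fintype, Measure.prod_sum_right, Measure.sum_fintype]
  refine Finset.sum_congr rfl fun x _ => ?_
  rw [Measure.prod_smul_right]

lemma integrable_sum_smul_map {w : 𝒳 → ℝ≥0} {P : Measure Ω} {h : 𝒳 → Ω → Q}
    (hh : ∀ x, Measurable (h x)) {f : Q → ℝ} (hf : Measurable f)
    (hint : ∀ x, w x ≠ 0 → Integrable (fun ω => f (h x ω)) P) :
    Integrable f (∑ x, (w x : ENNReal) • P.map (h x)) ∧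
      ∫ q, f q ∂(∑ x, (w x : ENNReal) • P.map (h x)) = ∑ x, w x * ∫ ω, f (h x ω) ∂P := by
  have h1 : ∀ x, Integrable f ((w x : ENNReal) • P.map (h x)) := by
    intro x
    by_cases hx : w x = 0
    · simp [hx]
    · exact ((integrable_map_measure hf.aestronglyMeasurable (hh x).aemeasurable).2
        (hint x hx)).smul_measure ENNReal.coe_ne_top
  refine ⟨integrable_finsetSum_measure.2 fun x _ => h1 x, ?_⟩
  rw [integral_finsetSum_measure fun x _ => h1 x]
  refine Finset.sum_congr rfl fun x _ => ?_
  rw [integral_smul_measure, integral_map (hh x).aemeasurable hf.aestronglyMeasurable]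
  simp

lemma integral_sum_smul_dirac [MeasurableSingletonClass S] (w : 𝒳 → ℝ≥0) (s : 𝒳 → S) (f : S → ℝ) :
    ∫ q, f q ∂(∑ x, (w x : ENNReal) • Measure.dirac (s x)) = ∑ x, w x * f (s x) := by
  rw [integral_finsetSum_measure fun x _ =>
    (integrable_dirac (by simp)).smul_measure ENNReal.coe_ne_top]
  refine Finset.sum_congr rfl fun x _ => ?_
  rw [integral_smul_measure, integral_dirac]
  simp

end Mixture

/-! ### The signal law as a mixture over labels -/

section Prior

variable {B K : ℕ} {p : Fin K → ℝ≥0} {a : Fin K → Fin B → ℝ} {P₀ : Measure (Fin B → ℝ)}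

lemma isProbabilityMeasure_of_eq (hp : ∑ k, p k = 1)
    (hP₀ : P₀ = ∑ k, (p k : ENNReal) • Measure.dirac (a k)) : IsProbabilityMeasure P₀ := by
  refine ⟨?_⟩
  rw [hP₀]
  simp only [Measure.coe_finsetSum, Finset.sum_apply, Measure.smul_apply, measure_univ, smul_eq_mul,
    mul_one]
  exact_mod_cast hp

/-- A product of mixtures is the mixture of the products. Atoms need not be distinct: labels may
carry more entropy than the signal, but the excess is never observed and cancels from the
information. -/
lemma signalLaw_eq (hp : ∑ k, p k = 1)
    (hP₀ : P₀ = ∑ k, (p k : ENNReal) • Measure.dirac (a k)) (L : ℕ) :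
    signalLaw P₀ L = ∑ x : Fin L → Fin K, (iidWeight (Fin L) p x : ENNReal) •
      Measure.dirac fun l => a (x l) := by
  have := isProbabilityMeasure_of_eq hp hP₀
  refine Measure.pi_eq fun s hs => ?_
  have h1 : ∀ l, P₀ (s l) = ∑ k, (p k : ENNReal) * (s l).indicator 1 (a k) := by
    intro l
    rw [hP₀]
    simp only [Measure.coe_finsetSum, Finset.sum_apply, Measure.smul_apply,
      Measure.dirac_apply' _ (hs l), smul_eq_mul]
  simp only [h1]
  rw [Finset.prod_univ_sum, Fintype.piFinset_univ, Measure.coe_finsetSum, Finset.sum_apply]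
  refine Finset.sum_congr rfl fun x _ => ?_
  rw [Measure.smul_apply, Measure.dirac_apply' _ (MeasurableSet.univ_pi hs), smul_eq_mul,
    Finset.prod_mul_distrib, iidWeight, ENNReal.ofNNReal_finsetProd]
  congr 1
  by_cases hx : (fun l => a (x l)) ∈ Set.univ.pi s
  · rw [Set.indicator_of_mem hx]
    exact (Finset.prod_eq_one fun l _ => Set.indicator_of_mem (hx l trivial) _).symm
  · rw [Set.indicator_of_notMem hx]
    obtain ⟨l, hl⟩ : ∃ l, a (x l) ∉ s l := by simpa [Set.mem_univ_pi] using hx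
    exact (Finset.prod_eq_zero (Finset.mem_univ l) (Set.indicator_of_notMem hl _)).symm

end Prior

/-! ### The Gaussian laws -/

section Laws

variable {𝒳 κ : Type*} [Fintype 𝒳] [Fintype κ]

lemma gaussChannel_withDensity (u : 𝒳 → ℝ) (δ : ℝ≥0) (x : 𝒳) :
    (gaussianReal 0 δ).withDensity (fun y => ((gaussChannel u δ).dens y x : ENNReal)) =
      gaussianReal (δ * u x) δ := by
  rw [← gaussianReal_withDensity_exp]
  congr 1
  funext y
  rw [← coe_gaussChannel_dens u, ENNReal.ofReal_coe_nnreal]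

lemma gaussianReal_map_affine (m : ℝ) {δ : ℝ≥0} {c : ℝ} (hc : c ^ 2 = δ) :
    (gaussianReal 0 1).map (fun z => m + c * z) = gaussianReal m δ := by
  have h0 : (fun z => m + c * z) = (fun y => y + m) ∘ fun z => c * z := by
    funext z
    simp only [Function.comp]
    ring
  rw [h0, ← Measure.map_map (by fun_prop) (by fun_prop), gaussianReal_map_const_mul,
    gaussianReal_map_add_const]
  congr 1
  · simp
  · ext
    simp [hc]

lemma measurePreserving_gaussChannel (u : 𝒳 → ℝ) {δ : ℝ≥0} {c : ℝ} (hc : c ^ 2 = δ) (x : 𝒳) :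
    MeasurePreserving (fun z => δ * u x + c * z) (gaussianReal 0 1)
      ((gaussChannel u δ).ref.withDensity fun y => (gaussChannel u δ).dens y x) :=
  ⟨by fun_prop, by rw [gaussChannel_ref, gaussChannel_withDensity, gaussianReal_map_affine _ hc]⟩

lemma measurePreserving_rowChannel (X : 𝒳 → κ → ℝ) (v : ℝ≥0) {δ : ℝ≥0} {c : ℝ} (hc : c ^ 2 = δ)
    (x : 𝒳) :
    MeasurePreserving (fun q : (κ → ℝ) × ℝ => (q.1, δ * ∑ i, q.1 i * X x i + c * q.2))
      ((rowLaw κ v).prod (gaussianReal 0 1))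
      ((rowChannel X v δ).ref.withDensity fun y => (rowChannel X v δ).dens y x) := by
  have hm : Measurable fun q : (κ → ℝ) × ℝ => (q.1, δ * ∑ i, q.1 i * X x i + c * q.2) := by
    fun_prop
  refine ⟨hm, Measure.ext fun s hs => ?_⟩
  rw [Measure.map_apply hm hs, Measure.prod_apply (hm hs), withDensity_apply _ hs,
    ← lintegral_indicator hs]
  show _ = ∫⁻ y, _ ∂((rowLaw κ v).prod (gaussianReal 0 δ))
  rw [lintegral_prod _ (((rowChannel X v δ).measurable_dens_apply x).coe_nnreal_ennreal.indicator
    hs).aemeasurable]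
  refine lintegral_congr fun φ => ?_
  have h1 : Prod.mk φ ⁻¹' ((fun q : (κ → ℝ) × ℝ => (q.1, δ * ∑ i, q.1 i * X x i + c * q.2)) ⁻¹' s) =
      (fun z => δ * (∑ i, φ i * X x i) + c * z) ⁻¹' (Prod.mk φ ⁻¹' s) := rfl
  have hs' : MeasurableSet (Prod.mk φ ⁻¹' s) := measurable_prodMk_left hs
  have h2 := (measurePreserving_gaussChannel (fun x => ∑ i, φ i * X x i) hc x).measure_preimage
    hs'.nullMeasurableSet
  rw [h1, h2, withDensity_apply _ hs', ← lintegral_indicator hs']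
  rfl

instance (X : 𝒳 → κ → ℝ) (v δ : ℝ≥0) : IsProbabilityMeasure (rowChannel X v δ).ref :=
  inferInstanceAs (IsProbabilityMeasure ((rowLaw κ v).prod (gaussianReal 0 δ)))

instance (u : 𝒳 → ℝ) (δ : ℝ≥0) : IsProbabilityMeasure (gaussChannel u δ).ref :=
  inferInstanceAs (IsProbabilityMeasure (gaussianReal 0 δ))

lemma Channel.isProbabilityMeasure_withDensity {Y : Type*} [MeasurableSpace Y] (C : Channel Y 𝒳)
    (x : 𝒳) : IsProbabilityMeasure (C.ref.withDensity fun y => C.dens y x) :=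
  ⟨by rw [withDensity_apply _ MeasurableSet.univ, Measure.restrict_univ, C.lintegral_dens]⟩

lemma Channel.measurePreserving_pi {Y Ω : Type*} [MeasurableSpace Y] [MeasurableSpace Ω] {n : ℕ}
    (C : Fin n → Channel Y 𝒳) [∀ i, IsProbabilityMeasure (C i).ref] {P : Fin n → Measure Ω}
    [∀ i, IsProbabilityMeasure (P i)] {g : Fin n → Ω → Y} {x : 𝒳}
    (hg : ∀ i, MeasurePreserving (g i) (P i) ((C i).ref.withDensity fun y => (C i).dens y x)) :
    MeasurePreserving (fun ω i => g i (ω i)) (Measure.pi P)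
      ((Channel.pi C).ref.withDensity fun y => (Channel.pi C).dens y x) := by
  have := fun i => (C i).isProbabilityMeasure_withDensity x
  have h1 := MeasureTheory.measurePreserving_pi P
    (fun i => (C i).ref.withDensity fun y => (C i).dens y x) hg
  rw [pi_withDensity (fun i => (C i).ref) _
    (fun i => ((C i).measurable_dens_apply x).coe_nnreal_ennreal) fun i => rfl] at h1
  simp only [← ENNReal.ofNNReal_finsetProd] at h1
  exact h1

end Laws

/-! ### The linear estimation model -/

section LinearModel

variable {B K : ℕ} {p : Fin K → ℝ≥0} {a : Fin K → Fin B → ℝ} {P₀ : Measure (Fin B → ℝ)}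

/-- The channel from the labels of the sections to the matrix and the measurements. -/
def measurementChannel (a : Fin K → Fin B → ℝ) (δ : ℝ≥0) (L M : ℕ) :
    Channel (Fin M → (Fin L × Fin B → ℝ) × ℝ) (Fin L → Fin K) :=
  Channel.pi fun _ : Fin M =>
    rowChannel (sectionFeatures a : (Fin L → Fin K) → Fin L × Fin B → ℝ)
      ((Fintype.card (Fin L) : ℝ≥0)⁻¹) δ

lemma measurementChannel_op (a : Fin K → Fin B → ℝ) (δ : ℝ≥0) (L M : ℕ) :
    (measurementChannel a δ L M).op = (jointOp (fun x : Fin L → Fin K => x) a δ) ^ M := by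
  rw [measurementChannel, Channel.op_pi, List.ofFn_const, List.prod_replicate]
  rfl

lemma coe_measurementChannel_dens (a : Fin K → Fin B → ℝ) (δ : ℝ≥0) (L M : ℕ)
    (y : Fin M → (Fin L × Fin B → ℝ) × ℝ) (x : Fin L → Fin K) :
    ((measurementChannel a δ L M).dens y x : ℝ) = Real.exp (∑ μ,
      ((∑ i, (y μ).1 i * a (x i.1) i.2) * (y μ).2 -
        δ * (∑ i, (y μ).1 i * a (x i.1) i.2) ^ 2 / 2)) := by
  rw [measurementChannel, Channel.pi_dens, NNReal.coe_prod, Real.exp_sum]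
  rfl

/-- The matrix and the rescaled measurements as a function of the matrix and the noise. -/
def outputMap (a : Fin K → Fin B → ℝ) (Δ : ℝ) {L M : ℕ} (x : Fin L → Fin K)
    (q : (Fin M → Fin L × Fin B → ℝ) × (Fin M → ℝ)) : Fin M → (Fin L × Fin B → ℝ) × ℝ :=
  fun μ => (q.1 μ, Δ⁻¹ * ∑ i, q.1 μ i * a (x i.1) i.2 + √Δ / Δ * q.2 μ)

lemma measurePreserving_outputMap (a : Fin K → Fin B → ℝ) {Δ : ℝ} (hΔ : 0 < Δ) {L M : ℕ}
    (x : Fin L → Fin K) :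
    MeasurePreserving (outputMap a Δ x) ((matrixLaw B L M).prod (stdNormal M))
      ((measurementChannel a Δ⁻¹.toNNReal L M).ref.withDensity fun y =>
        (measurementChannel a Δ⁻¹.toNNReal L M).dens y x) := by
  have hδ : ((Δ⁻¹.toNNReal : ℝ≥0) : ℝ) = Δ⁻¹ := Real.coe_toNNReal _ (by positivity)
  have hc : (√Δ / Δ) ^ 2 = (Δ⁻¹.toNNReal : ℝ≥0) := by
    rw [hδ, div_pow, Real.sq_sqrt hΔ.le]
    field_simp
  have h1 := Channel.measurePreserving_pi (x := x) (fun _ : Fin M =>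
    rowChannel (sectionFeatures a : (Fin L → Fin K) → Fin L × Fin B → ℝ)
      ((Fintype.card (Fin L) : ℝ≥0)⁻¹) Δ⁻¹.toNNReal) fun _ => measurePreserving_rowChannel _ _ hc x
  have h2 := (measurePreserving_arrowProdEquivProdArrow (Fin L × Fin B → ℝ) ℝ (Fin M)
    (fun _ => rowLaw (Fin L × Fin B) ((Fintype.card (Fin L) : ℝ≥0)⁻¹))
    fun _ => gaussianReal 0 1).symm
  have h3 := h1.comp h2
  rw [hδ] at h3
  have h4 : (matrixLaw B L M).prod (stdNormal M) =
      (Measure.pi fun _ => rowLaw (Fin L × Fin B) ((Fintype.card (Fin L) : ℝ≥0)⁻¹)).prod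
        (Measure.pi fun _ => gaussianReal 0 1) := by
    simp only [matrixLaw, stdNormal, rowLaw, Fintype.card_fin, one_div]
  rw [h4]
  exact h3

lemma evidence_eq (hp : ∑ k, p k = 1) (hP₀ : P₀ = ∑ k, (p k : ENNReal) • Measure.dirac (a k))
    (Δ : ℝ) {L M : ℕ} (φ : Fin M → Fin L × Fin B → ℝ) (y : Fin M → ℝ) :
    evidence Δ P₀ φ y =
      ∑ x : Fin L → Fin K, iidWeight (Fin L) p x * likelihood Δ φ (fun l => a (x l)) y := by
  rw [evidence, signalLaw_eq hp hP₀, integral_sum_smul_dirac]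

/-- Expanding the square isolates a factor that depends on the measurement but not on the candidate
`x'`. It cancels between likelihood and evidence, leaving the density of the Gaussian channel of
precision `1 / Δ`. -/
lemma likelihood_eq (a : Fin K → Fin B → ℝ) {Δ : ℝ} (hΔ : 0 < Δ) {L M : ℕ} (x x' : Fin L → Fin K)
    (q : (Fin M → Fin L × Fin B → ℝ) × (Fin M → ℝ)) :
    likelihood Δ q.1 (fun l => a (x' l)) (measurement Δ q.1 (fun l => a (x l)) q.2) =
      (2 * Real.pi * Δ) ^ (-(M : ℝ) / 2) * Real.exp (-(1 / (2 * Δ)) *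
        ∑ μ, measurement Δ q.1 (fun l => a (x l)) q.2 μ ^ 2) *
      (measurementChannel a Δ⁻¹.toNNReal L M).dens (outputMap a Δ x q) x' := by
  have hδ : ((Δ⁻¹.toNNReal : ℝ≥0) : ℝ) = Δ⁻¹ := Real.coe_toNNReal _ (by positivity)
  rw [likelihood, coe_measurementChannel_dens, mul_assoc ((2 * Real.pi * Δ) ^ (-(M : ℝ) / 2)),
    ← Real.exp_add, hδ]
  congr 2
  rw [Finset.mul_sum, Finset.mul_sum, ← Finset.sum_add_distrib]
  refine Finset.sum_congr rfl fun μ _ => ?_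
  simp only [measurement, project, outputMap]
  field_simp
  ring

lemma informationDensity_eq (hp : ∑ k, p k = 1)
    (hP₀ : P₀ = ∑ k, (p k : ENNReal) • Measure.dirac (a k)) {Δ : ℝ} (hΔ : 0 < Δ) {L M : ℕ}
    (x : Fin L → Fin K) (q : (Fin M → Fin L × Fin B → ℝ) × (Fin M → ℝ)) :
    informationDensity Δ P₀ L M (q.1, (fun l => a (x l)), q.2) =
      (measurementChannel a Δ⁻¹.toNNReal L M).informationDensity (iidWeight (Fin L) p) x
        (outputMap a Δ x q) := by
  simp only [informationDensity, Channel.informationDensity]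
  rw [evidence_eq hp hP₀]
  simp only [likelihood_eq a hΔ]
  congr 1
  set c := (2 * Real.pi * Δ) ^ (-(M : ℝ) / 2) * Real.exp (-(1 / (2 * Δ)) *
    ∑ μ, measurement Δ q.1 (fun l => a (x l)) q.2 μ ^ 2) with hc
  have hc0 : c ≠ 0 := by positivity
  simp only [mul_left_comm _ c, ← Finset.mul_sum]
  rw [mul_div_mul_left _ _ hc0]

lemma measurable_informationDensity (hp : ∑ k, p k = 1)
    (hP₀ : P₀ = ∑ k, (p k : ENNReal) • Measure.dirac (a k)) (Δ : ℝ) (L M : ℕ) :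
    Measurable (informationDensity Δ P₀ L M) := by
  have h1 : ∀ s : (Fin M → Fin L × Fin B → ℝ) × (Fin L → Fin B → ℝ) × (Fin M → ℝ) →
      Fin L → Fin B → ℝ, Measurable s → Measurable fun q : (Fin M → Fin L × Fin B → ℝ) ×
        (Fin L → Fin B → ℝ) × (Fin M → ℝ) => likelihood Δ q.1 (s q) (measurement Δ q.1 q.2.1 q.2.2) := by
    intro s hs
    unfold likelihood measurement project
    have h2 : ∀ l b, Measurable fun q => s q l b := fun l b =>
      (measurable_pi_apply b).comp ((measurable_pi_apply l).comp hs)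
    fun_prop
  unfold informationDensity
  simp only [evidence_eq hp hP₀]
  refine Real.measurable_log.comp (Measurable.div (h1 _ (by fun_prop)) ?_)
  exact Finset.measurable_sum _ fun x _ => (h1 _ measurable_const).const_mul _

lemma quenchedLaw_eq (hp : ∑ k, p k = 1)
    (hP₀ : P₀ = ∑ k, (p k : ENNReal) • Measure.dirac (a k)) (L M : ℕ) :
    quenchedLaw P₀ L M = ∑ x : Fin L → Fin K, (iidWeight (Fin L) p x : ENNReal) •
      ((matrixLaw B L M).prod (stdNormal M)).map fun q => (q.1, (fun l => a (x l)), q.2) := by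
  have i1 : IsProbabilityMeasure (matrixLaw B L M) := by unfold matrixLaw; infer_instance
  have i2 : IsProbabilityMeasure (stdNormal M) := by unfold stdNormal; infer_instance
  rw [quenchedLaw, signalLaw_eq hp hP₀, sum_smul_dirac_prod, prod_sum_smul]
  refine Finset.sum_congr rfl fun x _ => ?_
  congr 1
  have := Measure.map_prod_map (matrixLaw B L M) (stdNormal M) measurable_id
    (measurable_prodMk_left (x := fun l => a (x l)))
  rw [Measure.map_id] at this
  exact this

lemma integrable_informationDensity (hp : ∑ k, p k = 1)
    (hP₀ : P₀ = ∑ k, (p k : ENNReal) • Measure.dirac (a k)) {Δ : ℝ} (hΔ : 0 < Δ) (L M : ℕ) :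
    Integrable (informationDensity Δ P₀ L M) (quenchedLaw P₀ L M) ∧
      ∫ q, informationDensity Δ P₀ L M q ∂quenchedLaw P₀ L M =
        L * Functional.entropyFun p - residualEntropy p a Δ⁻¹.toNNReal L M := by
  set C := measurementChannel a Δ⁻¹.toNNReal L M with hC
  have hpos : ∀ y x, C.dens y x ≠ 0 := by
    intro y x
    rw [← NNReal.coe_ne_zero, hC, coe_measurementChannel_dens]
    exact (Real.exp_pos _).ne'
  have h := integrable_sum_smul_map (w := iidWeight (Fin L) p)
    (P := (matrixLaw B L M).prod (stdNormal M))
    (h := fun x q => (q.1, (fun l => a (x l)), q.2)) (fun x => by fun_prop)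
    (measurable_informationDensity hp hP₀ Δ L M) (fun x hx => by
      simp only [informationDensity_eq hp hP₀ hΔ]
      exact C.integrable_informationDensity_comp hpos _ (measurePreserving_outputMap a hΔ x) hx)
  rw [← quenchedLaw_eq hp hP₀] at h
  refine ⟨h.1, h.2.trans ?_⟩
  simp only [informationDensity_eq hp hP₀ hΔ]
  rw [C.sum_integral_informationDensity_comp hpos _ (sum_iidWeight _ hp)
    (measurePreserving_outputMap a hΔ), hC, measurementChannel_op]
  congr 1
  have := (decomposes_entropy (β := Fin L) (𝒳 := fun _ => Fin K)).apply_prob (w := fun _ => p)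
    fun _ => hp
  simp only [Finset.sum_const, Finset.card_univ, Fintype.card_fin, nsmul_eq_mul] at this
  exact this

lemma iCS_eq (hp : ∑ k, p k = 1)
    (hP₀ : P₀ = ∑ k, (p k : ENNReal) • Measure.dirac (a k)) {Δ : ℝ} (hΔ : 0 < Δ) {L : ℕ}
    (hL : L ≠ 0) (M : ℕ) :
    iCS Δ P₀ L M = Functional.entropyFun p - residualEntropy p a Δ⁻¹.toNNReal L M / L := by
  have : (L : ℝ) ≠ 0 := by exact_mod_cast hL
  rw [iCS, (integrable_informationDensity hp hP₀ hΔ L M).2]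
  field_simp

end LinearModel

/-! ### The denoising model -/

section Denoising

variable {B K : ℕ} {p : Fin K → ℝ≥0} {a : Fin K → Fin B → ℝ} {P₀ : Measure (Fin B → ℝ)}

/-- The channel from a label to the rescaled noisy features. -/
def denoisingChannel (a : Fin K → Fin B → ℝ) (l : ℝ≥0) : Channel (Fin B → ℝ) (Fin K) :=
  Channel.pi fun b => gaussChannel (fun k => a k b) l

lemma denoisingChannel_op (a : Fin K → Fin B → ℝ) (l : ℝ≥0) :
    (denoisingChannel a l).op = sideOp a l := by
  rw [denoisingChannel, Channel.op_pi, sideOp, List.ofFn_eq_map]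
  refine List.Perm.prod_eq' ?_ ?_
  · refine List.Perm.map _ (List.perm_of_nodup_nodup_toFinset_eq (List.nodup_finRange B)
      (Finset.nodup_toList _) ?_)
    ext b
    simp
  · rw [List.pairwise_map]
    exact List.pairwise_of_forall fun i j => Channel.commute_op _ _

lemma coe_denoisingChannel_dens (a : Fin K → Fin B → ℝ) (l : ℝ≥0) (y : Fin B → ℝ) (k : Fin K) :
    ((denoisingChannel a l).dens y k : ℝ) =
      Real.exp (∑ b, (a k b * y b - l * a k b ^ 2 / 2)) := by
  rw [denoisingChannel, Channel.pi_dens, NNReal.coe_prod, Real.exp_sum]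
  rfl

lemma measurePreserving_denoising (a : Fin K → Fin B → ℝ) {l : ℝ≥0} {c : ℝ} (hc : c ^ 2 = l)
    (k : Fin K) :
    MeasurePreserving (fun (z : Fin B → ℝ) b => l * a k b + c * z b) (stdNormal B)
      ((denoisingChannel a l).ref.withDensity fun y => (denoisingChannel a l).dens y k) :=
  Channel.measurePreserving_pi (x := k) (fun b => gaussChannel (fun k => a k b) l)
    fun _ => measurePreserving_gaussChannel _ hc k

lemma integral_half_sum_sq_stdNormal (B : ℕ) :
    Integrable (fun z : Fin B → ℝ => ∑ b, z b ^ 2 / 2) (stdNormal B) ∧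
      ∫ z, ∑ b, z b ^ 2 / 2 ∂stdNormal B = (B : ℝ) / 2 := by
  have hmp : ∀ b : Fin B, MeasurePreserving (fun z : Fin B → ℝ => z b) (stdNormal B)
      (gaussianReal 0 1) := fun b => measurePreserving_eval _ b
  have hint : ∀ b : Fin B, Integrable (fun z : Fin B → ℝ => z b ^ 2 / 2) (stdNormal B) := fun b =>
    (hmp b).integrable_comp_of_integrable (g := fun y => y ^ 2 / 2)
      ((integrable_sq_gaussianReal 0 1).div_const 2)
  refine ⟨integrable_finsetSum _ fun b _ => hint b, ?_⟩
  rw [integral_finsetSum _ fun b _ => hint b]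
  have h1 : ∀ b : Fin B, ∫ z, z b ^ 2 / 2 ∂stdNormal B = 1 / 2 := by
    intro b
    have h2 := integral_map (μ := stdNormal B) (hmp b).measurable.aemeasurable
      (f := fun y : ℝ => y ^ 2 / 2) (by fun_prop)
    rw [(hmp b).map_eq] at h2
    rw [← h2, integral_div, integral_sq_gaussianReal]
    simp
  simp only [h1, Finset.sum_const, Finset.card_univ, Fintype.card_fin, nsmul_eq_mul]
  ring

/-- Completing the square relative to the true atom leaves minus half the squared noise, whose mean
`-B / 2` is compensated by the constant in `iDenoising`. -/
lemma denoisingLogPartition_eq (hp : ∑ k, p k = 1)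
    (hP₀ : P₀ = ∑ k, (p k : ENNReal) • Measure.dirac (a k)) {l : ℝ≥0} {σ : ℝ} (hσ : 0 < σ)
    (hl : (l : ℝ) = (σ ^ 2)⁻¹) (k : Fin K) (z : Fin B → ℝ) :
    denoisingLogPartition P₀ σ (a k, z) =
      -(denoisingChannel a l).informationDensity p k (fun b => l * a k b + σ⁻¹ * z b) -
        ∑ b, z b ^ 2 / 2 := by
  set y : Fin B → ℝ := fun b => l * a k b + σ⁻¹ * z b with hy
  set W : ℝ := ∑ k', (p k' : ℝ) * (denoisingChannel a l).dens y k' with hW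
  have hd : ∀ k', (0 : ℝ) < (denoisingChannel a l).dens y k' := fun k' => by
    rw [coe_denoisingChannel_dens]
    exact Real.exp_pos _
  have hW0 : 0 < W := by
    obtain ⟨k', hk'⟩ : ∃ k', p k' ≠ 0 := by
      by_contra h
      push Not at h
      simp [h] at hp
    exact Finset.sum_pos' (fun k' _ => mul_nonneg (p k').2 (hd k').le)
      ⟨k', Finset.mem_univ _, mul_pos (by exact_mod_cast pos_iff_ne_zero.2 hk') (hd k')⟩
  have key : ∀ k', Real.exp (-∑ b, (a k' b - (a k b + z b * σ)) ^ 2 / (2 * σ ^ 2)) =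
      Real.exp (-∑ b, z b ^ 2 / 2) * ((denoisingChannel a l).dens y k : ℝ)⁻¹ *
        (denoisingChannel a l).dens y k' := by
    intro k'
    rw [coe_denoisingChannel_dens, coe_denoisingChannel_dens, ← Real.exp_neg, ← Real.exp_add,
      ← Real.exp_add]
    congr 1
    simp only [← Finset.sum_neg_distrib, ← Finset.sum_add_distrib]
    refine Finset.sum_congr rfl fun b _ => ?_
    simp only [hy, hl]
    field_simp
    ring
  rw [denoisingLogPartition, hP₀, integral_sum_smul_dirac]
  simp only [key]
  rw [Channel.informationDensity, ← hW, Real.log_div (hd k).ne' hW0.ne']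
  have h1 : ∑ x, (p x : ℝ) * (Real.exp (-∑ b, z b ^ 2 / 2) *
      ((denoisingChannel a l).dens y k : ℝ)⁻¹ * (denoisingChannel a l).dens y x) =
      Real.exp (-∑ b, z b ^ 2 / 2) * ((denoisingChannel a l).dens y k : ℝ)⁻¹ * W := by
    rw [hW, Finset.mul_sum]
    refine Finset.sum_congr rfl fun x _ => ?_
    ring
  rw [h1, Real.log_mul (mul_ne_zero (Real.exp_pos _).ne' (inv_ne_zero (hd k).ne')) hW0.ne',
    Real.log_mul (Real.exp_pos _).ne' (inv_ne_zero (hd k).ne'), Real.log_exp, Real.log_inv]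
  ring

lemma measurable_denoisingLogPartition
    (hP₀ : P₀ = ∑ k, (p k : ENNReal) • Measure.dirac (a k)) (σ : ℝ) :
    Measurable (denoisingLogPartition P₀ σ) := by
  unfold denoisingLogPartition
  rw [hP₀]
  simp only [integral_sum_smul_dirac]
  fun_prop

lemma integrable_denoisingLogPartition (hp : ∑ k, p k = 1)
    (hP₀ : P₀ = ∑ k, (p k : ENNReal) • Measure.dirac (a k)) {l : ℝ≥0} {σ : ℝ} (hσ : 0 < σ)
    (hl : (l : ℝ) = (σ ^ 2)⁻¹) :
    Integrable (denoisingLogPartition P₀ σ) (P₀.prod (stdNormal B)) ∧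
      iDenoising P₀ σ = Functional.entropyFun p - scalarResidualEntropy p a l := by
  have i2 : IsProbabilityMeasure (stdNormal B) := by unfold stdNormal; infer_instance
  have hc : σ⁻¹ ^ 2 = (l : ℝ) := by rw [hl, inv_pow]
  have hpos : ∀ y k, (denoisingChannel a l).dens y k ≠ 0 := by
    intro y x
    rw [← NNReal.coe_ne_zero, coe_denoisingChannel_dens]
    exact (Real.exp_pos _).ne'
  have hinfo : ∀ k, p k ≠ 0 → Integrable (fun z : Fin B → ℝ =>
      (denoisingChannel a l).informationDensity p k (fun b => l * a k b + σ⁻¹ * z b))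
      (stdNormal B) := fun k hk =>
    (denoisingChannel a l).integrable_informationDensity_comp hpos p
      (measurePreserving_denoising a hc k) hk
  obtain ⟨hsq, hsq'⟩ := integral_half_sum_sq_stdNormal B
  have h := integrable_sum_smul_map (w := p) (P := stdNormal B)
    (h := fun k z => (a k, z)) (fun x => by fun_prop)
    (measurable_denoisingLogPartition hP₀ σ) (fun k hk => by
      simp only [denoisingLogPartition_eq hp hP₀ hσ hl]
      exact (hinfo k hk).neg.sub hsq)
  have hprod : P₀.prod (stdNormal B) =
      ∑ k, (p k : ENNReal) • (stdNormal B).map fun z => (a k, z) := by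
    conv_lhs => rw [hP₀]
    exact sum_smul_dirac_prod p a (stdNormal B)
  rw [← hprod] at h
  refine ⟨h.1, ?_⟩
  rw [iDenoising, h.2]
  have h1 : ∀ k, (p k : ℝ) * ∫ z, denoisingLogPartition P₀ σ (a k, z) ∂stdNormal B =
      -(p k * ∫ z : Fin B → ℝ, (denoisingChannel a l).informationDensity p k
        (fun b => l * a k b + σ⁻¹ * z b) ∂stdNormal B) - p k * ((B : ℝ) / 2) := by
    intro k
    by_cases hk : p k = 0
    · simp [hk]
    · simp only [denoisingLogPartition_eq hp hP₀ hσ hl]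
      rw [integral_sub (hinfo k hk).fun_neg hsq, integral_neg, hsq']
      ring
  simp only [h1, Finset.sum_sub_distrib, Finset.sum_neg_distrib, ← Finset.sum_mul,
    coe_sum_eq_one hp]
  have h2 := (denoisingChannel a l).sum_integral_informationDensity_comp hpos p hp
    (measurePreserving_denoising a hc)
  rw [h2, denoisingChannel_op, scalarResidualEntropy]
  ring

lemma sq_effectiveNoise {B : ℕ} (hB : 0 < B) {α Δ E : ℝ} (hα : 0 < α) (hΔ : 0 < Δ) (hE : 0 ≤ E) :
    0 < effectiveNoise B α Δ E ∧ (effectiveNoise B α Δ E ^ 2)⁻¹ = α * B / (Δ + E) := by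
  have hB' : (0 : ℝ) < B := by exact_mod_cast hB
  have h : 0 < (α * B / (Δ + E))⁻¹ := by positivity
  refine ⟨Real.sqrt_pos.2 h, ?_⟩
  rw [effectiveNoise, Real.sq_sqrt h.le, inv_inv]

lemma iRS_eq (hB : 0 < B) (hp : ∑ k, p k = 1)
    (hP₀ : P₀ = ∑ k, (p k : ENNReal) • Measure.dirac (a k)) {α Δ E : ℝ} (hα : 0 < α) (hΔ : 0 < Δ)
    (hE : 0 ≤ E) :
    iRS P₀ α Δ E = psiRS B α Δ E +
      (Functional.entropyFun p - scalarResidualEntropy p a (α * B / (Δ + E)).toNNReal) := by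
  obtain ⟨h1, h2⟩ := sq_effectiveNoise hB hα hΔ hE
  rw [iRS, (integrable_denoisingLogPartition hp hP₀ h1 (l := (α * B / (Δ + E)).toNNReal) _).2]
  rw [h2, Real.coe_toNNReal _ (by positivity)]

end Denoising

/-- A discrete prior with nonnegative weights. -/
lemma IsDiscretePrior.exists_eq {B : ℕ} {P₀ : Measure (Fin B → ℝ)} (h : IsDiscretePrior P₀) :
    ∃ (K : ℕ) (p : Fin K → ℝ≥0) (a : Fin K → Fin B → ℝ) (U : ℝ), ∑ k, p k = 1 ∧
      P₀ = ∑ k, (p k : ENNReal) • Measure.dirac (a k) ∧ ∀ k b, |a k b| ≤ U := by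
  obtain ⟨K, p, a, hp0, hp1, hP⟩ := h
  refine ⟨K, fun k => (p k).toNNReal, a, ∑ k, ∑ b, |a k b|, ?_, hP, fun k b => ?_⟩
  · rw [← NNReal.coe_inj, NNReal.coe_sum, NNReal.coe_one, ← hp1]
    exact Finset.sum_congr rfl fun k _ => Real.coe_toNNReal _ (hp0 k)
  · calc |a k b| ≤ ∑ b, |a k b| :=
          Finset.single_le_sum (f := fun b => |a k b|) (fun _ _ => abs_nonneg _) (Finset.mem_univ b)
      _ ≤ _ := Finset.single_le_sum (f := fun k => ∑ b, |a k b|)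
          (fun _ _ => Finset.sum_nonneg fun _ _ => abs_nonneg _) (Finset.mem_univ k)

lemma secondMoment_nonneg {B : ℕ} (P₀ : Measure (Fin B → ℝ)) : 0 ≤ secondMoment P₀ :=
  integral_nonneg fun s => Finset.sum_nonneg fun b _ => sq_nonneg (s b)

end

/-! ### The limit, the minimum and their comparison -/

theorem theorem1 (B : ℕ) (hB : 0 < B) (P₀ : Measure (Fin B → ℝ)) (hP₀ : IsDiscretePrior P₀)
    (α Δ : ℝ) (hα : 0 < α) (hΔ : 0 < Δ) :
    -- the expectations in the definitions of both mutual informations are finite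
    (∀ L M : ℕ, Integrable (informationDensity Δ P₀ L M) (quenchedLaw P₀ L M)) ∧
    (∀ E ∈ Set.Icc 0 (secondMoment P₀),
      Integrable (denoisingLogPartition P₀ (effectiveNoise B α Δ E))
        (P₀.prod (stdNormal B))) ∧
    -- the limit exists, the minimum is attained, and the limit is at most the minimum
    ∃ i m : ℝ,
      (∀ M : ℕ → ℕ,
        Tendsto (fun L : ℕ => (M L : ℝ) / ((L : ℝ) * (B : ℝ))) atTop (𝓝 α) →
        Tendsto (fun L : ℕ => iCS Δ P₀ L (M L)) atTop (𝓝 i)) ∧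
      IsLeast ((fun E : ℝ => iRS P₀ α Δ E) '' Set.Icc 0 (secondMoment P₀)) m ∧
      i ≤ m := by
  obtain ⟨K, p, a, U, hp, hP, ha⟩ := hP₀.exists_eq
  have hB' : (0 : ℝ) < B := by exact_mod_cast hB
  have hδ0 : Δ⁻¹.toNNReal ≠ 0 := by simpa using hΔ
  have hδ : ((Δ⁻¹.toNNReal : NNReal) : ℝ) = Δ⁻¹ := Real.coe_toNNReal _ (by positivity)
  have hγ : 0 ≤ α * B := by positivity
  -- `l` is chosen before any sequence of row numbers, so the limit is common to all of them. Rows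
  -- are counted per section here, hence the rate `α * B`.
  obtain ⟨l, hl⟩ := exists_tendsto_residualEntropy_div hp ha hδ0 hγ
  have hrate : ∀ M : ℕ → ℕ, Tendsto (fun L : ℕ => (M L : ℝ) / ((L : ℝ) * (B : ℝ))) atTop (𝓝 α) →
      Tendsto (fun L : ℕ => (M L : ℝ) / L) atTop (𝓝 (α * B)) := by
    intro M hM
    refine (hM.mul_const (B : ℝ)).congr fun L => ?_
    field_simp
  refine ⟨fun L M => (integrable_informationDensity hp hP hΔ L M).1, fun E hE => ?_, ?_⟩
  · obtain ⟨h1, h2⟩ := sq_effectiveNoise hB hα hΔ hE.1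
    have hE0 : 0 ≤ α * B / (Δ + E) := by have := hE.1; positivity
    exact (integrable_denoisingLogPartition hp hP h1 (l := (α * B / (Δ + E)).toNNReal)
      (by rw [h2, Real.coe_toNNReal _ hE0])).1
  -- Continuity of the potential on a compact interval yields the minimiser. The denoising term
  -- inherits continuity from the residual entropy as a function of the precision.
  have hcont : ContinuousOn (fun E => iRS P₀ α Δ E) (Set.Icc 0 (secondMoment P₀)) := by
    have h1 : ContinuousOn (fun E => psiRS B α Δ E + (Functional.entropyFun p -
        scalarResidualEntropy p a (α * B / (Δ + E)).toNNReal)) (Set.Icc 0 (secondMoment P₀)) := by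
      have h2 : ContinuousOn (fun E => α * B / (Δ + E)) (Set.Icc 0 (secondMoment P₀)) :=
        ContinuousOn.div (by fun_prop) (by fun_prop) fun E hE => by
          have := hE.1
          positivity
      have h3 : ContinuousOn (fun E => psiRS B α Δ E) (Set.Icc 0 (secondMoment P₀)) := by
        unfold psiRS
        refine ContinuousOn.div_const (ContinuousOn.mul continuousOn_const (ContinuousOn.sub
          (ContinuousOn.log (by fun_prop) fun E hE => ?_)
          (ContinuousOn.div (by fun_prop) (by fun_prop) fun E hE => ?_))) 2
        · have := hE.1
          positivity
        · have := hE.1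
          positivity
      exact h3.add (continuousOn_const.sub (((continuous_scalarResidualEntropy hp ha).comp
        continuous_real_toNNReal).comp_continuousOn h2))
    exact h1.congr fun E hE => iRS_eq hB hp hP hα hΔ hE.1
  obtain ⟨E₀, hE₀, hmin⟩ := isCompact_Icc.exists_isMinOn
    ⟨0, Set.left_mem_Icc.2 (secondMoment_nonneg P₀)⟩ hcont
  refine ⟨Functional.entropyFun p - l, iRS P₀ α Δ E₀, fun M hM => ?_,
    ⟨⟨E₀, hE₀, rfl⟩, ?_⟩, ?_⟩
  · refine ((hl M (hrate M hM)).const_sub (Functional.entropyFun p)).congr' ?_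
    filter_upwards [eventually_ne_atTop 0] with L hL
    exact (iCS_eq hp hP hΔ hL (M L)).symm
  · rintro _ ⟨E, hE, rfl⟩
    exact hmin hE
  -- Any sequence of the right rate serves to compare `l` with the potential; a floor sequence shows
  -- that one exists.
  · have hfloor : Tendsto (fun L : ℕ => ((⌊(α * B) * L⌋₊ : ℕ) : ℝ) / L) atTop (𝓝 (α * B)) :=
      (tendsto_nat_floor_mul_div_atTop hγ).comp tendsto_natCast_atTop_atTop
    have h0 := hE₀.1
    have h1 := le_of_tendsto_residualEntropy_div hp ha Δ⁻¹.toNNReal E₀.toNNReal (α * B).toNNReal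
      (by rwa [Real.coe_toNNReal _ hγ]) (hl _ hfloor)
    rw [iRS_eq hB hp hP hα hΔ h0, psiRS]
    rw [Real.coe_toNNReal _ hγ, hδ, Real.coe_toNNReal _ h0] at h1
    -- With `δ = 1 / Δ`, the precision reached by the interpolation is exactly the inverse square of
    -- the effective noise level.
    have h2 : (α * B).toNNReal * (Δ⁻¹.toNNReal / (1 + Δ⁻¹.toNNReal * E₀.toNNReal)) =
        (α * B / (Δ + E₀)).toNNReal := by
      rw [← NNReal.coe_inj]
      push_cast
      rw [Real.coe_toNNReal _ hγ, hδ, Real.coe_toNNReal _ h0, Real.coe_toNNReal _ (by positivity)]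
      field_simp
    rw [h2] at h1
    have h3 : α * B * (Real.log (1 + Δ⁻¹ * E₀) / 2 - Δ⁻¹ * E₀ / (1 + Δ⁻¹ * E₀) / 2) =
        α * B * (Real.log (1 + E₀ / Δ) - E₀ / (E₀ + Δ)) / 2 := by
      have h4 : Δ⁻¹ * E₀ / (1 + Δ⁻¹ * E₀) = E₀ / (E₀ + Δ) := by field_simp; ring
      rw [h4, inv_mul_eq_div]
      ring
    rw [h3] at h1
    linarith
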